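/- **Theorem (Morse method for categories).** For a small category $\mathcal{C}$ let $B\mathcal{C}$ be its classifying space (the geometric realization of its nerve); topological notions applied to $\mathcal{C}$, such as $\pi_k(\mathcal{C},x):=\pi_k(B\mathcal{C},x)$, refer to $B\mathcal{C}$. A space is called $n$-connected if it is non-empty and its $\pi_k$ is trivial at every base point for $0\le k\le n$. For categories $\mathcal{A},\mathcal{B}$ the join $\mathcal{A}*\mathcal{B}$ is the disjoint union of $\mathcal{A}$ and $\mathcal{B}$ together with exactly one additional arrow $A\to B$ for each pair of objects $A$ of $\mathcal{A}$ and $B$ of $\mathcal{B}$. Let $\mathcal{X}$ be a small category and $\mathcal{X}_0\subseteq\mathcal{X}$ the full subcategory spanned by a collection of objects, such that $\operatorname{Hom}_{\mathcal{X}}(X,X)=\{\mathrm{id}_X\}$ for every object $X$ of $\mathcal{X}$ not in $\mathcal{X}_0$. Let the objects outside $\mathcal{X}_0$ be added successively in the order of ascending values of a function $f$ from the objects outside $\mathcal{X}_0$ to a well-ordered set $W$, where any two distinct objects $X,Y$ with $f(X)=f(Y)$ are independent, i.e. there is no arrow $X\to Y$ and no arrow $Y\to X$ in $\mathcal{X}$.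 (If $f$ is injective, objects are added one at a time and this condition is void.) For an object $X$ outside $\mathcal{X}_0$ let $\mathcal{X}_{<X}$ be the full subcategory of $\mathcal{X}$ spanned by the objects of $\mathcal{X}_0$ and the objects $Y$ outside $\mathcal{X}_0$ with $f(Y)<f(X)$. The descending link of $X$ is the join $$lk_{\downarrow}(X):=(\mathcal{X}_{<X}{\downarrow}X)*(X{\downarrow}\mathcal{X}_{<X})$$ of the comma category of pairs $(Y,Y\to X)$ and the comma category of pairs $(Y,X\to Y)$, with $Y$ an object of $\mathcal{X}_{<X}$. Let $n\ge 0$, let $x_0$ be an object of $\mathcal{X}_0$, and assume that $lk_{\downarrow}(X)$ is $n$-connected for every object $X$ outside $\mathcal{X}_0$. Then the inclusion $\mathcal{X}_0\hookrightarrow\mathcal{X}$ induces isomorphisms $$\pi_k(\mathcal{X}_0,x_0)\cong\pi_k(\mathcal{X},x_0)\qquad\text{for } k=0,\ldots,n$$ (bijections for $k=0$, group isomorphisms for $1\le k\le n$). -/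

import Mathlib

open CategoryTheory Topology
open scoped Simplicial

universe w v u

/-! ### Classifying spaces of small categories -/

/-- The classifying space `B C` of a category: the geometric realization of its nerve. -/
noncomputable def classifyingSpace (C : Type u) [Category.{v} C] : TopCat.{max u v} :=
  SSet.toTop.obj (nerve C)

/-- The continuous map `B F : B C → B D` induced by a functor `F : C ⥤ D`. -/
noncomputable def classifyingMap {C D : Type u} [Category.{v} C] [Category.{v} D] (F : C ⥤ D) :
    C(classifyingSpace C, classifyingSpace D) :=
  (SSet.toTop.map (nerveMap F)).hom

/-- The point of `B C` given by an object `x`: the image of the unique point of the standard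
`0`-simplex under the characteristic map of the `0`-simplex `x` of the nerve. -/
noncomputable def classifyingVertex {C : Type u} [Category.{v} C] (x : C) : classifyingSpace C :=
  (SSet.toTop.obj (nerve C)).toSSetObjEquiv (Opposite.op ⦋0⦌)
    ((sSetTopAdj.unit.app (nerve C)).app (Opposite.op ⦋0⦌) (ComposableArrows.mk₀ x))
    (stdSimplex.vertex (S := ℝ) (0 : Fin 1))

theorem classifyingMap_vertex {C D : Type u} [Category.{v} C] [Category.{v} D] (F : C ⥤ D)
    (x : C) : classifyingMap F (classifyingVertex x) = classifyingVertex (F.obj x) := by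
  have h := congrArg (fun t => t.app (Opposite.op ⦋0⦌) (ComposableArrows.mk₀ x))
    (sSetTopAdj.unit.naturality (nerveMap F))
  unfold classifyingVertex
  rw [← nerveMap_app_mk₀]
  exact (congrArg (fun s => (SSet.toTop.obj (nerve D)).toSSetObjEquiv (Opposite.op ⦋0⦌) s
    (stdSimplex.vertex (S := ℝ) (0 : Fin 1))) h).symm

/-! ### Homotopy groups -/

/-- Postcomposition of a `k`-dimensional loop at `x` with a continuous map sending `x` to `y`. -/
def genLoopMap {X Y : Type*} [TopologicalSpace X] [TopologicalSpace Y] (k : ℕ) (g : C(X, Y))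
    {x : X} {y : Y} (h : g x = y) (p : GenLoop (Fin k) X x) : GenLoop (Fin k) Y y :=
  ⟨g.comp p.1, fun t ht => (congrArg g (p.2 t ht)).trans h⟩

/-- The map `π_k(X, x) → π_k(Y, y)` induced by a continuous map `g : X → Y` with `g x = y`. -/
def homotopyGroupMap {X Y : Type*} [TopologicalSpace X] [TopologicalSpace Y] (k : ℕ) (g : C(X, Y))
    {x : X} {y : Y} (h : g x = y) : HomotopyGroup.Pi k X x → HomotopyGroup.Pi k Y y :=
  Quotient.map (genLoopMap k g h) fun _ _ hpq => hpq.map fun H => H.compContinuousMap g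

/-- A space is `n`-connected if it is non-empty and `π_k` is trivial at all base points for all
`0 ≤ k ≤ n` (for `k = 0` this says that it is path-connected). -/
def IsNConnected (n : ℕ) (X : Type*) [TopologicalSpace X] : Prop :=
  Nonempty X ∧ ∀ k ≤ n, ∀ x : X, Subsingleton (HomotopyGroup.Pi k X x)

/-! ### Building up a category and descending links -/

section Morse

variable {C : Type u} [Category.{v} C] {W : Type w} [LinearOrder W]

/-- `f` encodes an adding order for the objects outside `P`: distinct objects which are added at
the same time are independent, i.e. there is no arrow between them. If `f` is injective, the
objects are added one at a time and the condition is void. -/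
def IsMorseFunction (P : ObjectProperty C) (f : {x : C // ¬ P x} → W) : Prop :=
  ∀ x y : {x : C // ¬ P x}, x ≠ y → f x = f y → IsEmpty (x.1 ⟶ y.1)

/-- The objects that are present just before `x` is added. -/
def addedBefore (P : ObjectProperty C) (f : {x : C // ¬ P x} → W) (x : {x : C // ¬ P x}) :
    ObjectProperty C :=
  fun y => P y ∨ ∃ h : ¬ P y, f ⟨y, h⟩ < f x

/-- The descending up link of `x`: pairs `(y, y ⟶ x)` with `y` added before `x`. -/
abbrev descendingUpLink (P : ObjectProperty C) (f : {x : C // ¬ P x} → W)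
    (x : {x : C // ¬ P x}) : Type (max u v) :=
  CostructuredArrow (addedBefore P f x).ι x.1

/-- The descending down link of `x`: pairs `(y, x ⟶ y)` with `y` added before `x`. -/
abbrev descendingDownLink (P : ObjectProperty C) (f : {x : C // ¬ P x} → W)
    (x : {x : C // ¬ P x}) : Type (max u v) :=
  StructuredArrow x.1 (addedBefore P f x).ι

/-- The descending link of `x`: the join of the descending up link and the descending down link,
with exactly one arrow from each object of the former to each object of the latter. -/
abbrev descendingLink (P : ObjectProperty C) (f : {x : C // ¬ P x} → W)
    (x : {x : C // ¬ P x}) : Type (max u v) :=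
  Join (descendingUpLink P f x) (descendingDownLink P f x)

end Morse

/-! The heart is a compression statement, `exists_homotopicRel_compress`: a cube in `BC` of
dimension at most `n + 1` whose boundary is supported on objects of `P` can be deformed, relative to
its boundary, until all of it is supported on `P`. Cubes of dimension `k ≤ n` give surjectivity on
`π_k`; homotopies, read as cubes of dimension `k + 1`, give injectivity.

A cube is compact, so its support contains only finitely many objects outside `P`. Those of greatest
`f`-value are removed one at a time. New objects may enter, but only from `P` or with smaller value,
so well-foundedness of `W` ends the process. To remove an object `x`, two cases are distinguished.

If no earlier object has arrows both from and to `x`, then near `x` the space is a cone on the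
descending link: since `x` has only the identity endomorphism, a chain through `x` is a chain of the
link with `x` inserted between its two halves. Points with weight `1/2` at `x` correspond to points
of the classifying space of the link. Where the weight at `x` exceeds `1/2`, the cube is replaced by
an extension, inside the link, of its values on the level set; this exists because the link is
`n`-connected. Old and new cube coincide once the points of weight at least `1/2` are collapsed to
the vertex `x`, so they are homotopic, and the new one can be pushed off `x`
(`exists_homotopicRel_of_link`).

If some earlier `z` has arrows `x ⟶ z ⟶ x`, chains may pass through `x` repeatedly and the cone
picture fails. But then `x` is a retract of `z`, and `z` can be inserted before the first `x` of a
chain. Moving weight to it lowers the number of alternations between `x` and other objects until `x`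
is gone; connectivity plays no role here (`exists_homotopicRel_of_retract`).

All maps are written in coordinates: a point is a chain with weights, a map is a family of functions
of weighted chains natural in the indexing order (`exists_chainPoint_lift`), and continuity is
tested on simplices. -/

/-! ### Points of classifying spaces as weighted chains -/

section Chains

variable {C : Type u} [Category.{v} C]

/-- The characteristic map of a simplex of the nerve. -/
noncomputable def characteristicMap {m : ℕ} (F : Fin (m + 1) ⥤ C) :
    C(stdSimplex ℝ (Fin (m + 1)), classifyingSpace C) :=
  (SSet.toTop.obj (nerve C)).toSSetObjEquiv (Opposite.op ⦋m⦌)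
    ((sSetTopAdj.unit.app (nerve C)).app (Opposite.op ⦋m⦌) F)

theorem characteristicMap_comp {m k : ℕ} (θ : Fin (m + 1) →o Fin (k + 1)) (G : Fin (k + 1) ⥤ C)
    (t : stdSimplex ℝ (Fin (m + 1))) :
    characteristicMap (θ.monotone.functor ⋙ G) t = characteristicMap G (stdSimplex.map θ t) := by
  let f : (⦋m⦌ : SimplexCategory) ⟶ ⦋k⦌ := SimplexCategory.mkHom θ
  have h := (sSetTopAdj.unit.app (nerve C)).naturality f.op
  have h2 := congrArg (fun z => (SSet.toTop.obj (nerve C)).toSSetObjEquiv (Opposite.op ⦋m⦌) z t)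
    (ConcreteCategory.congr_hom h G)
  exact h2

theorem characteristicMap_comp_functor {D : Type u} [Category.{v} D] (K : C ⥤ D) {m : ℕ}
    (F : Fin (m + 1) ⥤ C) (t : stdSimplex ℝ (Fin (m + 1))) :
    classifyingMap K (characteristicMap F t) = characteristicMap (F ⋙ K) t := by
  have h := congrArg (fun z => (SSet.toTop.obj (nerve D)).toSSetObjEquiv (Opposite.op ⦋m⦌)
    (z.app (Opposite.op ⦋m⦌) F) t) (sSetTopAdj.unit.naturality (nerveMap K))
  exact h.symm

variable (C) in
/-- Representatives of the points of the classifying space. -/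
abbrev ChainRep : Type (max u v) :=
  Σ s : (Σ m : ℕ, (Fin (m + 1) ⥤ C)), stdSimplex ℝ (Fin (s.1 + 1))

/-- The elementary identifications between representatives. -/
def chainRel (a b : ChainRep C) : Prop :=
  ∃ (θ : Fin (a.1.1 + 1) →o Fin (b.1.1 + 1)), a.1.2 = θ.monotone.functor ⋙ b.1.2 ∧
    b.2 = stdSimplex.map θ a.2

variable (C) in
/-- The point given by a representative. -/
noncomputable def chainProj (a : ChainRep C) : classifyingSpace C := characteristicMap a.1.2 a.2

theorem chainProj_eq_of_rel {a b : ChainRep C} (h : chainRel a b) :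
    chainProj C a = chainProj C b := by
  obtain ⟨⟨m, F⟩, t⟩ := a
  obtain ⟨⟨k, G⟩, s⟩ := b
  obtain ⟨θ, h1, h2⟩ := h
  calc characteristicMap F t = characteristicMap (θ.monotone.functor ⋙ G) t :=
        congrArg (fun H => characteristicMap H t) h1
    _ = characteristicMap G (stdSimplex.map θ t) := characteristicMap_comp θ G t
    _ = characteristicMap G s := congrArg (characteristicMap G) h2.symm


variable (C) in
/-- The space obtained by glueing simplices. -/
def ChainQuot : Type (max u v) := Quot (chainRel (C := C))

instance : TopologicalSpace (ChainQuot C) := inferInstanceAs (TopologicalSpace (Quot _))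

/-- The simplicial map to the singular simplices of the glued space. -/
noncomputable def toSingChainQuot : nerve C ⟶ TopCat.toSSet.obj (TopCat.of (ChainQuot C)) where
  app m := ↾fun F => ((TopCat.of (ChainQuot C)).toSSetObjEquiv m).symm
    ⟨fun t => Quot.mk _ ⟨⟨m.unop.len, F⟩, t⟩,
      continuous_quot_mk.comp (continuous_sigmaMk (σ := fun s : (Σ m : ℕ, (Fin (m + 1) ⥤ C)) =>
        stdSimplex ℝ (Fin (s.1 + 1))) (i := ⟨m.unop.len, F⟩))⟩
  naturality m k f := by
    ext F
    apply ((TopCat.of (ChainQuot C)).toSSetObjEquiv k).injective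
    ext t
    exact Quot.sound ⟨SimplexCategory.Hom.toOrderHom f.unop, rfl, rfl⟩

/-- The comparison map from the realization to the glued space. -/
noncomputable def toChainQuot : C(classifyingSpace C, ChainQuot C) :=
  ((sSetTopAdj.homEquiv (nerve C) (TopCat.of (ChainQuot C))).symm toSingChainQuot).hom

theorem toChainQuot_chainProj (a : ChainRep C) : toChainQuot (chainProj C a) = Quot.mk _ a := by
  have h : sSetTopAdj.unit.app (nerve C) ≫ TopCat.toSSet.map
      ((sSetTopAdj.homEquiv (nerve C) (TopCat.of (ChainQuot C))).symm toSingChainQuot)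
      = toSingChainQuot := by
    exact (Adjunction.homEquiv_unit ..).symm.trans (Equiv.apply_symm_apply _ _)
  have h2 := congrArg (fun z => (TopCat.of (ChainQuot C)).toSSetObjEquiv (Opposite.op ⦋a.1.1⦌)
    (z.app (Opposite.op ⦋a.1.1⦌) a.1.2) a.2) h
  exact h2

/-- The comparison map from the glued space to the realization. -/
noncomputable def ofChainQuot : C(ChainQuot C, classifyingSpace C) where
  toFun := Quot.lift (chainProj C) fun _ _ h => chainProj_eq_of_rel h
  continuous_toFun := by
    apply continuous_quot_lift
    rw [continuous_sigma_iff]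
    exact fun s => (characteristicMap s.2).continuous

/-- A map out of the realization is determined by its adjoint, that is, by its values on the
characteristic simplices, and there the composite is the identity. -/
theorem ofChainQuot_toChainQuot (p : classifyingSpace C) : ofChainQuot (toChainQuot p) = p := by
  have h : (sSetTopAdj.homEquiv (nerve C) (TopCat.of (ChainQuot C))).symm toSingChainQuot ≫
      TopCat.ofHom ofChainQuot = 𝟙 (SSet.toTop.obj (nerve C)) := by
    apply (sSetTopAdj.homEquiv _ _).injective
    ext m F
    apply ((SSet.toTop.obj (nerve C)).toSSetObjEquiv m).injective
    ext t
    exact congrArg ofChainQuot (toChainQuot_chainProj ⟨⟨m.unop.len, F⟩, t⟩)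
  exact ConcreteCategory.congr_hom h p

-- The realization is the quotient of the disjoint union of all simplices of the nerve, so maps out
-- of it may be defined, and tested for continuity, simplex by simplex.
variable (C) in
theorem isQuotientMap_chainProj : IsQuotientMap (chainProj C) := by
  let e : ChainQuot C ≃ₜ classifyingSpace C :=
    { toFun := ofChainQuot
      invFun := toChainQuot
      left_inv := by
        rintro ⟨a⟩
        exact toChainQuot_chainProj a
      right_inv := ofChainQuot_toChainQuot
      continuous_toFun := ofChainQuot.continuous
      continuous_invFun := toChainQuot.continuous }
  exact e.isQuotientMap.comp isQuotientMap_quot_mk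

/-- Functions on the classifying space are compatible families of functions on simplices. -/
theorem exists_chainProj_lift {S : Sort*} (f : ChainRep C → S)
    (hf : ∀ a b, chainRel a b → f a = f b) :
    ∃ Φ : classifyingSpace C → S, ∀ a, Φ (chainProj C a) = f a :=
  ⟨fun p => Quot.lift (r := chainRel) f hf (toChainQuot p : Quot (chainRel (C := C))), fun a =>
    congrArg (Quot.lift (r := chainRel) f hf) (toChainQuot_chainProj a)⟩

end Chains

/-! ### Chains indexed by arbitrary finite linear orders -/

section ChainPoints

variable {C : Type u} [Category.{v} C]
variable {ι κ : Type} [LinearOrder ι] [Fintype ι] [Nonempty ι] [LinearOrder κ] [Fintype κ]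
  [Nonempty κ]

open scoped Classical in
/-- The push-forward of weights. -/
noncomputable def pushWeight {α β : Type} [Fintype α] (θ : α → β) (t : α → ℝ) : β → ℝ := fun k => ∑ l with θ l = k, t l

theorem stdSimplex_map_coe {α β : Type} [Fintype α] [Fintype β] (θ : α → β) (t : stdSimplex ℝ α) :
    (stdSimplex.map θ t).1 = pushWeight θ t.1 := by
  classical
  funext k
  exact FunOnFinite.linearMap_apply_apply ..

theorem pushWeight_mem {α β : Type} [Fintype α] [Fintype β] (θ : α → β) {t : α → ℝ}
    (ht : t ∈ stdSimplex ℝ α) : pushWeight θ t ∈ stdSimplex ℝ β := by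
  rw [← stdSimplex_map_coe θ ⟨t, ht⟩]
  exact (stdSimplex.map θ ⟨t, ht⟩).2

variable (ι) in
/-- The increasing enumeration of a finite nonempty linear order. -/
noncomputable def chainEnum : Fin (Fintype.card ι - 1 + 1) ≃o ι :=
  monoEquivOfFin ι (Nat.sub_add_cancel Fintype.card_pos).symm

theorem comp_equiv_mem_stdSimplex {α β : Type*} [Fintype α] [Fintype β] (e : α ≃ β) {t : β → ℝ}
    (h : t ∈ stdSimplex ℝ β) : t ∘ e ∈ stdSimplex ℝ α :=
  ⟨fun _ => h.1 _, (e.sum_comp t).trans h.2⟩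

open scoped Classical in
/-- The point of the classifying space given by a chain with weights on its objects. -/
noncomputable def chainPoint (F : ι ⥤ C) (t : ι → ℝ) : classifyingSpace C :=
  if h : t ∈ stdSimplex ℝ ι then characteristicMap ((chainEnum ι).monotone.functor ⋙ F)
    ⟨t ∘ chainEnum ι, comp_equiv_mem_stdSimplex (chainEnum ι).toEquiv h⟩
  -- A junk value for weights outside the simplex; it keeps membership proofs out of the terms.
  else characteristicMap ((chainEnum ι).monotone.functor ⋙ F) (stdSimplex.vertex 0)

theorem chainPoint_of_mem (F : ι ⥤ C) {t : ι → ℝ} (h : t ∈ stdSimplex ℝ ι) :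
    chainPoint F t = characteristicMap ((chainEnum ι).monotone.functor ⋙ F)
      ⟨t ∘ chainEnum ι, comp_equiv_mem_stdSimplex (chainEnum ι).toEquiv h⟩ := dif_pos h

theorem monotone_functor_congr {α β : Type*} [Preorder α] [Preorder β] {f g : α → β}
    (hf : Monotone f) (hg : Monotone g) (h : f = g) (G : β ⥤ C) :
    hf.functor ⋙ G = hg.functor ⋙ G := by
  subst h
  rfl

/-- The single source of identifications: repeated objects joined by identities merge with their
weights added, and objects outside the image of `θ` appear with weight zero. -/
theorem chainPoint_comp {θ : ι → κ} (hθ : Monotone θ) (G : κ ⥤ C) {t : ι → ℝ}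
    (ht : t ∈ stdSimplex ℝ ι) :
    chainPoint (hθ.functor ⋙ G) t = chainPoint G (pushWeight θ t) := by
  classical
  rw [chainPoint_of_mem _ ht, chainPoint_of_mem _ (pushWeight_mem θ ht)]
  let f : Fin (Fintype.card ι - 1 + 1) →o Fin (Fintype.card κ - 1 + 1) :=
    ⟨fun i => (chainEnum κ).symm (θ (chainEnum ι i)), fun i j h =>
      (chainEnum κ).symm.monotone (hθ ((chainEnum ι).monotone h))⟩
  have hf : ∀ i, f i = (chainEnum κ).symm (θ (chainEnum ι i)) := fun _ => rfl
  have h1 : (chainEnum ι).monotone.functor ⋙ hθ.functor ⋙ G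
      = f.monotone.functor ⋙ ((chainEnum κ).monotone.functor ⋙ G) :=
    monotone_functor_congr (hθ.comp (chainEnum ι).monotone)
      ((chainEnum κ).monotone.comp f.monotone) (by funext i; simp [hf]) G
  rw [h1, characteristicMap_comp]
  congr 1
  apply Subtype.ext
  rw [stdSimplex_map_coe]
  funext k
  simp only [pushWeight, Function.comp_apply]
  refine Finset.sum_bij' (fun l _ => chainEnum ι l) (fun l _ => (chainEnum ι).symm l) ?_ ?_ ?_ ?_ ?_
  · intro l hl
    simp only [Finset.mem_filter, Finset.mem_univ, true_and] at hl ⊢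
    rw [← hl]
    simp [hf]
  · intro l hl
    simp only [Finset.mem_filter, Finset.mem_univ, true_and] at hl ⊢
    simp [hf, hl]
  all_goals simp

theorem chainPoint_eq_of_map {θ : ι → κ} (hθ : Monotone θ) {F : ι ⥤ C} {G : κ ⥤ C} {t : ι → ℝ}
    {s : κ → ℝ} (ht : t ∈ stdSimplex ℝ ι) (hF : F = hθ.functor ⋙ G) (hs : s = pushWeight θ t) :
    chainPoint F t = chainPoint G s := by
  rw [hF, hs, chainPoint_comp hθ G ht]

theorem chainPoint_fin {m : ℕ} (F : Fin (m + 1) ⥤ C) (t : stdSimplex ℝ (Fin (m + 1))) :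
    chainPoint F t.1 = characteristicMap F t := by
  rw [chainPoint_of_mem F t.2]
  have hcard : Fintype.card (Fin (m + 1)) - 1 + 1 = m + 1 := by simp
  let f : Fin (Fintype.card (Fin (m + 1)) - 1 + 1) →o Fin (m + 1) :=
    ⟨chainEnum (Fin (m + 1)), (chainEnum (Fin (m + 1))).monotone⟩
  have := characteristicMap_comp f F ⟨t.1 ∘ chainEnum (Fin (m + 1)),
    comp_equiv_mem_stdSimplex (chainEnum _).toEquiv t.2⟩
  refine this.trans ?_
  congr 1
  apply Subtype.ext
  rw [stdSimplex_map_coe]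
  funext k
  classical
  simp only [pushWeight, Function.comp_apply]
  rw [Finset.sum_eq_single ((chainEnum (Fin (m + 1))).symm k)]
  · simp
  · intro b hb hne
    simp only [Finset.mem_filter, Finset.mem_univ, true_and] at hb
    exact absurd (by rw [← hb]; simp [f]) hne
  · simp [f]

theorem exists_chainPoint (p : classifyingSpace C) :
    ∃ (m : ℕ) (F : Fin (m + 1) ⥤ C) (t : Fin (m + 1) → ℝ), t ∈ stdSimplex ℝ (Fin (m + 1)) ∧
      chainPoint F t = p := by
  obtain ⟨⟨⟨m, F⟩, t⟩, rfl⟩ := (isQuotientMap_chainProj C).surjective p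
  exact ⟨m, F, t, t.2, chainPoint_fin F t⟩

theorem continuousOn_chainPoint (F : ι ⥤ C) : ContinuousOn (chainPoint F) (stdSimplex ℝ ι) := by
  rw [continuousOn_iff_continuous_domRestrict]
  have : (stdSimplex ℝ ι).domRestrict (chainPoint F) = fun t : stdSimplex ℝ ι =>
      characteristicMap ((chainEnum ι).monotone.functor ⋙ F)
      ⟨t.1 ∘ chainEnum ι, comp_equiv_mem_stdSimplex (chainEnum ι).toEquiv t.2⟩ := by
    funext t
    exact chainPoint_of_mem F t.2
  rw [this]
  refine (map_continuous _).comp (Continuous.subtype_mk ?_ _)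
  exact continuous_pi fun i => (continuous_apply _).comp continuous_subtype_val

/-- Functions on the classifying space are natural families of functions of weighted chains. -/
theorem exists_chainPoint_lift {S : Sort*}
    (f : ∀ (ι : Type) [LinearOrder ι] [Fintype ι] [Nonempty ι], (ι ⥤ C) → (ι → ℝ) → S)
    (hf : ∀ (ι κ : Type) [LinearOrder ι] [Fintype ι] [Nonempty ι] [LinearOrder κ] [Fintype κ]
      [Nonempty κ] (θ : ι → κ) (hθ : Monotone θ) (G : κ ⥤ C) (t : ι → ℝ),
      t ∈ stdSimplex ℝ ι → f ι (hθ.functor ⋙ G) t = f κ G (pushWeight θ t)) :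
    ∃ Φ : classifyingSpace C → S, ∀ (ι : Type) [LinearOrder ι] [Fintype ι] [Nonempty ι]
      (F : ι ⥤ C) (t : ι → ℝ), t ∈ stdSimplex ℝ ι → Φ (chainPoint F t) = f ι F t := by
  obtain ⟨Φ, hΦ⟩ := exists_chainProj_lift (C := C) (fun a => f _ a.1.2 a.2.1) (by
    rintro ⟨⟨m, F⟩, t⟩ ⟨⟨k, G⟩, s⟩ ⟨θ, h1, h2⟩
    change F = θ.monotone.functor ⋙ G at h1
    have h3 : s.1 = pushWeight θ t.1 := by
      rw [← stdSimplex_map_coe]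
      exact congrArg Subtype.val h2
    change f _ F t.1 = f _ G s.1
    rw [h3, ← hf _ _ θ θ.monotone G t.1 t.2]
    exact congrArg (fun H => f _ H _) h1)
  refine ⟨Φ, ?_⟩
  intro ι _ _ _ F t ht
  classical
  rw [chainPoint_of_mem F ht]
  refine (hΦ ⟨⟨_, _⟩, _⟩).trans ?_
  refine (hf _ _ (chainEnum ι) (chainEnum ι).monotone F (t ∘ chainEnum ι)
    (comp_equiv_mem_stdSimplex (chainEnum ι).toEquiv ht)).trans ?_
  congr 1
  funext k
  simp only [pushWeight, Function.comp_apply]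
  rw [Finset.sum_eq_single ((chainEnum ι).symm k)]
  · simp
  · intro b hb hne
    simp only [Finset.mem_filter, Finset.mem_univ, true_and] at hb
    exact absurd (by rw [← hb]; simp) hne
  · simp

/-- Openness of a preimage inside the open set `O` can be checked on simplices by the quotient
property. This serves maps which are only continuous where some weight is positive. -/
theorem continuousOn_of_chainPoint {S : Type*} [TopologicalSpace S] {Φ : classifyingSpace C → S}
    {O : Set (classifyingSpace C)} (hO : IsOpen O)
    (h : ∀ (m : ℕ) (F : Fin (m + 1) ⥤ C), ContinuousOn (fun t => Φ (chainPoint F t))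
      (stdSimplex ℝ (Fin (m + 1)) ∩ chainPoint F ⁻¹' O)) : ContinuousOn Φ O := by
  rw [continuousOn_open_iff hO]
  intro A hA
  rw [← (isQuotientMap_chainProj C).isOpen_preimage, isOpen_sigma_iff]
  rintro ⟨m, F⟩
  have hO' : IsOpen (characteristicMap F ⁻¹' O) :=
    hO.preimage (map_continuous _)
  have h1 : ContinuousOn (fun t : stdSimplex ℝ (Fin (m + 1)) => Φ (characteristicMap F t))
      (characteristicMap F ⁻¹' O) := by
    have := (h m F).comp (f := fun t : stdSimplex ℝ (Fin (m + 1)) => t.1)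
      (s := (characteristicMap F ⁻¹' O)) continuous_subtype_val.continuousOn
      (fun t ht => ⟨t.2, by rw [Set.mem_preimage, chainPoint_fin]; exact ht⟩)
    refine this.congr fun t _ => ?_
    simp [chainPoint_fin]
  exact (continuousOn_open_iff hO').1 h1 A hA

theorem continuous_of_chainPoint {S : Type*} [TopologicalSpace S] {Φ : classifyingSpace C → S}
    (h : ∀ (m : ℕ) (F : Fin (m + 1) ⥤ C), ContinuousOn (fun t => Φ (chainPoint F t))
      (stdSimplex ℝ (Fin (m + 1)))) : Continuous Φ := by
  rw [← continuousOn_univ]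
  exact continuousOn_of_chainPoint isOpen_univ fun m F => (h m F).mono fun t ht => ht.1

theorem classifyingMap_chainPoint {D : Type u} [Category.{v} D] (K : C ⥤ D) (F : ι ⥤ C)
    {t : ι → ℝ} (ht : t ∈ stdSimplex ℝ ι) :
    classifyingMap K (chainPoint F t) = chainPoint (F ⋙ K) t := by
  rw [chainPoint_of_mem F ht, chainPoint_of_mem _ ht, characteristicMap_comp_functor]
  rfl

theorem classifyingVertex_eq_chainPoint (x : C) :
    classifyingVertex x = chainPoint (ComposableArrows.mk₀ x) (fun _ : Fin 1 => (1 : ℝ)) := by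
  have h : (fun _ : Fin 1 => (1 : ℝ)) = (stdSimplex.vertex (S := ℝ) (0 : Fin 1)).1 := by
    funext i
    rw [Subsingleton.elim i 0]
    simp
  rw [h]
  exact (chainPoint_fin (m := 0) (ComposableArrows.mk₀ x) (stdSimplex.vertex 0)).symm

end ChainPoints

/-! ### Continuity of homotopies -/

section Continuity

variable {C : Type u} [Category.{v} C]

/-- The product of a quotient map with a locally compact space is again a quotient map; for `Y = I`
this makes homotopies testable on simplices. -/
theorem isOpen_prod_of_chainPoint {Y : Type*} [TopologicalSpace Y] [LocallyCompactSpace Y]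
    {A : Set (classifyingSpace C × Y)}
    (h : ∀ (m : ℕ) (F : Fin (m + 1) ⥤ C), IsOpen ((fun q : stdSimplex ℝ (Fin (m + 1)) × Y =>
      (chainPoint F q.1.1, q.2)) ⁻¹' A)) : IsOpen A := by
  refine continuous_Prop.1 (?_ : Continuous fun q => q ∈ A)
  apply (isQuotientMap_chainProj C).continuous_lift_prod_left
  rw [← (Homeomorph.sigmaProdDistrib (X := fun s : (Σ m : ℕ, (Fin (m + 1) ⥤ C)) =>
    stdSimplex ℝ (Fin (s.1 + 1))) (Y := Y)).symm.comp_continuous_iff', continuous_sigma_iff]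
  rintro ⟨m, F⟩
  rw [continuous_Prop]
  convert! h m F using 1
  ext q
  simp only [Set.mem_preimage, chainPoint_fin]
  rfl

theorem continuousOn_prod_of_chainPoint {Y S : Type*} [TopologicalSpace Y] [LocallyCompactSpace Y]
    [TopologicalSpace S] {Φ : classifyingSpace C → Y → S} {O : Set (classifyingSpace C)}
    (hO : IsOpen O)
    (h : ∀ (m : ℕ) (F : Fin (m + 1) ⥤ C),
      ContinuousOn (fun q : (Fin (m + 1) → ℝ) × Y => Φ (chainPoint F q.1) q.2)
      ((stdSimplex ℝ (Fin (m + 1)) ∩ chainPoint F ⁻¹' O) ×ˢ Set.univ)) :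
    ContinuousOn (fun q : classifyingSpace C × Y => Φ q.1 q.2) (O ×ˢ Set.univ) := by
  rw [continuousOn_open_iff (hO.prod isOpen_univ)]
  intro A hA
  refine isOpen_prod_of_chainPoint fun m F => ?_
  have hc : Continuous fun q : stdSimplex ℝ (Fin (m + 1)) × Y => chainPoint F q.1.1 := by
    simp only [chainPoint_fin]
    fun_prop
  have hO' : IsOpen ((fun q : stdSimplex ℝ (Fin (m + 1)) × Y => chainPoint F q.1.1) ⁻¹' O) :=
    hO.preimage hc
  have h1 := (h m F).comp (f := fun q : stdSimplex ℝ (Fin (m + 1)) × Y => (q.1.1, q.2))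
    (s := (fun q : stdSimplex ℝ (Fin (m + 1)) × Y => chainPoint F q.1.1) ⁻¹' O)
    (by fun_prop) (fun q hq => ⟨⟨q.1.2, hq⟩, Set.mem_univ _⟩)
  convert! (continuousOn_open_iff hO').1 h1 A hA using 1
  ext q
  simp

end Continuity

/-! ### The mass of a point on a class of objects -/

section Mass

variable {C : Type u} [Category.{v} C]
variable {ι κ : Type} [LinearOrder ι] [Fintype ι] [Nonempty ι] [LinearOrder κ] [Fintype κ]
  [Nonempty κ]

open scoped Classical in
theorem sum_pushWeight {α β : Type} [Fintype α] [Fintype β] (θ : α → β) (t : α → ℝ)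
    (q : β → Prop) : ∑ k with q k, pushWeight θ t k = ∑ l with q (θ l), t l := by
  simp only [pushWeight]
  rw [Finset.sum_comm' (t' := Finset.univ.filter fun l => q (θ l)) (s' := fun l => {θ l})]
  · simp
  · intro k l
    simp only [Finset.mem_filter, Finset.mem_univ, true_and, Finset.mem_singleton]
    constructor
    · rintro ⟨h1, h2⟩
      exact ⟨h2.symm, h2 ▸ h1⟩
    · rintro ⟨h1, h2⟩
      exact ⟨h1 ▸ h2, h1.symm⟩

/-- Rescaling by factors that are pulled back along `θ` commutes with push-forward. This is why all
later reweightings are natural. -/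
theorem pushWeight_mul {α β : Type} [Fintype α] (θ : α → β) (t : α → ℝ) (c : β → ℝ) :
    pushWeight θ (fun l => c (θ l) * t l) = fun k => c k * pushWeight θ t k := by
  classical
  funext k
  simp only [pushWeight, Finset.mul_sum]
  refine Finset.sum_congr rfl fun l hl => ?_
  simp only [Finset.mem_filter, Finset.mem_univ, true_and] at hl
  rw [hl]

open scoped Classical in
/-- The total weight of the objects of a chain satisfying a predicate. -/
noncomputable def chainMass (A : C → Prop) (F : ι ⥤ C) (t : ι → ℝ) : ℝ := ∑ k with A (F.obj k), t k

variable (C) in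
theorem exists_mass (A : C → Prop) : ∃ Φ : classifyingSpace C → ℝ, ∀ (ι : Type) [LinearOrder ι]
    [Fintype ι] [Nonempty ι] (F : ι ⥤ C) (t : ι → ℝ), t ∈ stdSimplex ℝ ι →
    Φ (chainPoint F t) = chainMass A F t :=
  exists_chainPoint_lift (fun ι _ _ _ F t => chainMass A F t) fun ι κ _ _ _ _ _ _ θ hθ G t _ => by
    classical
    exact (sum_pushWeight θ t (fun k => A (G.obj k))).symm

/-- The mass which a point of the classifying space has on the objects satisfying a predicate. -/
noncomputable def mass (A : C → Prop) (p : classifyingSpace C) : ℝ :=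
  Classical.choose (exists_mass C A) p

theorem mass_chainPoint (A : C → Prop) (F : ι ⥤ C) {t : ι → ℝ} (ht : t ∈ stdSimplex ℝ ι) :
    mass A (chainPoint F t) = chainMass A F t :=
  Classical.choose_spec (exists_mass C A) ι F t ht

theorem continuous_chainMass (A : C → Prop) (F : ι ⥤ C) : Continuous (chainMass A F) := by
  unfold chainMass
  fun_prop

theorem continuous_mass (A : C → Prop) : Continuous (mass A) :=
  continuous_of_chainPoint fun _ F =>
    (continuous_chainMass A F).continuousOn.congr fun _ ht => mass_chainPoint A F ht

theorem chainMass_nonneg (A : C → Prop) (F : ι ⥤ C) {t : ι → ℝ} (ht : t ∈ stdSimplex ℝ ι) :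
    0 ≤ chainMass A F t := Finset.sum_nonneg fun k _ => ht.1 k

theorem mass_nonneg (A : C → Prop) (p : classifyingSpace C) : 0 ≤ mass A p := by
  obtain ⟨m, F, t, ht, rfl⟩ := exists_chainPoint p
  rw [mass_chainPoint A F ht]
  exact chainMass_nonneg A F ht

theorem mass_add_mass_not (A : C → Prop) (p : classifyingSpace C) :
    mass A p + mass (fun c => ¬ A c) p = 1 := by
  classical
  obtain ⟨m, F, t, ht, rfl⟩ := exists_chainPoint p
  rw [mass_chainPoint A F ht, mass_chainPoint _ F ht, ← ht.2]
  unfold chainMass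
  convert Finset.sum_filter_add_sum_filter_not Finset.univ (fun k => A (F.obj k)) t

theorem mass_mono {A B : C → Prop} (h : ∀ c, A c → B c) (p : classifyingSpace C) :
    mass A p ≤ mass B p := by
  classical
  obtain ⟨m, F, t, ht, rfl⟩ := exists_chainPoint p
  rw [mass_chainPoint A F ht, mass_chainPoint _ F ht]
  refine Finset.sum_le_sum_of_subset_of_nonneg (fun k => ?_) fun k _ _ => ht.1 k
  simp only [Finset.mem_filter, Finset.mem_univ, true_and]
  exact h _

theorem mass_eq_zero_mono {A B : C → Prop} (h : ∀ c, A c → B c) {p : classifyingSpace C}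
    (hp : mass B p = 0) : mass A p = 0 :=
  le_antisymm ((mass_mono h p).trans hp.le) (mass_nonneg A p)

theorem chainMass_eq_zero_iff (A : C → Prop) (F : ι ⥤ C) {t : ι → ℝ} (ht : t ∈ stdSimplex ℝ ι) :
    chainMass A F t = 0 ↔ ∀ k, A (F.obj k) → t k = 0 := by
  classical
  unfold chainMass
  rw [Finset.sum_eq_zero_iff_of_nonneg fun k _ => ht.1 k]
  simp

theorem mass_or_eq_zero {A B : C → Prop} {p : classifyingSpace C} (hA : mass A p = 0)
    (hB : mass B p = 0) : mass (fun c => A c ∨ B c) p = 0 := by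
  obtain ⟨m, F, t, ht, rfl⟩ := exists_chainPoint p
  rw [mass_chainPoint _ F ht, chainMass_eq_zero_iff _ F ht] at *
  rintro k (h | h)
  exacts [hA k h, hB k h]

theorem pushWeight_subtype_val {p : ι → Prop} [Fintype {k // p k}] {t : ι → ℝ}
    (h0 : ∀ k, ¬ p k → t k = 0) : t = pushWeight Subtype.val (fun k : {k // p k} => t k.1) := by
  classical
  funext k
  unfold pushWeight
  by_cases hk : p k
  · rw [Finset.sum_eq_single ⟨k, hk⟩]
    · intro b hb hne
      simp only [Finset.mem_filter, Finset.mem_univ, true_and] at hb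
      exact absurd (Subtype.ext hb) hne
    · simp
  · rw [h0 k hk, Finset.sum_eq_zero]
    intro b hb
    simp only [Finset.mem_filter, Finset.mem_univ, true_and] at hb
    exact absurd (hb ▸ b.2) hk

theorem subtype_weight_mem {p : ι → Prop} [Fintype {k // p k}] {t : ι → ℝ}
    (ht : t ∈ stdSimplex ℝ ι) (h0 : ∀ k, ¬ p k → t k = 0) :
    (fun k : {k // p k} => t k.1) ∈ stdSimplex ℝ {k // p k} := by
  classical
  refine ⟨fun k => ht.1 _, ?_⟩
  have h1 := sum_pushWeight (Subtype.val : {k // p k} → ι) (fun k => t k.1) (fun _ => True)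
  rw [← pushWeight_subtype_val h0] at h1
  simpa [ht.2] using h1.symm

/-- Objects of weight zero may be dropped from a chain. -/
theorem chainPoint_subtype (p : ι → Prop) [Fintype {k // p k}] [Nonempty {k // p k}] (F : ι ⥤ C)
    {t : ι → ℝ} (ht : t ∈ stdSimplex ℝ ι) (h0 : ∀ k, ¬ p k → t k = 0) :
    chainPoint ((Subtype.mono_coe p).functor ⋙ F) (fun k => t k.1) = chainPoint F t :=
  chainPoint_eq_of_map (Subtype.mono_coe p) (subtype_weight_mem ht h0) rfl
    (pushWeight_subtype_val h0)

theorem exists_pos_of_mem_stdSimplex {α : Type} [Fintype α] {t : α → ℝ}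
    (ht : t ∈ stdSimplex ℝ α) : ∃ k, 0 < t k := by
  by_contra! h
  have := Finset.sum_nonpos fun k (_ : k ∈ Finset.univ) => h k
  rw [ht.2] at this
  linarith

/-- Every point is given by a chain with positive weights. -/
theorem exists_chainPoint_pos (p : classifyingSpace C) :
    ∃ (ι : Type) (_ : LinearOrder ι) (_ : Fintype ι) (_ : Nonempty ι) (F : ι ⥤ C) (t : ι → ℝ),
      t ∈ stdSimplex ℝ ι ∧ (∀ k, 0 < t k) ∧ chainPoint F t = p := by
  classical
  obtain ⟨m, F, t, ht, rfl⟩ := exists_chainPoint p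
  have h0 : ∀ k, ¬ 0 < t k → t k = 0 := fun k hk => le_antisymm (not_lt.1 hk) (ht.1 k)
  obtain ⟨k, hk⟩ := exists_pos_of_mem_stdSimplex ht
  have : Nonempty {k // 0 < t k} := ⟨⟨k, hk⟩⟩
  exact ⟨{k // 0 < t k}, inferInstance, inferInstance, inferInstance, _, _,
    subtype_weight_mem ht h0, fun k => k.2, chainPoint_subtype (fun k => 0 < t k) F ht h0⟩

/-- Of a family of functions of which only finitely many are nonzero on each simplex, only finitely
many are nonzero on a compact set. -/
theorem finite_nonzero_of_isCompact {J : Type*} {φ : J → classifyingSpace C → ℝ}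
    (hφ : ∀ j, Continuous (φ j)) (h0 : ∀ j p, 0 ≤ φ j p)
    (hfin : ∀ (m : ℕ) (F : Fin (m + 1) ⥤ C),
      (Set.ofPred fun j => ∃ t ∈ stdSimplex ℝ (Fin (m + 1)), φ j (chainPoint F t) ≠ 0).Finite)
    {K : Set (classifyingSpace C)} (hK : IsCompact K) :
    (Set.ofPred fun j => ∃ p ∈ K, φ j p ≠ 0).Finite := by
  by_contra hinf
  have hinf : (Set.ofPred fun j => ∃ p ∈ K, φ j p ≠ 0).Infinite := hinf
  let e := hinf.natEmbedding
  choose p hpK hp using fun n => (e n).2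
  -- The scaling makes the `n`-th term equal to `n` at `p n`. The sum `f` is finite on each simplex,
  -- hence continuous, but unbounded on `K`.
  let c : ℕ → ℝ := fun n => n / φ (e n).1 (p n)
  have hc : ∀ n, 0 ≤ c n := fun n => div_nonneg n.cast_nonneg (h0 _ _)
  let f : classifyingSpace C → ℝ := fun q => ∑ᶠ n, c n * φ (e n).1 q
  have hinj : Function.Injective fun n => (e n).1 :=
    Subtype.val_injective.comp e.injective
  have hfin' : ∀ (m : ℕ) (F : Fin (m + 1) ⥤ C),
      (Set.ofPred fun n => ∃ t ∈ stdSimplex ℝ (Fin (m + 1)), φ (e n).1 (chainPoint F t) ≠ 0).Finite :=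
    fun m F => Set.Finite.preimage (f := fun n => (e n).1) (s := Set.ofPred fun j =>
      ∃ t ∈ stdSimplex ℝ (Fin (m + 1)), φ j (chainPoint F t) ≠ 0) hinj.injOn (hfin m F)
  have hsupp : ∀ (m : ℕ) (F : Fin (m + 1) ⥤ C), ∀ t ∈ stdSimplex ℝ (Fin (m + 1)),
      (Function.support fun n => c n * φ (e n).1 (chainPoint F t)) ⊆ (hfin' m F).toFinset := by
    intro m F t ht n hn
    simp only [Set.Finite.coe_toFinset]
    exact ⟨t, ht, fun h => hn (by simp [h])⟩
  have hf : Continuous f := by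
    refine continuous_of_chainPoint fun m F => ?_
    have : ContinuousOn (fun t => ∑ n ∈ (hfin' m F).toFinset, c n * φ (e n).1 (chainPoint F t))
        (stdSimplex ℝ (Fin (m + 1))) :=
      continuousOn_finsetSum _ fun n _ => continuousOn_const.mul
        ((hφ _).comp_continuousOn (continuousOn_chainPoint F))
    exact this.congr fun t ht => finsum_eq_sum_of_support_subset _ (hsupp m F t ht)
  obtain ⟨b, hb⟩ := (hK.image hf).bddAbove
  obtain ⟨n, hn⟩ := exists_nat_gt b
  have h1 : f (p n) ≤ b := hb ⟨p n, hpK n, rfl⟩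
  have h2 : (n : ℝ) ≤ f (p n) := by
    obtain ⟨m, F, t, ht, hpt⟩ := exists_chainPoint (p n)
    have h3 := finsum_eq_sum_of_support_subset _ (hsupp m F t ht)
    rw [hpt] at h3
    have h4 : n ∈ (hfin' m F).toFinset := by
      rw [Set.Finite.mem_toFinset]
      exact ⟨t, ht, by rw [hpt]; exact hp n⟩
    have h5 : c n * φ (e n).1 (p n) = n := div_mul_cancel₀ _ (hp n)
    change (n : ℝ) ≤ ∑ᶠ i, c i * φ (e i).1 (p n)
    rw [h3]
    calc (n : ℝ) = c n * φ (e n).1 (p n) := h5.symm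
      _ ≤ _ := Finset.single_le_sum (f := fun i => c i * φ (e i).1 (p n))
        (fun i _ => mul_nonneg (hc i) (h0 _ _)) h4
  linarith

end Mass

/-! ### Linear movement towards a class of objects -/

section Push

open scoped unitInterval

variable {C : Type u} [Category.{v} C]
variable {ι κ : Type} [LinearOrder ι] [Fintype ι] [Nonempty ι] [LinearOrder κ] [Fintype κ]
  [Nonempty κ]

theorem chainMass_comp (A : C → Prop) {θ : ι → κ} (hθ : Monotone θ) (G : κ ⥤ C) (t : ι → ℝ) :
    chainMass A (hθ.functor ⋙ G) t = chainMass A G (pushWeight θ t) := by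
  classical
  exact (sum_pushWeight θ t (fun k => A (G.obj k))).symm

open scoped Classical in
/-- The factors by which weights are multiplied when moving towards the objects satisfying `A`. -/
noncomputable def pushFactor (A : C → Prop) (F : ι ⥤ C) (s : ℝ) (t : ι → ℝ) (k : ι) : ℝ :=
  1 - s + s * (if A (F.obj k) then (chainMass A F t)⁻¹ else 0)

theorem pushFactor_nonneg (A : C → Prop) (F : ι ⥤ C) (s : I) {t : ι → ℝ}
    (ht : t ∈ stdSimplex ℝ ι) (k : ι) : 0 ≤ pushFactor A F s t k := by
  have h1 := s.2.1
  have h2 := s.2.2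
  have h3 := chainMass_nonneg A F ht
  unfold pushFactor
  split_ifs
  · have := mul_nonneg h1 (inv_nonneg.2 h3)
    linarith
  · linarith

theorem pushFactor_mul_mem (A : C → Prop) (F : ι ⥤ C) (s : I) {t : ι → ℝ}
    (ht : t ∈ stdSimplex ℝ ι) (hm : 0 < chainMass A F t) :
    (fun k => pushFactor A F s t k * t k) ∈ stdSimplex ℝ ι := by
  classical
  refine ⟨fun k => mul_nonneg (pushFactor_nonneg A F s ht k) (ht.1 k), ?_⟩
  have h1 : ∀ k, pushFactor A F s t k * t k = (1 - (s : ℝ)) * t k +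
      s * (chainMass A F t)⁻¹ * (if A (F.obj k) then t k else 0) := by
    intro k
    unfold pushFactor
    split_ifs <;> ring
  simp only [h1, Finset.sum_add_distrib, ← Finset.mul_sum, ht.2]
  have h2 : ∑ k, (if A (F.obj k) then t k else 0) = chainMass A F t := by
    unfold chainMass
    rw [Finset.sum_filter]
  rw [h2]
  field_simp
  ring

-- The movement is the straight line from `t` to its normalized restriction to `A`. Points without
-- mass on `A` stay put, which is a default value where continuity is not claimed.
variable (C) in
open scoped Classical in
theorem exists_push (A : C → Prop) : ∃ Φ : classifyingSpace C → I → classifyingSpace C,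
    ∀ (ι : Type) [LinearOrder ι] [Fintype ι] [Nonempty ι] (F : ι ⥤ C) (t : ι → ℝ),
    t ∈ stdSimplex ℝ ι → Φ (chainPoint F t) = fun s : I => if 0 < chainMass A F t then
      chainPoint F (fun k => pushFactor A F s t k * t k) else chainPoint F t :=
  exists_chainPoint_lift (fun ι _ _ _ F t => fun s : I => if 0 < chainMass A F t then
      chainPoint F (fun k => pushFactor A F s t k * t k) else chainPoint F t)
      fun ι κ _ _ _ _ _ _ θ hθ G t ht => by
    funext s
    by_cases hm : 0 < chainMass A G (pushWeight θ t)
    · have hm' := hm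
      rw [← chainMass_comp A hθ G t] at hm'
      rw [if_pos hm, if_pos hm', chainPoint_comp hθ G (pushFactor_mul_mem A _ s ht hm'),
        ← pushWeight_mul]
      congr 2
      funext l
      unfold pushFactor
      rw [chainMass_comp]
      rfl
    · have hm' := hm
      rw [← chainMass_comp A hθ G t] at hm'
      rw [if_neg hm, if_neg hm', chainPoint_comp hθ G ht]

/-- The movement of points towards the objects satisfying `A`. -/
noncomputable def push (A : C → Prop) (p : classifyingSpace C) (s : I) : classifyingSpace C :=
  Classical.choose (exists_push C A) p s

theorem push_chainPoint (A : C → Prop) (F : ι ⥤ C) {t : ι → ℝ} (ht : t ∈ stdSimplex ℝ ι)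
    (hm : 0 < chainMass A F t) (s : I) :
    push A (chainPoint F t) s = chainPoint F (fun k => pushFactor A F s t k * t k) := by
  have := congrFun (Classical.choose_spec (exists_push C A) ι F t ht) s
  rwa [if_pos hm] at this

theorem continuousOn_push (A : C → Prop) :
    ContinuousOn (fun q : classifyingSpace C × I => push A q.1 q.2)
      ((mass A ⁻¹' Set.Ioi 0) ×ˢ Set.univ) := by
  refine continuousOn_prod_of_chainPoint (isOpen_Ioi.preimage (continuous_mass A)) fun m F => ?_
  have h0 : ∀ q ∈ (stdSimplex ℝ (Fin (m + 1)) ∩ chainPoint F ⁻¹' (mass A ⁻¹' Set.Ioi 0)) ×ˢ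
      (Set.univ : Set I), 0 < chainMass A F q.1 := by
    rintro q ⟨⟨h1, h2⟩, -⟩
    rw [← mass_chainPoint A F h1]
    exact h2
  have h1 : ContinuousOn (fun q : (Fin (m + 1) → ℝ) × I =>
      chainPoint F (fun k => pushFactor A F q.2 q.1 k * q.1 k))
      ((stdSimplex ℝ (Fin (m + 1)) ∩ chainPoint F ⁻¹' (mass A ⁻¹' Set.Ioi 0)) ×ˢ Set.univ) := by
    refine (continuousOn_chainPoint F).comp (continuousOn_pi.2 fun k => ?_) fun q hq =>
      pushFactor_mul_mem A F q.2 hq.1.1 (h0 q hq)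
    unfold pushFactor
    refine ContinuousOn.mul ?_ (by fun_prop)
    split_ifs
    · refine ContinuousOn.add (by fun_prop) (ContinuousOn.mul (by fun_prop)
        (ContinuousOn.inv₀ ?_ fun q hq => (h0 q hq).ne'))
      exact ((continuous_chainMass A F).comp continuous_fst).continuousOn
    · fun_prop
  exact h1.congr fun q hq => push_chainPoint A F hq.1.1 (h0 q hq) q.2

theorem push_zero (A : C → Prop) {p : classifyingSpace C} (hp : 0 < mass A p) :
    push A p 0 = p := by
  obtain ⟨m, F, t, ht, rfl⟩ := exists_chainPoint p
  rw [mass_chainPoint A F ht] at hp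
  rw [push_chainPoint A F ht hp]
  congr 1
  funext k
  simp [pushFactor]

theorem mass_push_one (A : C → Prop) {p : classifyingSpace C} (hp : 0 < mass A p) :
    mass (fun c => ¬ A c) (push A p 1) = 0 := by
  obtain ⟨m, F, t, ht, rfl⟩ := exists_chainPoint p
  rw [mass_chainPoint A F ht] at hp
  have h1 := pushFactor_mul_mem A F 1 ht hp
  rw [push_chainPoint A F ht hp, mass_chainPoint _ _ h1, chainMass_eq_zero_iff _ _ h1]
  intro k hk
  simp [pushFactor, hk]

theorem mass_push_eq_zero {A B : C → Prop} {p : classifyingSpace C} (hp : 0 < mass A p)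
    (hB : mass B p = 0) (s : I) : mass B (push A p s) = 0 := by
  obtain ⟨m, F, t, ht, rfl⟩ := exists_chainPoint p
  rw [mass_chainPoint A F ht] at hp
  rw [mass_chainPoint B F ht, chainMass_eq_zero_iff _ _ ht] at hB
  have h1 := pushFactor_mul_mem A F s ht hp
  rw [push_chainPoint A F ht hp, mass_chainPoint _ _ h1, chainMass_eq_zero_iff _ _ h1]
  intro k hk
  simp [hB k hk]

theorem mass_pos_of_not_eq_zero {A : C → Prop} {p : classifyingSpace C}
    (hp : mass (fun c => ¬ A c) p = 0) : 0 < mass A p := by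
  have := mass_add_mass_not A p
  linarith

theorem push_eq_self {A : C → Prop} {p : classifyingSpace C}
    (hp : mass (fun c => ¬ A c) p = 0) (s : I) : push A p s = p := by
  have h0 := mass_pos_of_not_eq_zero hp
  have h2 : mass A p = 1 := by linarith [mass_add_mass_not A p]
  obtain ⟨m, F, t, ht, rfl⟩ := exists_chainPoint p
  rw [mass_chainPoint A F ht] at h0 h2
  rw [mass_chainPoint _ F ht, chainMass_eq_zero_iff _ _ ht] at hp
  rw [push_chainPoint A F ht h0]
  congr 1
  funext k
  by_cases hk : A (F.obj k)
  · simp [pushFactor, hk, h2]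
  · simp [hp k hk]

theorem functor_ext_of_subsingleton {F G : ι ⥤ C} (h : ∀ k, F.obj k = G.obj k)
    (h' : ∀ k l : ι, k ≤ l → Subsingleton (F.obj k ⟶ F.obj l)) : F = G :=
  CategoryTheory.Functor.ext h fun k l e => by
    have := h' k l (leOfHom e)
    exact Subsingleton.elim _ _

/-- After dropping zero weights all objects are `x` and all arrows are its only endomorphism, so the
chain is pulled back from the one-element chain. -/
theorem eq_classifyingVertex {x : C} (hx : ∀ e : x ⟶ x, e = 𝟙 x) {p : classifyingSpace C}
    (hp : mass (fun c => c ≠ x) p = 0) : p = classifyingVertex x := by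
  classical
  obtain ⟨ι, _, _, _, F, t, ht, hpos, rfl⟩ := exists_chainPoint_pos p
  rw [mass_chainPoint _ F ht, chainMass_eq_zero_iff _ _ ht] at hp
  have hF : ∀ k, F.obj k = x := fun k => by
    by_contra h
    exact (hpos k).ne' (hp k h)
  rw [classifyingVertex_eq_chainPoint]
  refine chainPoint_eq_of_map (θ := fun _ => (0 : Fin 1)) monotone_const ht
    (functor_ext_of_subsingleton hF fun k l _ => ?_) ?_
  · rw [hF k, hF l]
    exact ⟨fun a b => (hx a).trans (hx b).symm⟩
  · funext k
    rw [Subsingleton.elim k 0]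
    simp [pushWeight, ht.2]

end Push

/-! ### Inserting an object into a chain -/

section Insertion

/-- A linear order with one element inserted between the elements satisfying a predicate and the
other ones. -/
structure Inserted {S : Type} (L : S → Prop) : Type where
  /-- `none` stands for the new element -/
  val : Option S

namespace Inserted

variable {S : Type} {L : S → Prop}

/-- The new element. -/
abbrev new : Inserted L := ⟨none⟩

/-- The old elements. -/
abbrev old (k : S) : Inserted L := ⟨some k⟩

/-- The underlying type is that of options. -/
def equivOption : Inserted L ≃ Option S where
  toFun a := a.val
  invFun a := ⟨a⟩

instance [Fintype S] : Fintype (Inserted L) := Fintype.ofEquiv _ equivOption.symm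
instance : Nonempty (Inserted L) := ⟨new⟩

theorem sum_eq [Fintype S] (t : Inserted L → ℝ) : ∑ a, t a = t new + ∑ k, t (old k) := by
  rw [← equivOption.symm.sum_comp, Fintype.sum_option]
  rfl

variable [LinearOrder S]

open scoped Classical in
/-- The lexicographic key which defines the order. -/
noncomputable def key (a : Inserted L) : ℕ ×ₗ WithBot S := match a with
  -- Level 0 holds the elements satisfying `L`, level 1 the new one, level 2 the rest. The entry `⊥`
  -- is a filler which also keeps the keys distinct.
  | ⟨none⟩ => toLex (1, ⊥)
  | ⟨some k⟩ => toLex (if L k then 0 else 2, (k : WithBot S))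

theorem key_injective : Function.Injective (key (L := L)) := by
  intro a b h
  match a, b with
  | ⟨none⟩, ⟨none⟩ => rfl
  | ⟨none⟩, ⟨some k⟩ =>
    have h2 : (⊥ : WithBot S) = k := congrArg (fun q => (ofLex q).2) h
    simp at h2
  | ⟨some k⟩, ⟨none⟩ =>
    have h2 : (k : WithBot S) = ⊥ := congrArg (fun q => (ofLex q).2) h
    simp at h2
  | ⟨some k⟩, ⟨some l⟩ =>
    have h2 : (k : WithBot S) = l := congrArg (fun q => (ofLex q).2) h
    rw [WithBot.coe_injective h2]

noncomputable instance : LinearOrder (Inserted L) := LinearOrder.lift' key key_injective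

theorem le_iff_key {a b : Inserted L} : a ≤ b ↔ key a ≤ key b := Iff.rfl

theorem le_of_old_le_old {k l : S} (h : (old k : Inserted L) ≤ (old l : Inserted L)) :
    (L l → L k) ∧ ((L k ↔ L l) → k ≤ l) := by
  rw [le_iff_key, key, key, Prod.Lex.le_iff] at h
  by_cases hk : L k <;> by_cases hl : L l <;> simp_all

theorem old_le_old {k l : S} (hkl : k ≤ l) (h : L l → L k) :
    (old k : Inserted L) ≤ (old l : Inserted L) := by
  rw [le_iff_key, key, key, Prod.Lex.le_iff]
  by_cases hk : L k <;> by_cases hl : L l <;> simp_all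

theorem old_le_new {k : S} : (old k : Inserted L) ≤ new ↔ L k := by
  rw [le_iff_key, key, key, Prod.Lex.le_iff]
  by_cases hk : L k <;> simp_all

theorem new_le_old {k : S} : (new : Inserted L) ≤ (old k : Inserted L) ↔ ¬ L k := by
  rw [le_iff_key, key, key, Prod.Lex.le_iff]
  by_cases hk : L k <;> simp_all

end Inserted

variable {C : Type u} [Category.{v} C]
variable {S S' : Type} [LinearOrder S] [LinearOrder S']

/-- The data for inserting an object into a chain. -/
structure Insertion (G : S ⥤ C) (o : C) where
  /-- the objects before the new one -/
  L : S → Prop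
  lower : ∀ k l, k ≤ l → L l → L k
  α : ∀ k, L k → (G.obj k ⟶ o)
  β : ∀ k, ¬ L k → (o ⟶ G.obj k)
  map_α : ∀ k l (h : k ≤ l) (hl : L l), G.map (homOfLE h) ≫ α l hl = α k (lower k l h hl)
  β_map : ∀ k l (h : k ≤ l) (hk : ¬ L k),
    β k hk ≫ G.map (homOfLE h) = β l fun hl => hk (lower k l h hl)
  α_β : ∀ k l (h : k ≤ l) (hk : L k) (hl : ¬ L l), α k hk ≫ β l hl = G.map (homOfLE h)

namespace Insertion

variable {o : C} {G : S ⥤ C}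

/-- The lexicographic order could reorder old elements for an arbitrary `L`; for a lower set it does
not. -/
theorem le (D : Insertion G o) {k l : S}
    (h : (.old k : Inserted D.L) ≤ (.old l : Inserted D.L)) : k ≤ l := by
  obtain ⟨h1, h2⟩ := Inserted.le_of_old_le_old h
  by_cases hl : D.L l
  · exact h2 ⟨fun _ => hl, h1⟩
  by_cases hk : D.L k
  · by_contra hlt
    exact hl (D.lower _ _ (not_le.1 hlt).le hk)
  · exact h2 ⟨fun h => absurd h hk, h1⟩

/-- The objects of the chain with the new one inserted. -/
def obj (D : Insertion G o) (a : Inserted D.L) : C := match a with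
  | ⟨none⟩ => o
  | ⟨some k⟩ => G.obj k

/-- The arrows of the chain with the new object inserted. -/
def mapLE (D : Insertion G o) (a b : Inserted D.L) : a ≤ b → (D.obj a ⟶ D.obj b) :=
  match a, b with
  | ⟨none⟩, ⟨none⟩ => fun _ => 𝟙 o
  | ⟨none⟩, ⟨some l⟩ => fun h => D.β l (Inserted.new_le_old.1 h)
  | ⟨some k⟩, ⟨none⟩ => fun h => D.α k (Inserted.old_le_new.1 h)
  | ⟨some _⟩, ⟨some _⟩ => fun h => G.map (homOfLE (D.le h))

/-- The chain with the new object inserted. -/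
def functor (D : Insertion G o) : Inserted D.L ⥤ C where
  obj := D.obj
  map {a b} h := D.mapLE a b (leOfHom h)
  map_id a := by
    match a with
    | ⟨none⟩ => rfl
    | ⟨some k⟩ => exact G.map_id k
  map_comp {a b c} h h' := by
    match a, b, c, leOfHom h, leOfHom h' with
    | ⟨none⟩, ⟨none⟩, c, _, _ => exact (Category.id_comp _).symm
    | a, ⟨none⟩, ⟨none⟩, _, _ => exact (Category.comp_id _).symm
    | ⟨none⟩, ⟨some k⟩, ⟨none⟩, h1, h2 =>
      exact absurd (Inserted.old_le_new.1 h2) (Inserted.new_le_old.1 h1)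
    | ⟨none⟩, ⟨some k⟩, ⟨some l⟩, h1, h2 => exact (D.β_map k l (D.le h2) _).symm
    | ⟨some k⟩, ⟨none⟩, ⟨some l⟩, h1, h2 =>
      exact (D.α_β k l _ _ _).symm
    | ⟨some k⟩, ⟨some l⟩, ⟨none⟩, h1, h2 => exact (D.map_α k l (D.le h1) _).symm
    | ⟨some k⟩, ⟨some l⟩, ⟨some m⟩, h1, h2 => exact G.map_comp (homOfLE (D.le h1)) (homOfLE (D.le h2))

/-- Monotone maps extend to the orders with an element inserted. -/
def map {L : S → Prop} {L' : S' → Prop} (θ : S → S') (a : Inserted L) : Inserted L' :=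
  match a with
  | ⟨none⟩ => .new
  | ⟨some k⟩ => .old (θ k)

theorem monotone_map {θ : S → S'} (hθ : Monotone θ) {L : S → Prop} {L' : S' → Prop}
    (hlow : ∀ k l, k ≤ l → L l → L k)
    (hL : ∀ k, L k ↔ L' (θ k)) : Monotone (map (L := L) (L' := L') θ) := by
  intro a b h
  match a, b with
  | ⟨none⟩, ⟨none⟩ => exact le_rfl
  | ⟨none⟩, ⟨some k⟩ => exact Inserted.new_le_old.2 fun hk => Inserted.new_le_old.1 h ((hL k).2 hk)
  | ⟨some k⟩, ⟨none⟩ => exact Inserted.old_le_new.2 ((hL k).1 (Inserted.old_le_new.1 h))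
  | ⟨some k⟩, ⟨some l⟩ =>
    have h1 : k ≤ l := by
      obtain ⟨h1, h2⟩ := Inserted.le_of_old_le_old h
      by_contra hlt
      exact hlt (h2 ⟨hlow _ _ (not_le.1 hlt).le, h1⟩)
    exact Inserted.old_le_old (hθ h1) fun hl =>
      (hL k).1 (hlow _ _ h1 ((hL l).2 hl))

/-- Together with `pushWeight_insertWeight` this makes constructions by insertion natural in the
chain, hence well defined on points. -/
theorem functor_comp {θ : S → S'} (hθ : Monotone θ) {G : S' ⥤ C} (D : Insertion (hθ.functor ⋙ G) o)
    (D' : Insertion G o) (hL : ∀ k, D.L k ↔ D'.L (θ k))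
    (hα : ∀ k h h', D.α k h = D'.α (θ k) h') (hβ : ∀ k h h', D.β k h = D'.β (θ k) h') :
    D.functor = (monotone_map hθ D.lower hL).functor ⋙ D'.functor := by
  refine CategoryTheory.Functor.ext (fun a => ?_) (fun a b h => ?_)
  · match a with
    | ⟨none⟩ => rfl
    | ⟨some k⟩ => rfl
  · match a, b, leOfHom h with
    | ⟨none⟩, ⟨none⟩, _ =>
      -- Once the elements are matched, both `eqToHom`s are identities by definition and disappear
      -- by the unit laws.
      refine Eq.trans ?_ (Eq.trans (Category.id_comp _) (Category.comp_id _)).symm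
      rfl
    | ⟨none⟩, ⟨some k⟩, h1 =>
      refine Eq.trans ?_ (Eq.trans (Category.id_comp _) (Category.comp_id _)).symm
      exact hβ _ _ _
    | ⟨some k⟩, ⟨none⟩, _ =>
      refine Eq.trans ?_ (Eq.trans (Category.id_comp _) (Category.comp_id _)).symm
      exact hα _ _ _
    | ⟨some k⟩, ⟨some l⟩, _ =>
      refine Eq.trans ?_ (Eq.trans (Category.id_comp _) (Category.comp_id _)).symm
      rfl

end Insertion

/-- The weights of a chain with an object inserted. -/
def insertWeight {L : S → Prop} (c : ℝ) (t : S → ℝ) (a : Inserted L) : ℝ := match a with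
  | ⟨none⟩ => c
  | ⟨some k⟩ => t k

theorem insertWeight_mem [Fintype S] {L : S → Prop} {c : ℝ} {t : S → ℝ} (hc : 0 ≤ c)
    (ht : ∀ k, 0 ≤ t k) (hs : c + ∑ k, t k = 1) :
    insertWeight (L := L) c t ∈ stdSimplex ℝ (Inserted L) := by
  refine ⟨fun a => ?_, ?_⟩
  · match a with
    | ⟨none⟩ => exact hc
    | ⟨some k⟩ => exact ht k
  · rw [Inserted.sum_eq]
    exact hs

theorem pushWeight_insertWeight [Fintype S] {L : S → Prop} {L' : S' → Prop} (θ : S → S') (c : ℝ)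
    (t : S → ℝ) : pushWeight (Insertion.map θ) (insertWeight (L := L) c t)
      = insertWeight (L := L') c (pushWeight θ t) := by
  classical
  funext a
  unfold pushWeight
  rw [Finset.sum_filter, Inserted.sum_eq]
  match a with
  | ⟨none⟩ => simp [Insertion.map, insertWeight]
  | ⟨some l⟩ => 
    simp only [Insertion.map, insertWeight]
    simp only [Inserted.mk.injEq, reduceCtorEq, if_false, zero_add, Option.some.injEq]
    rw [Finset.sum_filter]
    refine Finset.sum_congr rfl fun k _ => ?_
    congr!

end Insertion

/-! ### The link of an object and the points halfway to it -/

section Link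

variable {C : Type u} [Category.{v} C] (Q : ObjectProperty C) (x : C)

/-- The join of the categories of objects with property `Q` over and under `x`. -/
abbrev LinkJoin : Type (max u v) := Join (CostructuredArrow Q.ι x) (StructuredArrow x Q.ι)

/-- The functor which forgets the arrow from or to `x`. -/
def linkForget : LinkJoin Q x ⥤ C :=
  Join.mkFunctor (CostructuredArrow.proj Q.ι x ⋙ Q.ι) (StructuredArrow.proj x Q.ι ⋙ Q.ι)
    { app := fun p => p.1.hom ≫ p.2.hom
      naturality := fun p q h => by
        have h1 := CostructuredArrow.w h.1
        have h2 := StructuredArrow.w h.2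
        change Q.ι.map h.1.left ≫ q.1.hom ≫ q.2.hom = (p.1.hom ≫ p.2.hom) ≫ Q.ι.map h.2.right
        rw [← Category.assoc, h1, Category.assoc, h2] }

/-- Arrows of comma categories are determined by their underlying arrows, and the join has at most
one arrow from left to right. Faithfulness later allows chains to be lifted from `C` to the link. -/
instance : (linkForget Q x).Faithful where
  map_injective {a b} f g h := by
    match a, b with
    | .left a, .left b =>
      obtain ⟨f, rfl⟩ := (Join.inclLeft _ _).map_surjective f
      obtain ⟨g, rfl⟩ := (Join.inclLeft _ _).map_surjective g
      congr 1
      exact CostructuredArrow.hom_ext _ _ (Q.ι.map_injective h)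
    | .right a, .right b =>
      obtain ⟨f, rfl⟩ := (Join.inclRight _ _).map_surjective f
      obtain ⟨g, rfl⟩ := (Join.inclRight _ _).map_surjective g
      congr 1
      exact StructuredArrow.hom_ext _ _ (Q.ι.map_injective h)
    | .left a, .right b => exact Subsingleton.elim _ _
    | .right a, .left b => exact (Join.false_of_right_to_left f).elim

variable {Q x}

theorem linkForget_prop (j : LinkJoin Q x) : Q ((linkForget Q x).obj j) := match j with
  | .left a => a.left.2
  | .right a => a.right.2

/-- The objects over `x`. -/
def LinkJoin.IsLeft (j : LinkJoin Q x) : Prop := match j with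
  | .left _ => True
  | .right _ => False

/-- The arrow to `x` from an object over `x`. -/
def LinkJoin.toTop (j : LinkJoin Q x) : j.IsLeft → ((linkForget Q x).obj j ⟶ x) := match j with
  | .left a => fun _ => a.hom
  | .right _ => fun h => h.elim

/-- The arrow from `x` to an object under `x`. -/
def LinkJoin.ofBot (j : LinkJoin Q x) : ¬ j.IsLeft → (x ⟶ (linkForget Q x).obj j) := match j with
  | .left _ => fun h => (h trivial).elim
  | .right a => fun _ => a.hom

theorem LinkJoin.isLeft_of_hom {i j : LinkJoin Q x} (h : i ⟶ j) (hj : j.IsLeft) : i.IsLeft := by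
  match i, j with
  | .left a, _ => trivial
  | .right a, .left b => exact (Join.false_of_right_to_left h).elim
  | .right a, .right b => exact hj

theorem LinkJoin.map_toTop {i j : LinkJoin Q x} (h : i ⟶ j) (hj : j.IsLeft) :
    (linkForget Q x).map h ≫ j.toTop hj = i.toTop (LinkJoin.isLeft_of_hom h hj) := by
  match i, j with
  | .left a, .left b =>
    obtain ⟨f, rfl⟩ := (Join.inclLeft _ _).map_surjective h
    exact CostructuredArrow.w f
  | .right a, .left b => exact (Join.false_of_right_to_left h).elim
  | _, .right b => exact hj.elim

theorem LinkJoin.ofBot_map {i j : LinkJoin Q x} (h : i ⟶ j) (hi : ¬ i.IsLeft) :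
    i.ofBot hi ≫ (linkForget Q x).map h =
      j.ofBot fun hj => hi (LinkJoin.isLeft_of_hom h hj) := by
  match i, j with
  | .right a, .right b =>
    obtain ⟨f, rfl⟩ := (Join.inclRight _ _).map_surjective h
    exact StructuredArrow.w f
  | .right a, .left b => exact (Join.false_of_right_to_left h).elim
  | .left b, _ => exact (hi trivial).elim

/-- The arrow of the join from left to right was sent to the composite through `x`; this is exactly
what permits the insertion of `x` between the two halves. -/
theorem LinkJoin.toTop_ofBot {i j : LinkJoin Q x} (h : i ⟶ j) (hi : i.IsLeft) (hj : ¬ j.IsLeft) :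
    i.toTop hi ≫ j.ofBot hj = (linkForget Q x).map h := by
  match i, j with
  | .left a, .right b =>
    obtain rfl : h = Join.edge a b := Subsingleton.elim _ _
    rfl
  | .right a, _ => exact hi.elim
  | _, .left b => exact (hj trivial).elim

variable {ι κ : Type} [LinearOrder ι] [LinearOrder κ]

/-- The insertion of `x` into a chain in its link. -/
def linkInsertion (K : ι ⥤ LinkJoin Q x) : Insertion (K ⋙ linkForget Q x) x where
  L k := (K.obj k).IsLeft
  lower _ _ h := LinkJoin.isLeft_of_hom (K.map (homOfLE h))
  α k := (K.obj k).toTop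
  β k := (K.obj k).ofBot
  map_α _ _ h := LinkJoin.map_toTop (K.map (homOfLE h))
  β_map _ _ h := LinkJoin.ofBot_map (K.map (homOfLE h))
  α_β _ _ h := LinkJoin.toTop_ofBot (K.map (homOfLE h))

theorem half_insertWeight_mem [Fintype ι] {L : ι → Prop} {t : ι → ℝ} (ht : t ∈ stdSimplex ℝ ι) :
    insertWeight (L := L) (1 / 2) (fun k => 1 / 2 * t k) ∈ stdSimplex ℝ (Inserted L) := by
  refine insertWeight_mem (by norm_num) (fun k => mul_nonneg (by norm_num) (ht.1 k)) ?_
  rw [← Finset.mul_sum, ht.2]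
  norm_num

-- Inserting `x` with weight `1/2` and halving the other weights places the link at the middle level
-- of its cone with apex `x`.
variable (Q x) in
theorem exists_linkCone : ∃ Φ : classifyingSpace (LinkJoin Q x) → classifyingSpace C,
    ∀ (ι : Type) [LinearOrder ι] [Fintype ι] [Nonempty ι] (K : ι ⥤ LinkJoin Q x) (t : ι → ℝ),
    t ∈ stdSimplex ℝ ι → Φ (chainPoint K t) =
      chainPoint (linkInsertion K).functor (insertWeight (1 / 2) fun k => 1 / 2 * t k) :=
  exists_chainPoint_lift (fun ι _ _ _ K t =>
    chainPoint (linkInsertion K).functor (insertWeight (1 / 2) fun k => 1 / 2 * t k))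
    fun ι κ _ _ _ _ _ _ θ hθ K t ht => by
      refine chainPoint_eq_of_map _ (half_insertWeight_mem ht)
        (Insertion.functor_comp (G := K ⋙ linkForget Q x) hθ (linkInsertion (hθ.functor ⋙ K)) (linkInsertion K)
          (fun k => Iff.rfl) (fun k _ _ => rfl) (fun k _ _ => rfl)) ?_
      rw [pushWeight_insertWeight, pushWeight_mul θ t (fun _ => 1 / 2)]

/-- The points halfway between the link of `x` and `x`. -/
noncomputable def linkCone (q : classifyingSpace (LinkJoin Q x)) : classifyingSpace C :=
  Classical.choose (exists_linkCone Q x) q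

variable [Fintype ι] [Nonempty ι]

theorem linkCone_chainPoint (K : ι ⥤ LinkJoin Q x) {t : ι → ℝ} (ht : t ∈ stdSimplex ℝ ι) :
    linkCone (chainPoint K t) =
      chainPoint (linkInsertion K).functor (insertWeight (1 / 2) fun k => 1 / 2 * t k) :=
  Classical.choose_spec (exists_linkCone Q x) ι K t ht

theorem continuous_insertWeight [Finite κ] {L : κ → Prop} (c : ℝ) (b : ℝ) : Continuous fun t : κ → ℝ =>
    insertWeight (L := L) c (fun k => b * t k) :=
  continuous_pi fun a => match a with
    | ⟨none⟩ => continuous_const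
    | ⟨some k⟩ => continuous_const.mul (continuous_apply k)

theorem continuous_linkCone : Continuous (linkCone (Q := Q) (x := x)) :=
  continuous_of_chainPoint fun _ K => ((continuousOn_chainPoint (linkInsertion K).functor).comp
    (continuous_insertWeight _ _).continuousOn fun _ ht => half_insertWeight_mem ht).congr
      fun _ ht => linkCone_chainPoint K ht

theorem mass_linkCone_eq_zero (q : classifyingSpace (LinkJoin Q x)) :
    mass (fun c => ¬ (c = x ∨ Q c)) (linkCone q) = 0 := by
  obtain ⟨m, K, t, ht, rfl⟩ := exists_chainPoint q
  rw [linkCone_chainPoint K ht, mass_chainPoint _ _ (half_insertWeight_mem ht),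
    chainMass_eq_zero_iff _ _ (half_insertWeight_mem ht)]
  intro a
  match a with
  | ⟨none⟩ => exact fun h => (h (Or.inl rfl)).elim
  | ⟨some k⟩ => exact fun h => (h (Or.inr (linkForget_prop (K.obj k)))).elim

theorem mass_linkCone (hQ : ¬ Q x) (q : classifyingSpace (LinkJoin Q x)) :
    mass (fun c => c = x) (linkCone q) = 1 / 2 := by
  classical
  obtain ⟨m, K, t, ht, rfl⟩ := exists_chainPoint q
  rw [linkCone_chainPoint K ht, mass_chainPoint _ _ (half_insertWeight_mem ht)]
  unfold chainMass
  rw [Finset.sum_filter, Inserted.sum_eq, Finset.sum_eq_zero, add_zero]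
  · exact if_pos rfl
  · intro k _
    refine if_neg fun h => hQ ?_
    have := linkForget_prop (K.obj k)
    rwa [show (linkForget Q x).obj (K.obj k) = x from h] at this

end Link

/-! ### Reading a chain through `x` as a chain of the link -/

section LinkMap

variable {C : Type u} [Category.{v} C] {Q : ObjectProperty C} {x : C}
variable {ι κ : Type} [LinearOrder ι] [LinearOrder κ]

/-- An object over `x`. -/
def linkLeft {z : C} (hz : Q z) (a : z ⟶ x) : LinkJoin Q x :=
  .left (CostructuredArrow.mk (S := Q.ι) (Y := ObjectProperty.FullSubcategory.mk z hz) a)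

/-- An object under `x`. -/
def linkRight {z : C} (hz : Q z) (a : x ⟶ z) : LinkJoin Q x :=
  .right (StructuredArrow.mk (S := x) (T := Q.ι) (Y := ObjectProperty.FullSubcategory.mk z hz) a)

/-- Two occurrences of `x` in a chain are joined by an endomorphism of `x`, which is the identity;
so the arrow to `x` does not depend on the occurrence used. -/
theorem map_eqToHom_unique (hx : ∀ e : x ⟶ x, e = 𝟙 x) (F : ι ⥤ C) {k l l' : ι} (h : k ≤ l)
    (h' : k ≤ l') (hl : F.obj l = x) (hl' : F.obj l' = x) :
    F.map (homOfLE h) ≫ eqToHom hl = F.map (homOfLE h') ≫ eqToHom hl' := by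
  wlog hll : l ≤ l' generalizing l l'
  · exact (this h' h hl' hl (not_le.1 hll).le).symm
  have h1 : F.map (homOfLE h') = F.map (homOfLE h) ≫ F.map (homOfLE hll) := by
    rw [← F.map_comp]
    rfl
  have h2 : F.map (homOfLE hll) ≫ eqToHom hl' = eqToHom hl := by
    have : Subsingleton (F.obj l ⟶ x) := by
      rw [hl]
      exact ⟨fun a b => (hx a).trans (hx b).symm⟩
    exact Subsingleton.elim _ _
  rw [h1, Category.assoc, h2]

theorem eqToHom_map_unique (hx : ∀ e : x ⟶ x, e = 𝟙 x) (F : ι ⥤ C) {k l l' : ι} (h : l ≤ k)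
    (h' : l' ≤ k) (hl : F.obj l = x) (hl' : F.obj l' = x) :
    eqToHom hl.symm ≫ F.map (homOfLE h) = eqToHom hl'.symm ≫ F.map (homOfLE h') := by
  wlog hll : l ≤ l' generalizing l l'
  · exact (this h' h hl' hl (not_le.1 hll).le).symm
  have h1 : F.map (homOfLE h) = F.map (homOfLE hll) ≫ F.map (homOfLE h') := by
    rw [← F.map_comp]
    rfl
  have h2 : eqToHom hl.symm ≫ F.map (homOfLE hll) = eqToHom hl'.symm := by
    have : Subsingleton (x ⟶ F.obj l') := by
      rw [hl']
      exact ⟨fun a b => (hx a).trans (hx b).symm⟩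
    exact Subsingleton.elim _ _
  rw [h1, ← Category.assoc, h2]

open scoped Classical in
/-- The object of the link of `x` given by an object of a chain through `x`. -/
noncomputable def linkObj (F : ι ⥤ C) (hex : ∃ l, F.obj l = x) (k : ι) (hk : Q (F.obj k)) :
    LinkJoin Q x :=
  if h : ∃ l, k ≤ l ∧ F.obj l = x then
    linkLeft hk (F.map (homOfLE h.choose_spec.1) ≫ eqToHom h.choose_spec.2)
  else linkRight hk (eqToHom hex.choose_spec.symm ≫ F.map (homOfLE (le_of_not_ge fun hle =>
    h ⟨hex.choose, hle, hex.choose_spec⟩)))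

variable (hx : ∀ e : x ⟶ x, e = 𝟙 x)
  (hno : ∀ z, Q z → (x ⟶ z) → (z ⟶ x) → False)

include hx in
theorem linkObj_of_le (F : ι ⥤ C) (hex : ∃ l, F.obj l = x) {k l : ι} (hk : Q (F.obj k))
    (h : k ≤ l) (hl : F.obj l = x) : linkObj F hex k hk =
      linkLeft hk (F.map (homOfLE h) ≫ eqToHom hl) := by
  have h' : ∃ l, k ≤ l ∧ F.obj l = x := ⟨l, h, hl⟩
  rw [linkObj, dif_pos h', map_eqToHom_unique hx F _ h _ hl]

-- An object lying both after and before occurrences of `x` would have arrows from and to `x`,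
-- contrary to `hno`. Hence its side in the link is unambiguous.
include hx hno in
theorem linkObj_of_ge (F : ι ⥤ C) (hex : ∃ l, F.obj l = x) {k l : ι} (hk : Q (F.obj k))
    (h : l ≤ k) (hl : F.obj l = x) : linkObj F hex k hk =
      linkRight hk (eqToHom hl.symm ≫ F.map (homOfLE h)) := by
  have h' : ¬ ∃ l, k ≤ l ∧ F.obj l = x := fun ⟨l', h1, h2⟩ =>
    hno _ hk (eqToHom hl.symm ≫ F.map (homOfLE h)) (F.map (homOfLE h1) ≫ eqToHom h2)
  rw [linkObj, dif_neg h', eqToHom_map_unique hx F _ h _ hl]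
  exact hex.choose_spec

-- Two objects of the chain lie both before `x`, both after it, or on different sides. In the last
-- case the given arrow factors through `x`, as the single arrow of the join requires.
include hx hno in
theorem exists_linkObj_hom (F : ι ⥤ C) (hex : ∃ l, F.obj l = x) {k l : ι} (hk : Q (F.obj k))
    (hl : Q (F.obj l)) (h : k ≤ l) : ∃ e : linkObj F hex k hk ⟶ linkObj F hex l hl,
      (linkForget Q x).map e ≍ F.map (homOfLE h) := by
  obtain ⟨m, hm⟩ := id hex
  rcases le_total l m with h1 | h1
  · rw [linkObj_of_le hx F hex hk (h.trans h1) hm, linkObj_of_le hx F hex hl h1 hm]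
    refine ⟨(Join.inclLeft _ _).map (CostructuredArrow.homMk
      (ObjectProperty.homMk (F.map (homOfLE h))) ?_), HEq.rfl⟩
    change F.map (homOfLE h) ≫ F.map (homOfLE h1) ≫ eqToHom hm = _
    rw [← Category.assoc, ← F.map_comp]
    rfl
  rcases le_total m k with h2 | h2
  · rw [linkObj_of_ge hx hno F hex hk h2 hm, linkObj_of_ge hx hno F hex hl h1 hm]
    refine ⟨(Join.inclRight _ _).map (StructuredArrow.homMk
      (ObjectProperty.homMk (F.map (homOfLE h))) ?_), HEq.rfl⟩
    change (eqToHom hm.symm ≫ F.map (homOfLE h2)) ≫ F.map (homOfLE h) = _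
    rw [Category.assoc, ← F.map_comp]
    rfl
  · rw [linkObj_of_le hx F hex hk h2 hm, linkObj_of_ge hx hno F hex hl h1 hm]
    refine ⟨Join.edge _ _, heq_of_eq ?_⟩
    change (F.map (homOfLE h2) ≫ eqToHom hm) ≫ eqToHom hm.symm ≫ F.map (homOfLE h1) = _
    simp only [Category.assoc, eqToHom_trans_assoc, eqToHom_refl, Category.id_comp]
    rw [← F.map_comp]
    rfl

theorem linkForget_linkObj (F : ι ⥤ C) (hex : ∃ l, F.obj l = x) (k : ι) (hk : Q (F.obj k)) :
    (linkForget Q x).obj (linkObj F hex k hk) = F.obj k := by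
  unfold linkObj
  split_ifs <;> rfl

/-- The part of a chain through `x` satisfying `Q`, viewed as a chain in the link of `x`. -/
noncomputable def linkFunctor (F : ι ⥤ C) (hex : ∃ l, F.obj l = x) :
    {k // Q (F.obj k)} ⥤ LinkJoin Q x :=
  -- Division by a faithful functor: with arrows lifted one at a time, functoriality is automatic.
  Functor.Faithful.div ((Subtype.mono_coe fun k => Q (F.obj k)).functor ⋙ F) (linkForget Q x)
    (fun k => linkObj F hex k.1 k.2) (fun k => linkForget_linkObj F hex k.1 k.2)
    (fun {k l} h => (exists_linkObj_hom hx hno F hex k.2 l.2 (leOfHom h)).choose)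
    (fun {k l} h => (exists_linkObj_hom hx hno F hex k.2 l.2 (leOfHom h)).choose_spec)

theorem linkFunctor_forget (F : ι ⥤ C) (hex : ∃ l, F.obj l = x) :
    linkFunctor hx hno F hex ⋙ linkForget Q x =
      (Subtype.mono_coe fun k => Q (F.obj k)).functor ⋙ F :=
  Functor.Faithful.div_comp _ _ _ _ _ _

theorem functor_ext_of_faithful {S : Type} [LinearOrder S] {J : Type*} [Category J]
    (Ψ : J ⥤ C) [Ψ.Faithful] {K K' : S ⥤ J} (h : K ⋙ Ψ = K' ⋙ Ψ) (hobj : ∀ k, K.obj k = K'.obj k) :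
    K = K' := by
  refine CategoryTheory.Functor.ext hobj fun k l e => Ψ.map_injective ?_
  rw [Functor.map_comp, Functor.map_comp, eqToHom_map, eqToHom_map]
  exact Functor.congr_hom h e

include hx hno in
theorem linkObj_comp {θ : ι → κ} (hθ : Monotone θ) (G : κ ⥤ C)
    (hex : ∃ l, (hθ.functor ⋙ G).obj l = x) (hex' : ∃ l, G.obj l = x) (k : ι)
    (hk : Q (G.obj (θ k))) :
    linkObj (hθ.functor ⋙ G) hex k hk = linkObj G hex' (θ k) hk := by
  obtain ⟨m, hm⟩ := id hex
  rcases le_total k m with h | h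
  · rw [linkObj_of_le hx _ hex (k := k) hk h hm, linkObj_of_le hx G hex' hk (hθ h) hm]
    rfl
  · rw [linkObj_of_ge hx hno _ hex (k := k) hk h hm, linkObj_of_ge hx hno G hex' hk (hθ h) hm]
    rfl

/-- The restriction of a map to subtypes. -/
def subtypeMap {α β : Type} (θ : α → β) (p : β → Prop) (k : {k // p (θ k)}) : {k // p k} :=
  ⟨θ k.1, k.2⟩

theorem monotone_subtypeMap {θ : ι → κ} (hθ : Monotone θ) (p : κ → Prop) :
    Monotone (subtypeMap θ p) := fun _ _ h => hθ h

theorem pushWeight_subtypeMap {α β : Type} [Fintype α] (θ : α → β) (p : β → Prop)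
    [Fintype {k // p (θ k)}] (t : α → ℝ) (k : {k // p k}) :
    pushWeight (subtypeMap θ p) (fun l => t l.1) k = pushWeight θ t k.1 := by
  classical
  unfold pushWeight
  refine Finset.sum_bij (fun l _ => l.1) ?_ ?_ ?_ ?_
  · intro l hl
    simp only [Finset.mem_filter, Finset.mem_univ, true_and] at hl ⊢
    exact congrArg Subtype.val hl
  · intro a _ b _ h
    exact Subtype.ext h
  · intro l hl
    simp only [Finset.mem_filter, Finset.mem_univ, true_and] at hl
    have hp : p (θ l) := hl ▸ k.2
    exact ⟨⟨l, hp⟩, by simpa using Subtype.ext hl, rfl⟩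
  · intro _ _
    rfl

theorem linkFunctor_comp {θ : ι → κ} (hθ : Monotone θ) (G : κ ⥤ C)
    (hex : ∃ l, (hθ.functor ⋙ G).obj l = x) (hex' : ∃ l, G.obj l = x) :
    linkFunctor hx hno (hθ.functor ⋙ G) hex =
      (monotone_subtypeMap hθ fun k => Q (G.obj k)).functor ⋙ linkFunctor hx hno G hex' := by
  refine functor_ext_of_faithful (linkForget Q x) ?_ fun k => linkObj_comp hx hno hθ G hex hex' k.1 k.2
  rw [linkFunctor_forget]
  exact congrArg (fun H => (monotone_subtypeMap hθ fun k => Q (G.obj k)).functor ⋙ H)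
    (linkFunctor_forget hx hno G hex').symm

end LinkMap

/-! ### Projection to the link -/

section LinkMap

variable {C : Type u} [Category.{v} C] {Q : ObjectProperty C} {x : C}
variable {ι κ : Type} [LinearOrder ι] [Fintype ι] [Nonempty ι]
variable (hx : ∀ e : x ⟶ x, e = 𝟙 x)
  (hno : ∀ z, Q z → (x ⟶ z) → (z ⟶ x) → False)

theorem exists_of_chainMass_pos {A : C → Prop} {F : ι ⥤ C} {t : ι → ℝ}
    (h : 0 < chainMass A F t) : ∃ k, A (F.obj k) := by
  classical
  by_contra hne
  unfold chainMass at h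
  rw [Finset.sum_eq_zero] at h
  · exact lt_irrefl _ h
  · intro k hk
    exact absurd ⟨k, (Finset.mem_filter.1 hk).2⟩ hne

theorem normalized_mem (A : C → Prop) (F : ι ⥤ C) {t : ι → ℝ} (ht : t ∈ stdSimplex ℝ ι)
    (h : 0 < chainMass A F t) [Fintype {k // A (F.obj k)}] :
    (fun k : {k // A (F.obj k)} => (chainMass A F t)⁻¹ * t k.1) ∈
      stdSimplex ℝ {k // A (F.obj k)} := by
  classical
  refine ⟨fun k => mul_nonneg (inv_nonneg.2 h.le) (ht.1 _), ?_⟩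
  rw [← Finset.mul_sum]
  have : ∑ k : {k // A (F.obj k)}, t k.1 = chainMass A F t := by
    unfold chainMass
    rw [Finset.sum_subtype (p := fun k => A (F.obj k)) _ (by simp)]
  rw [this, inv_mul_cancel₀ h.ne']

theorem pushWeight_normalized {κ : Type} [LinearOrder κ] [Fintype κ] [Nonempty κ] (A : C → Prop) {θ : ι → κ}
    (hθ : Monotone θ) (G : κ ⥤ C) (t : ι → ℝ) [Fintype {k // A (G.obj (θ k))}] :
    (fun k : {k // A (G.obj k)} => (chainMass A G (pushWeight θ t))⁻¹ * pushWeight θ t k.1) =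
      pushWeight (subtypeMap θ fun k => A (G.obj k))
        (fun k => (chainMass A (hθ.functor ⋙ G) t)⁻¹ * t k.1) := by
  rw [chainMass_comp A hθ]
  funext k
  rw [← pushWeight_subtypeMap θ (fun k => A (G.obj k)) t k]
  exact (congrFun (pushWeight_mul (subtypeMap θ fun k => A (G.obj k)) (fun k => t k.1)
    (fun _ => (chainMass A G (pushWeight θ t))⁻¹)) k).symm

theorem continuousOn_normalized (A : C → Prop) (F : ι ⥤ C) :
    ContinuousOn (fun (t : ι → ℝ) (k : {k // A (F.obj k)}) => (chainMass A F t)⁻¹ * t k.1)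
      (chainMass A F ⁻¹' Set.Ioi 0) :=
  continuousOn_pi.2 fun _ => ((continuous_chainMass A F).continuousOn.inv₀
    fun t (ht : 0 < chainMass A F t) => ht.ne').mul (continuous_apply _).continuousOn

theorem heq_of_obj_eq {o a b : C} (ho : ∀ e : o ⟶ o, e = 𝟙 o) (ha : a = o) (hb : b = o)
    (e : a ⟶ b) : e ≍ 𝟙 o := by
  subst ha
  subst hb
  exact heq_of_eq (ho e)

theorem LinkJoin.toTop_heq {j : LinkJoin Q x} {z : C} {hz : Q z} {a : z ⟶ x}
    (h : j = linkLeft hz a) (hj : j.IsLeft) : j.toTop hj ≍ a := by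
  subst h
  rfl

theorem LinkJoin.ofBot_heq {j : LinkJoin Q x} {z : C} {hz : Q z} {a : x ⟶ z}
    (h : j = linkRight hz a) (hj : ¬ j.IsLeft) : j.ofBot hj ≍ a := by
  subst h
  rfl

theorem isLeft_linkLeft {z : C} (hz : Q z) (a : z ⟶ x) : (linkLeft hz a).IsLeft := trivial

theorem not_isLeft_linkRight {z : C} (hz : Q z) (a : x ⟶ z) : ¬ (linkRight hz a).IsLeft := id

/-- By `hno` the occurrences of `x` are consecutive, and they are joined by identities; collapsing
them to one gives the link chain with `x` inserted. This is the chain-level form of the identity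
that `linkCone` undoes the projection to the link. -/
theorem exists_map_linkInsertion (F : ι ⥤ C) (hex : ∃ l, F.obj l = x)
    (hF : ∀ k, F.obj k = x ∨ Q (F.obj k)) (hQ : ¬ Q x) :
    ∃ (θ : ι → Inserted (linkInsertion (linkFunctor hx hno F hex)).L) (hθ : Monotone θ),
      F = hθ.functor ⋙ (linkInsertion (linkFunctor hx hno F hex)).functor ∧
      (∀ k hk, θ k = .old ⟨k, hk⟩) ∧ ∀ k, F.obj k = x → θ k = .new := by
  classical
  set D := linkInsertion (linkFunctor hx hno F hex) with hD
  let θ : ι → Inserted D.L := fun k => if h : Q (F.obj k) then .old ⟨k, h⟩ else .new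
  have h1 : ∀ k hk, θ k = .old ⟨k, hk⟩ := fun k hk => dif_pos hk
  have h2 : ∀ k, F.obj k = x → θ k = .new := fun k hk => dif_neg (by rwa [hk])
  have hleft : ∀ (k : {k // Q (F.obj k)}) (l : ι), k.1 ≤ l → F.obj l = x → D.L k := by
    intro k l h hl
    change (linkObj F hex k.1 k.2).IsLeft
    rw [linkObj_of_le hx F hex k.2 h hl]
    exact isLeft_linkLeft _ _
  have hright : ∀ (k : {k // Q (F.obj k)}) (l : ι), l ≤ k.1 → F.obj l = x → ¬ D.L k := by
    intro k l h hl
    change ¬ (linkObj F hex k.1 k.2).IsLeft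
    rw [linkObj_of_ge hx hno F hex k.2 h hl]
    exact not_isLeft_linkRight _ _
  have hθ : Monotone θ := by
    intro k l h
    rcases hF k with hk | hk <;> rcases hF l with hl | hl
    · rw [h2 k hk, h2 l hl]
    · rw [h2 k hk, h1 l hl]
      exact Inserted.new_le_old.2 (hright ⟨l, hl⟩ k h hk)
    · rw [h1 k hk, h2 l hl]
      exact Inserted.old_le_new.2 (hleft ⟨k, hk⟩ l h hl)
    · rw [h1 k hk, h1 l hl]
      exact Inserted.old_le_old h (D.lower ⟨k, hk⟩ ⟨l, hl⟩ h)
  have hobj : ∀ k, F.obj k = D.functor.obj (θ k) := by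
    intro k
    rcases hF k with hk | hk
    · rw [h2 k hk]
      exact hk
    · rw [h1 k hk]
      exact (linkForget_linkObj F hex k hk).symm
  -- Stated for free variables `a` and `b`, so that the values of `θ` can be replaced by
  -- constructors.
  have key : ∀ k l (h : k ≤ l) (a b : Inserted D.L) (hab : a ≤ b), θ k = a → θ l = b →
      F.map (homOfLE h) ≍ D.functor.map (homOfLE hab) := by
    intro k l h a b hab ha hb
    rcases hF k with hk | hk <;> rcases hF l with hl | hl
    · obtain rfl : a = .new := ha.symm.trans (h2 k hk)
      obtain rfl : b = .new := hb.symm.trans (h2 l hl)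
      exact heq_of_obj_eq hx hk hl _
    · obtain rfl : a = .new := ha.symm.trans (h2 k hk)
      obtain rfl : b = .old ⟨l, hl⟩ := hb.symm.trans (h1 l hl)
      refine HEq.trans ?_ (LinkJoin.ofBot_heq (linkObj_of_ge hx hno F hex hl h hk)
        (hright ⟨l, hl⟩ k h hk)).symm
      exact (eqToHom_comp_heq _ _).symm
    · obtain rfl : a = .old ⟨k, hk⟩ := ha.symm.trans (h1 k hk)
      obtain rfl : b = .new := hb.symm.trans (h2 l hl)
      refine HEq.trans ?_ (LinkJoin.toTop_heq (linkObj_of_le hx F hex hk h hl)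
        (hleft ⟨k, hk⟩ l h hl)).symm
      exact (comp_eqToHom_heq _ _).symm
    · obtain rfl : a = .old ⟨k, hk⟩ := ha.symm.trans (h1 k hk)
      obtain rfl : b = .old ⟨l, hl⟩ := hb.symm.trans (h1 l hl)
      exact (Functor.hcongr_hom (linkFunctor_forget hx hno F hex)
        (homOfLE h : (⟨k, hk⟩ : {k // Q (F.obj k)}) ⟶ ⟨l, hl⟩)).symm
  exact ⟨θ, hθ, Functor.hext hobj fun k l e => key k l (leOfHom e) _ _ (hθ (leOfHom e)) rfl rfl,
    h1, h2⟩

-- The map keeps only the objects in `Q` and renormalizes their weights. Where `x` or `Q` has no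
-- mass it takes the default value `q₀`.
include hx hno in
theorem exists_linkMap (q₀ : classifyingSpace (LinkJoin Q x)) :
    ∃ ρ : classifyingSpace C → classifyingSpace (LinkJoin Q x),
    ContinuousOn ρ (mass (fun c => c = x) ⁻¹' Set.Ioi 0 ∩ mass Q ⁻¹' Set.Ioi 0) ∧
    ∀ p, mass (fun c => c = x) p = 1 / 2 → mass (fun c => ¬ (c = x ∨ Q c)) p = 0 → ¬ Q x →
      linkCone (ρ p) = p := by
  classical
  have hne : ∀ {ι : Type} [LinearOrder ι] [Fintype ι] [Nonempty ι] {F : ι ⥤ C} {t : ι → ℝ},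
      0 < chainMass Q F t → Nonempty {k // Q (F.obj k)} := fun h =>
    ⟨⟨_, (exists_of_chainMass_pos h).choose_spec⟩⟩
  obtain ⟨ρ, hρ⟩ := exists_chainPoint_lift (C := C) (S := classifyingSpace (LinkJoin Q x))
    (fun ι _ _ _ F t => if h : 0 < chainMass (fun c => c = x) F t ∧ 0 < chainMass Q F t then
      haveI := hne h.2
      chainPoint (linkFunctor hx hno F (exists_of_chainMass_pos h.1))
        (fun k => (chainMass Q F t)⁻¹ * t k.1) else q₀)
    (fun ι κ _ _ _ _ _ _ θ hθ G t ht => by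
      by_cases h : 0 < chainMass (fun c => c = x) G (pushWeight θ t) ∧
        0 < chainMass Q G (pushWeight θ t)
      · have h' := h
        rw [← chainMass_comp _ hθ, ← chainMass_comp _ hθ] at h'
        rw [dif_pos h, dif_pos h']
        have := hne h.2
        have := hne h'.2
        exact chainPoint_eq_of_map _ (normalized_mem Q (hθ.functor ⋙ G) ht h'.2)
          (linkFunctor_comp hx hno hθ G _ _) (pushWeight_normalized Q hθ G t)
      · have h' := h
        rw [← chainMass_comp _ hθ, ← chainMass_comp _ hθ] at h'
        rw [dif_neg h, dif_neg h'])
  have hρ' : ∀ (ι : Type) [LinearOrder ι] [Fintype ι] [Nonempty ι] (F : ι ⥤ C)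
      [Nonempty {k // Q (F.obj k)}] (hex : ∃ k, F.obj k = x) (t : ι → ℝ), t ∈ stdSimplex ℝ ι →
      0 < chainMass (fun c => c = x) F t → 0 < chainMass Q F t → ρ (chainPoint F t) =
      chainPoint (linkFunctor hx hno F hex) (fun k => (chainMass Q F t)⁻¹ * t k.1) := by
    intro ι _ _ _ F _ hex t ht h1 h2
    rw [hρ ι F t ht, dif_pos ⟨h1, h2⟩]
  refine ⟨ρ, ?_, ?_⟩
  · refine continuousOn_of_chainPoint ((isOpen_Ioi.preimage (continuous_mass _)).inter
      (isOpen_Ioi.preimage (continuous_mass _))) fun m F => ?_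
    rcases Set.eq_empty_or_nonempty (stdSimplex ℝ (Fin (m + 1)) ∩ chainPoint F ⁻¹'
      (mass (fun c => c = x) ⁻¹' Set.Ioi 0 ∩ mass Q ⁻¹' Set.Ioi 0)) with he | ⟨t₀, h₀, h₁, h₂⟩
    · rw [he]
      exact continuousOn_empty _
    · rw [Set.mem_preimage, mass_chainPoint _ F h₀] at h₁ h₂
      have hex := exists_of_chainMass_pos h₁
      have := hne h₂
      have hpos : ∀ t ∈ stdSimplex ℝ (Fin (m + 1)) ∩ chainPoint F ⁻¹'
          (mass (fun c => c = x) ⁻¹' Set.Ioi 0 ∩ mass Q ⁻¹' Set.Ioi 0),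
          0 < chainMass (fun c => c = x) F t ∧ 0 < chainMass Q F t := by
        rintro t ⟨h3, h4, h5⟩
        rw [Set.mem_preimage, mass_chainPoint _ F h3] at h4 h5
        exact ⟨h4, h5⟩
      refine ContinuousOn.congr ?_ fun t ht => hρ' _ F hex t ht.1 (hpos t ht).1 (hpos t ht).2
      exact (continuousOn_chainPoint (linkFunctor hx hno F hex)).comp
        ((continuousOn_normalized Q F).mono fun t ht => (hpos t ht).2)
        fun t ht => normalized_mem Q F ht.1 (hpos t ht).2
  · intro p hp hsupp hQ
    obtain ⟨ι, _, _, _, F, t, ht, hpos, rfl⟩ := exists_chainPoint_pos p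
    rw [mass_chainPoint _ F ht] at hp hsupp
    rw [chainMass_eq_zero_iff _ _ ht] at hsupp
    have hF : ∀ k, F.obj k = x ∨ Q (F.obj k) := fun k => by
      by_contra h
      exact (hpos k).ne' (hsupp k h)
    -- The support is the disjoint union of `x` and objects in `Q`, so the other half of the weight
    -- lies on `Q`.
    have hmQ : chainMass Q F t = 1 / 2 := by
      have h1 : ∀ k, (t k = (if F.obj k = x then t k else 0) + (if Q (F.obj k) then t k else 0)) := by
        intro k
        rcases hF k with h | h
        · have : ¬ Q (F.obj k) := by rwa [h]
          simp [h, hQ]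
        · have : ¬ F.obj k = x := fun h' => hQ (h' ▸ h)
          simp [h, this]
      have h2 := ht.2
      rw [Finset.sum_congr rfl fun k _ => h1 k, Finset.sum_add_distrib, ← Finset.sum_filter,
        ← Finset.sum_filter] at h2
      unfold chainMass at hp ⊢
      linarith
    have hex := exists_of_chainMass_pos (A := fun c => c = x) (F := F) (t := t) (by rw [hp]; norm_num)
    have := hne (F := F) (t := t) (by rw [hmQ]; norm_num)
    have hmem := normalized_mem Q F ht (by rw [hmQ]; norm_num)
    rw [hρ' ι F hex t ht (by rw [hp]; norm_num) (by rw [hmQ]; norm_num), linkCone_chainPoint _ hmem]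
    obtain ⟨θ, hθ, hFθ, h1, h2⟩ := exists_map_linkInsertion hx hno F hex hF hQ
    refine (chainPoint_eq_of_map hθ ht hFθ ?_).symm
    funext a
    unfold pushWeight
    rw [Finset.sum_filter]
    match a with
    | ⟨none⟩ =>
      refine hp.symm.trans ?_
      unfold chainMass
      rw [Finset.sum_filter]
      refine Finset.sum_congr rfl fun k _ => ?_
      rcases hF k with hk | hk
      · rw [if_pos hk, if_pos (h2 k hk)]
      · rw [if_neg fun h : F.obj k = x => hQ (h ▸ hk), if_neg (by rw [h1 k hk]; simp)]
    | ⟨some k⟩ =>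
      change 1 / 2 * ((chainMass Q F t)⁻¹ * t k.1) = _
      rw [hmQ, Finset.sum_eq_single k.1]
      · rw [if_pos (h1 k.1 k.2)]
        ring
      · intro l _ hl
        refine if_neg ?_
        rcases hF l with h | h
        · rw [h2 l h]
          simp
        · rw [h1 l h]
          intro he
          simp only [Inserted.mk.injEq, Option.some.injEq] at he
          exact hl (congrArg Subtype.val he)
      · simp

end LinkMap

/-! ### Extending maps from spheres to balls (in the sup norm) -/

section SphereExtension

open scoped unitInterval

/-- The height of a point of the sphere in terms of the norm of its preimage in the ball. -/
noncomputable def wrapHeight (r : ℝ) : ℝ := max (-1) (min 1 (6 * r - 3))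

/-- The factor by which the ball is stretched when wrapping it around the sphere. -/
noncomputable def wrapFactor (r : ℝ) : ℝ := min 1 (3 * (1 - r)) / max r (1 / 3)

/-- The three thirds of the radius. The inner one is stretched by 3 onto the bottom face, the middle
one covers the side walls with the height rising from -1 to 1, and the outer one covers the top
face, shrinking to its centre. -/
theorem wrap_cases (r : ℝ) : (r ≤ 1 / 3 ∧ wrapHeight r = -1 ∧ wrapFactor r = 3) ∨
    (1 / 3 ≤ r ∧ r ≤ 2 / 3 ∧ wrapHeight r = 6 * r - 3 ∧ wrapFactor r * r = 1) ∨
    (2 / 3 ≤ r ∧ wrapHeight r = 1 ∧ wrapFactor r * r = 3 * (1 - r)) := by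
  unfold wrapHeight wrapFactor
  rcases le_total r (1 / 3) with h | h
  · left
    have h1 : max (-1) (min 1 (6 * r - 3)) = -1 :=
      max_eq_left ((min_le_right _ _).trans (by linarith))
    have h2 : min 1 (3 * (1 - r)) = 1 := min_eq_left (by linarith)
    rw [h1, h2, max_eq_right h]
    norm_num [h]
  rcases le_total r (2 / 3) with h' | h'
  · right; left
    have h1 : min 1 (6 * r - 3) = 6 * r - 3 := min_eq_right (by linarith)
    have h2 : min 1 (3 * (1 - r)) = 1 := min_eq_left (by linarith)
    rw [h1, h2, max_eq_left h, max_eq_right (by linarith)]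
    exact ⟨h, h', rfl, div_mul_cancel₀ _ (by linarith)⟩
  · right; right
    have h1 : min 1 (6 * r - 3) = 1 := min_eq_left (by linarith)
    have h2 : min 1 (3 * (1 - r)) = 3 * (1 - r) := min_eq_right (by linarith)
    rw [h1, h2, max_eq_left h, max_eq_right (by norm_num)]
    exact ⟨h', rfl, div_mul_cancel₀ _ (by linarith)⟩

theorem continuous_wrapHeight : Continuous wrapHeight := by
  unfold wrapHeight
  fun_prop

theorem continuous_wrapFactor : Continuous wrapFactor := by
  unfold wrapFactor
  refine Continuous.div (by fun_prop) (by fun_prop) fun r => ?_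
  exact (lt_of_lt_of_le (by norm_num) (le_max_right r (1 / 3))).ne'

theorem wrapFactor_nonneg {r : ℝ} (h : r ≤ 1) : 0 ≤ wrapFactor r :=
  div_nonneg (le_min zero_le_one (by linarith)) (le_trans (by norm_num) (le_max_right r (1 / 3)))

theorem wrapFactor_pos {r : ℝ} (h : r < 1) : 0 < wrapFactor r :=
  div_pos (lt_min zero_lt_one (by linarith)) (lt_of_lt_of_le (by norm_num) (le_max_right r (1 / 3)))

variable {k : ℕ}

theorem norm_cons (a : ℝ) (y : Fin k → ℝ) :
    ‖(Fin.cons a y : Fin (k + 1) → ℝ)‖ = max (abs a) ‖y‖ := by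
  refine le_antisymm ?_ (max_le ?_ ?_)
  · refine (pi_norm_le_iff_of_nonneg (le_trans (abs_nonneg a) (le_max_left _ _))).2 fun i => ?_
    refine Fin.cases (le_max_left _ _) (fun j => ?_) i
    exact (norm_le_pi_norm y j).trans (le_max_right _ _)
  · exact norm_le_pi_norm (Fin.cons a y : Fin (k + 1) → ℝ) 0
  · refine (pi_norm_le_iff_of_nonneg (norm_nonneg _)).2 fun j => ?_
    exact norm_le_pi_norm (Fin.cons a y : Fin (k + 1) → ℝ) j.succ

/-- The ball wrapped around the sphere, with the boundary of the ball going to one point. -/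
noncomputable def wrap (y : Fin k → ℝ) : Fin (k + 1) → ℝ :=
  Fin.cons (wrapHeight ‖y‖) (wrapFactor ‖y‖ • y)

theorem continuous_wrap : Continuous (wrap (k := k)) := by
  refine continuous_pi fun i => Fin.cases ?_ (fun j => ?_) i
  · exact continuous_wrapHeight.comp continuous_norm
  · exact (continuous_wrapFactor.comp continuous_norm).mul (continuous_apply j)

theorem norm_wrapFactor_smul {y : Fin k → ℝ} (hy : ‖y‖ ≤ 1) :
    ‖wrapFactor ‖y‖ • y‖ = wrapFactor ‖y‖ * ‖y‖ := by
  rw [norm_smul, Real.norm_of_nonneg (wrapFactor_nonneg hy)]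

theorem norm_wrap {y : Fin k → ℝ} (hy : ‖y‖ ≤ 1) : ‖wrap y‖ = 1 := by
  rw [wrap, norm_cons, norm_wrapFactor_smul hy]
  have h0 := norm_nonneg y
  rcases wrap_cases ‖y‖ with ⟨h1, h2, h3⟩ | ⟨h1, h1', h2, h3⟩ | ⟨h1, h2, h3⟩
  · rw [h2, h3, max_eq_left] <;> norm_num
    linarith
  · rw [h2, h3, max_eq_right]
    rw [abs_le]
    constructor <;> linarith
  · rw [h2, h3, max_eq_left] <;> norm_num
    linarith

theorem wrap_of_norm_eq_one {y : Fin k → ℝ} (hy : ‖y‖ = 1) : wrap y = Fin.cons 1 0 := by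
  have h : wrapFactor 1 = 0 := by norm_num [wrapFactor]
  have h' : wrapHeight 1 = 1 := by norm_num [wrapHeight]
  rw [wrap, hy, h, h', zero_smul]

/-- Height and norm of the remaining coordinates determine the radius, and inside the open ball the
stretching factor is positive; so only boundary points are identified. -/
theorem wrap_eq {y y' : Fin k → ℝ} (hy : ‖y‖ ≤ 1) (hy' : ‖y'‖ ≤ 1) (h : wrap y = wrap y') :
    y = y' ∨ (‖y‖ = 1 ∧ ‖y'‖ = 1) := by
  obtain ⟨h1, h2⟩ := Fin.cons_inj.1 h
  have h3 := congrArg norm h2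
  rw [norm_wrapFactor_smul hy, norm_wrapFactor_smul hy'] at h3
  have h4 : ‖y‖ = ‖y'‖ := by
    rcases wrap_cases ‖y‖ with ⟨a1, a2, a3⟩ | ⟨a1, a1', a2, a3⟩ | ⟨a1, a2, a3⟩ <;>
    rcases wrap_cases ‖y'‖ with ⟨b1, b2, b3⟩ | ⟨b1, b1', b2, b3⟩ | ⟨b1, b2, b3⟩ <;>
    rw [a2, b2] at h1 <;> rw [a3, b3] at h3 <;> linarith
  rw [← h4] at h2 ⊢
  rcases hy.lt_or_eq with hlt | heq
  · exact Or.inl (smul_right_injective _ (wrapFactor_pos hlt).ne' h2)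
  · exact Or.inr ⟨heq, heq⟩

theorem exists_wrap_eq (hk : 0 < k) {q : Fin (k + 1) → ℝ} (hq : ‖q‖ = 1) :
    ∃ y : Fin k → ℝ, ‖y‖ ≤ 1 ∧ wrap y = q := by
  obtain ⟨z, u, rfl⟩ : ∃ (z : ℝ) (u : Fin k → ℝ), q = Fin.cons z u :=
    ⟨q 0, Fin.tail q, (Fin.cons_self_tail q).symm⟩
  rw [norm_cons] at hq
  have hz : abs z ≤ 1 := hq ▸ le_max_left _ _
  have hu : ‖u‖ ≤ 1 := hq ▸ le_max_right _ _
  rw [abs_le] at hz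
  by_cases h1 : z = -1
  · have hn : ‖(1 / 3 : ℝ) • u‖ = 1 / 3 * ‖u‖ := by rw [norm_smul]; norm_num
    refine ⟨(1 / 3 : ℝ) • u, by rw [hn]; linarith, ?_⟩
    have h2 : wrapHeight (1 / 3 * ‖u‖) = -1 ∧ wrapFactor (1 / 3 * ‖u‖) = 3 := by
      rcases wrap_cases (1 / 3 * ‖u‖) with ⟨a1, a2, a3⟩ | ⟨a1, a1', a2, a3⟩ | ⟨a1, a2, a3⟩
      · exact ⟨a2, a3⟩
      · have hu1 : ‖u‖ = 1 := by linarith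
        rw [hu1] at a2 a3 ⊢
        constructor <;> linarith
      · linarith
    rw [wrap, hn, h2.1, h2.2, smul_smul, h1]
    norm_num
  by_cases h2 : ‖u‖ = 1
  · have hr : 0 ≤ (z + 3) / 6 := by linarith
    have hn : ‖((z + 3) / 6) • u‖ = (z + 3) / 6 := by
      rw [norm_smul, h2, Real.norm_of_nonneg hr, mul_one]
    refine ⟨((z + 3) / 6) • u, by rw [hn]; linarith, ?_⟩
    have h2 : wrapHeight ((z + 3) / 6) = z ∧ wrapFactor ((z + 3) / 6) * ((z + 3) / 6) = 1 := by
      rcases wrap_cases ((z + 3) / 6) with ⟨a1, a2, a3⟩ | ⟨a1, a1', a2, a3⟩ | ⟨a1, a2, a3⟩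
      · exact absurd (by linarith) h1
      · exact ⟨by linarith, a3⟩
      · have : z = 1 := by linarith
        constructor <;> linarith
    rw [wrap, hn, h2.1, smul_smul, h2.2, one_smul]
  · have h3 : z = 1 := by
      rcases max_choice (abs z) ‖u‖ with h | h
      · rw [h] at hq
        rcases eq_or_eq_neg_of_abs_eq hq with h | h
        exacts [h, absurd h h1]
      · exact absurd (h ▸ hq) h2
    by_cases h4 : u = 0
    -- The centre of the top face is the image of the boundary of the ball. A boundary point exists
    -- only for `0 < k`: in dimension zero the sphere has two points, the ball one.
    · have hn : ‖(fun _ => 1 : Fin k → ℝ)‖ = 1 := by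
        haveI : Nonempty (Fin k) := ⟨⟨0, hk⟩⟩
        rw [pi_norm_const]
        norm_num
      exact ⟨fun _ => 1, hn.le, by rw [wrap_of_norm_eq_one hn, h3, h4]⟩
    · have h5 : 0 < ‖u‖ := norm_pos_iff.2 h4
      have hr : 0 ≤ (1 - ‖u‖ / 3) / ‖u‖ := div_nonneg (by linarith) h5.le
      have hn : ‖((1 - ‖u‖ / 3) / ‖u‖) • u‖ = 1 - ‖u‖ / 3 := by
        rw [norm_smul, Real.norm_of_nonneg hr, div_mul_cancel₀ _ h5.ne']
      refine ⟨((1 - ‖u‖ / 3) / ‖u‖) • u, by rw [hn]; linarith, ?_⟩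
      have h6 : wrapHeight (1 - ‖u‖ / 3) = 1 ∧
          wrapFactor (1 - ‖u‖ / 3) * (1 - ‖u‖ / 3) = ‖u‖ := by
        rcases wrap_cases (1 - ‖u‖ / 3) with ⟨a1, a2, a3⟩ | ⟨a1, a1', a2, a3⟩ | ⟨a1, a2, a3⟩
        · linarith
        · exact absurd (by linarith) h2
        · exact ⟨a2, by linarith⟩
      rw [wrap, hn, h6.1, smul_smul, ← mul_div_assoc, h6.2, div_self h5.ne', one_smul, h3]

/-- The cube as a ball. -/
def cubeBall (t : Fin k → I) : Fin k → ℝ := fun i => 2 * (t i : ℝ) - 1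

theorem norm_cubeBall_le (t : Fin k → I) : ‖cubeBall t‖ ≤ 1 := by
  refine (pi_norm_le_iff_of_nonneg zero_le_one).2 fun i => ?_
  rw [Real.norm_eq_abs, abs_le, cubeBall]
  have h1 := (t i).2.1
  have h2 := (t i).2.2
  constructor <;> linarith

theorem continuous_cubeBall : Continuous (cubeBall (k := k)) := by
  unfold cubeBall
  fun_prop

theorem norm_cubeBall_eq_one_of_mem {t : Fin k → I} (ht : t ∈ Cube.boundary (Fin k)) :
    ‖cubeBall t‖ = 1 := by
  refine le_antisymm (norm_cubeBall_le t) ?_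
  obtain ⟨i, hi⟩ := ht
  refine le_trans ?_ (norm_le_pi_norm (cubeBall t) i)
  rw [Real.norm_eq_abs, cubeBall]
  rcases hi with hi | hi <;> rw [hi] <;> norm_num

theorem mem_boundary_of_norm_cubeBall {t : Fin k → I} (ht : ‖cubeBall t‖ = 1) :
    t ∈ Cube.boundary (Fin k) := by
  by_contra hne
  have h : ‖cubeBall t‖ < 1 := by
    refine (pi_norm_lt_iff zero_lt_one).2 fun i => ?_
    rw [Real.norm_eq_abs, abs_lt, cubeBall]
    have h1 : (0 : ℝ) < t i := (t i).2.1.lt_of_ne fun h => hne ⟨i, Or.inl (Subtype.ext h.symm)⟩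
    have h2 : (t i : ℝ) < 1 := (t i).2.2.lt_of_ne fun h => hne ⟨i, Or.inr (Subtype.ext h)⟩
    constructor <;> linarith
  exact h.ne ht

theorem exists_cubeBall_eq {y : Fin k → ℝ} (hy : ‖y‖ ≤ 1) : ∃ t : Fin k → I, cubeBall t = y := by
  have h : ∀ i, (y i + 1) / 2 ∈ I := fun i => by
    have := abs_le.1 ((norm_le_pi_norm y i).trans hy)
    constructor <;> linarith [this.1, this.2]
  refine ⟨fun i => ⟨_, h i⟩, ?_⟩
  funext i
  simp only [cubeBall]
  ring

theorem cubeBall_injective : Function.Injective (cubeBall (k := k)) := by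
  intro t t' h
  funext i
  have := congrFun h i
  simp only [cubeBall] at this
  exact Subtype.ext (by linarith)

/-- Maps on spheres extend to balls if the homotopy groups vanish. -/
theorem exists_extension_ball_succ {T : Type*} [TopologicalSpace T] (hk : 0 < k)
    (hT : ∀ x : T, Subsingleton (HomotopyGroup.Pi k T x)) (f : (Fin (k + 1) → ℝ) → T)
    (hf : ContinuousOn f (Metric.sphere 0 1)) :
    ∃ g : C(Metric.closedBall (0 : Fin (k + 1) → ℝ) 1, T), ∀ p, ‖p.1‖ = 1 → g p = f p.1 := by
  have hw : ∀ t : Fin k → I, ‖wrap (cubeBall t)‖ = 1 := fun t => norm_wrap (norm_cubeBall_le t)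
  let b : Fin (k + 1) → ℝ := Fin.cons 1 0
  let γ : GenLoop (Fin k) T (f b) := ⟨⟨fun t => f (wrap (cubeBall t)),
    hf.comp_continuous (continuous_wrap.comp continuous_cubeBall) fun t => by simp [hw]⟩,
    fun t ht => congrArg f (wrap_of_norm_eq_one (norm_cubeBall_eq_one_of_mem ht))⟩
  have hγ : GenLoop.Homotopic γ GenLoop.const := Quotient.exact
    ((hT (f b)).elim (Quotient.mk _ γ) (Quotient.mk _ GenLoop.const))
  obtain ⟨N⟩ := hγ
  have hN0 : ∀ t, N (0, t) = f (wrap (cubeBall t)) := fun t => N.apply_zero t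
  have hN1 : ∀ t, N (1, t) = f b := fun t => N.apply_one t
  have hNb : ∀ s t, t ∈ Cube.boundary (Fin k) → N (s, t) = f b := fun s t ht =>
    (N.eq_fst s ht).trans (γ.2 t ht)
  have hnorm : ∀ q : I × (Fin k → I), ‖(1 - (q.1 : ℝ)) • wrap (cubeBall q.2)‖ = 1 - q.1 := by
    intro q
    rw [norm_smul, hw, mul_one, Real.norm_of_nonneg (by linarith [q.1.2.2])]
  -- The cube at time `s` wraps around the sphere of radius `1 - s`. This surjection from a compact
  -- to a Hausdorff space is a quotient map, so the null-homotopy `N` descends to the ball once it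
  -- is constant on fibres.
  let Ξ : C(I × (Fin k → I), Metric.closedBall (0 : Fin (k + 1) → ℝ) 1) :=
    ⟨fun q => ⟨(1 - (q.1 : ℝ)) • wrap (cubeBall q.2), by
      rw [mem_closedBall_zero_iff, hnorm]
      linarith [q.1.2.1]⟩, by
      refine Continuous.subtype_mk (Continuous.smul (f := fun q : I × (Fin k → I) =>
        1 - (q.1 : ℝ)) (by fun_prop) ?_) _
      exact continuous_wrap.comp (continuous_cubeBall.comp continuous_snd)⟩
  have hsurj : Function.Surjective Ξ := by
    rintro ⟨p, hp⟩
    rw [mem_closedBall_zero_iff] at hp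
    by_cases h0 : p = 0
    · exact ⟨(1, fun _ => 0), Subtype.ext (by simp [Ξ, h0])⟩
    · have h1 : 0 < ‖p‖ := norm_pos_iff.2 h0
      obtain ⟨y, hy, hy'⟩ := exists_wrap_eq (q := ‖p‖⁻¹ • p) hk (by
        rw [norm_smul, norm_inv, norm_norm, inv_mul_cancel₀ h1.ne'])
      obtain ⟨t, rfl⟩ := exists_cubeBall_eq hy
      refine ⟨(⟨1 - ‖p‖, by linarith, by linarith⟩, t), Subtype.ext ?_⟩
      change (1 - (1 - ‖p‖)) • wrap (cubeBall t) = p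
      rw [hy', smul_smul, sub_sub_cancel, mul_inv_cancel₀ h1.ne', one_smul]
  have hq : IsQuotientMap Ξ := (Ξ.continuous.isClosedMap).isQuotientMap Ξ.continuous hsurj
  have hfib : ∀ a c, Ξ a = Ξ c → N a = N c := by
    rintro ⟨s, t⟩ ⟨s', t'⟩ h
    have h := congrArg Subtype.val h
    change (1 - (s : ℝ)) • wrap (cubeBall t) = (1 - (s' : ℝ)) • wrap (cubeBall t') at h
    have h1 := congrArg norm h
    rw [hnorm (s, t), hnorm (s', t')] at h1
    obtain rfl : s = s' := Subtype.ext (by simpa using h1)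
    by_cases hs : s = 1
    · rw [hs, hN1, hN1]
    · have hs' : 1 - (s : ℝ) ≠ 0 := fun h => hs (Subtype.ext (by simpa using (sub_eq_zero.1 h).symm))
      rcases wrap_eq (norm_cubeBall_le t) (norm_cubeBall_le t')
        (smul_right_injective _ hs' h) with h2 | ⟨h2, h3⟩
      · rw [cubeBall_injective h2]
      · rw [hNb s t (mem_boundary_of_norm_cubeBall h2), hNb s t' (mem_boundary_of_norm_cubeBall h3)]
  refine ⟨hq.lift N.toContinuousMap hfib, fun p hp => ?_⟩
  obtain ⟨⟨s, t⟩, rfl⟩ := hsurj p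
  have h1 : (1 : ℝ) - s = 1 := (hnorm (s, t)).symm.trans hp
  obtain rfl : s = 0 := Subtype.ext (by simpa using h1)
  have h2 := congrArg (fun G => G (0, t)) (hq.lift_comp N.toContinuousMap hfib)
  refine h2.trans ?_
  refine (hN0 t).trans ?_
  simp [Ξ]

/-- In dimension 0 the sphere is empty and any point of `T` serves; in dimension 1 it has two
points, joined by a path; beyond that the boundary sphere has dimension `d - 1 ≤ n` and the homotopy
group there is trivial. -/
theorem exists_extension_ball {T : Type*} [TopologicalSpace T] {n d : ℕ} (hT : IsNConnected n T)
    (hd : d ≤ n + 1) (f : (Fin d → ℝ) → T) (hf : ContinuousOn f (Metric.sphere 0 1)) :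
    ∃ g : C(Metric.closedBall (0 : Fin d → ℝ) 1, T), ∀ p, ‖p.1‖ = 1 → g p = f p.1 := by
  match d, hd with
  | 0, _ =>
    refine ⟨ContinuousMap.const _ hT.1.some, fun p hp => ?_⟩
    rw [Subsingleton.elim p.1 0, norm_zero] at hp
    exact absurd hp zero_ne_one
  | 1, _ =>
    have h0 := hT.2 0 (Nat.zero_le n)
    have hj : Joined (f fun _ => -1) (f fun _ => 1) := by
      have h1 := h0 (f fun _ => 1)
      have h2 := (HomotopyGroup.pi0EquivZerothHomotopy (X := T)
        (x := f fun _ => 1)).symm.subsingleton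
      exact Quotient.exact (h2.elim (Quotient.mk _ _) (Quotient.mk _ _))
    obtain ⟨γ⟩ := hj
    refine ⟨⟨fun p => γ.extend ((p.1 0 + 1) / 2), ?_⟩, fun p hp => ?_⟩
    · exact γ.continuous_extend.comp
        (f := fun p : Metric.closedBall (0 : Fin 1 → ℝ) 1 => (p.1 0 + 1) / 2)
        ((((continuous_apply 0).comp continuous_subtype_val).add continuous_const).div_const 2)
    · have h1 : abs (p.1 0) = 1 := by
        refine Eq.trans ?_ hp
        refine le_antisymm (norm_le_pi_norm p.1 0) ?_
        refine (pi_norm_le_iff_of_nonneg (abs_nonneg _)).2 fun i => ?_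
        rw [Subsingleton.elim i 0, Real.norm_eq_abs]
      have h2 : p.1 = fun _ => p.1 0 := funext fun i => by rw [Subsingleton.elim i 0]
      change γ.extend ((p.1 0 + 1) / 2) = _
      rcases eq_or_eq_neg_of_abs_eq h1 with h | h <;> rw [h2, h] <;> norm_num
  | k + 2, hd =>
    exact exists_extension_ball_succ (Nat.succ_pos k) (hT.2 (k + 1) (by omega)) f hf

end SphereExtension

/-! ### Extension over cubical grids -/

section Grid

variable {k : ℕ}

open scoped Classical in
/-- The coordinates of a point which are not integers. -/
noncomputable def nonint (a : Fin k → ℝ) : Finset (Fin k) :=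
  Finset.univ.filter fun i => ∀ z : ℤ, a i ≠ z

theorem mem_nonint {a : Fin k → ℝ} {i : Fin k} : i ∈ nonint a ↔ ∀ z : ℤ, a i ≠ z := by
  simp [nonint]

/-- The cells of the integer grid: faces of cubes with integral vertices. -/
def gridCell (p : Finset (Fin k) × (Fin k → ℤ)) : Set (Fin k → ℝ) :=
  Set.Icc (fun i => (p.2 i : ℝ)) (fun i => p.2 i + if i ∈ p.1 then 1 else 0)

theorem isClosed_gridCell (p : Finset (Fin k) × (Fin k → ℤ)) : IsClosed (gridCell p) :=
  isClosed_Icc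

theorem mem_gridCell {J : Finset (Fin k)} {c : Fin k → ℤ} {a : Fin k → ℝ} :
    a ∈ gridCell (J, c) ↔ ∀ i, (c i : ℝ) ≤ a i ∧ a i ≤ c i + if i ∈ J then 1 else 0 :=
  ⟨fun h i => ⟨h.1 i, h.2 i⟩, fun h => ⟨fun i => (h i).1, fun i => (h i).2⟩⟩

theorem eq_of_mem_gridCell {J : Finset (Fin k)} {c : Fin k → ℤ} {a : Fin k → ℝ}
    (ha : a ∈ gridCell (J, c)) {i : Fin k} (hi : i ∉ J) : a i = c i := by
  have := mem_gridCell.1 ha i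
  rw [if_neg hi, add_zero] at this
  exact le_antisymm this.2 this.1

theorem nonint_subset {J : Finset (Fin k)} {c : Fin k → ℤ} {a : Fin k → ℝ}
    (ha : a ∈ gridCell (J, c)) : nonint a ⊆ J := by
  intro i hi
  by_contra h
  exact mem_nonint.1 hi _ (eq_of_mem_gridCell ha h)

theorem mem_gridCell_nonint (a : Fin k → ℝ) : a ∈ gridCell (nonint a, fun i => ⌊a i⌋) := by
  refine mem_gridCell.2 fun i => ⟨Int.floor_le _, ?_⟩
  split_ifs with h
  · exact (Int.lt_floor_add_one _).le
  · rw [mem_nonint] at h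
    push Not at h
    obtain ⟨z, hz⟩ := h
    rw [hz, Int.floor_intCast, add_zero]

/-- A point has a unique cell containing it in the relative interior, given by its non-integral
coordinates and its floor. -/
theorem floor_eq_of_mem_gridCell {J : Finset (Fin k)} {c : Fin k → ℤ} {a : Fin k → ℝ}
    (ha : a ∈ gridCell (J, c)) (h : J ⊆ nonint a) (i : Fin k) : ⌊a i⌋ = c i := by
  by_cases hi : i ∈ J
  · have h1 := mem_gridCell.1 ha i
    rw [if_pos hi] at h1
    rw [Int.floor_eq_iff]
    refine ⟨h1.1, h1.2.lt_of_ne fun h2 => mem_nonint.1 (h hi) (c i + 1) ?_⟩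
    rw [h2]
    push_cast
    rfl
  · rw [eq_of_mem_gridCell ha hi, Int.floor_intCast]

theorem locallyFinite_gridCell : LocallyFinite (gridCell (k := k)) := by
  intro a
  refine ⟨Metric.ball a 1, Metric.ball_mem_nhds a one_pos, ?_⟩
  -- A cell meeting the unit ball around `a` has its base corner near the floor of `a`; the bound 3
  -- leaves room to spare.
  refine (Set.Finite.prod (Set.finite_univ (α := Finset (Fin k)))
    (Set.finite_Icc (fun i => ⌊a i⌋ - 3) (fun i => ⌊a i⌋ + 3))).subset ?_
  rintro ⟨J, c⟩ ⟨b, hb, hba⟩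
  have h1 : ∀ i, (⌊a i⌋ : ℤ) - 3 ≤ c i ∧ c i ≤ ⌊a i⌋ + 3 := by
    intro i
    have h2 := mem_gridCell.1 hb i
    have h3 : abs (b i - a i) < 1 := lt_of_le_of_lt (norm_le_pi_norm (b - a) i) (by
      rwa [Metric.mem_ball, dist_eq_norm] at hba)
    rw [abs_lt] at h3
    have h4 := Int.floor_le (a i)
    have h5 := Int.lt_floor_add_one (a i)
    have h6 : b i ≤ c i + 1 := by
      refine h2.2.trans ?_
      split_ifs <;> linarith
    constructor
    · have : ((⌊a i⌋ - 3 : ℤ) : ℝ) ≤ c i := by push_cast; linarith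
      exact_mod_cast this
    · have : (c i : ℝ) ≤ ((⌊a i⌋ + 3 : ℤ) : ℝ) := by push_cast; linarith [h2.1]
      exact_mod_cast this
  exact ⟨Set.mem_univ _, fun i => (h1 i).1, fun i => (h1 i).2⟩

/-- The points with less than `j` non-integral coordinates. -/
def gridSkeleton (k j : ℕ) : Set (Fin k → ℝ) := Set.ofPred fun a => (nonint a).card < j

theorem isClosed_gridSkeleton (j : ℕ) : IsClosed (gridSkeleton k j) := by
  have h : gridSkeleton k j = ⋃ p : {p : Finset (Fin k) × (Fin k → ℤ) // p.1.card < j},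
      gridCell p.1 := by
    ext a
    rw [Set.mem_iUnion]
    constructor
    · exact fun h => ⟨⟨(nonint a, fun i => ⌊a i⌋), h⟩, mem_gridCell_nonint a⟩
    · rintro ⟨⟨⟨J, c⟩, hp⟩, ha⟩
      exact (Finset.card_le_card (nonint_subset ha)).trans_lt hp
  rw [h]
  exact (locallyFinite_gridCell.comp_injective Subtype.val_injective).isClosed_iUnion
    fun p => isClosed_gridCell p.1

variable {T : Type*} [TopologicalSpace T] {n : ℕ}

theorem norm_eq_one_iff_of_le {j : ℕ} {y : Fin j → ℝ} (hy : ‖y‖ ≤ 1) :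
    ‖y‖ = 1 ↔ ∃ l, abs (y l) = 1 := by
  constructor
  · intro h
    by_contra! hne
    refine ((pi_norm_lt_iff zero_lt_one).2 fun l => ?_).ne h
    exact ((norm_le_pi_norm y l).trans hy).lt_of_ne (hne l)
  · rintro ⟨l, hl⟩
    exact le_antisymm hy (hl ▸ norm_le_pi_norm y l)

/-- The cell is affinely a ball of dimension `J.card`, with the part in the lower skeleton as its
boundary sphere: there some coordinate in `J` reaches one of its two ends. -/
theorem exists_extension_gridCell (hT : IsNConnected n T) (J : Finset (Fin k)) (c : Fin k → ℤ)
    (hJ : J.card ≤ n + 1) (f : (Fin k → ℝ) → T)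
    (hf : ContinuousOn f (gridCell (J, c) ∩ gridSkeleton k J.card)) :
    ∃ g : (Fin k → ℝ) → T, ContinuousOn g (gridCell (J, c)) ∧
      ∀ a ∈ gridCell (J, c) ∩ gridSkeleton k J.card, g a = f a := by
  classical
  let e : J ≃ Fin J.card := J.equivFin
  let φ : (Fin J.card → ℝ) → (Fin k → ℝ) := fun y i =>
    if h : i ∈ J then c i + (y (e ⟨i, h⟩) + 1) / 2 else c i
  let ψ : (Fin k → ℝ) → (Fin J.card → ℝ) := fun a l => 2 * (a (e.symm l).1 - c (e.symm l).1) - 1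
  have hφc : Continuous φ := continuous_pi fun i => by
    by_cases h : i ∈ J
    · simp only [φ, dif_pos h]
      fun_prop
    · simp only [φ, dif_neg h]
      fun_prop
  have hψc : Continuous ψ := by fun_prop
  have hφψ : ∀ a ∈ gridCell (J, c), φ (ψ a) = a := by
    intro a ha
    funext i
    by_cases h : i ∈ J
    · simp only [φ, ψ, dif_pos h, Equiv.symm_apply_apply]
      ring
    · simp only [φ, dif_neg h]
      exact (eq_of_mem_gridCell ha h).symm
  have hψ : ∀ a ∈ gridCell (J, c), ‖ψ a‖ ≤ 1 := by
    intro a ha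
    refine (pi_norm_le_iff_of_nonneg zero_le_one).2 fun l => ?_
    have := mem_gridCell.1 ha (e.symm l).1
    rw [if_pos (e.symm l).2] at this
    rw [Real.norm_eq_abs, abs_le]
    simp only [ψ]
    constructor <;> linarith [this.1, this.2]
  have hφ : ∀ y, ‖y‖ ≤ 1 → φ y ∈ gridCell (J, c) := by
    intro y hy
    refine mem_gridCell.2 fun i => ?_
    by_cases h : i ∈ J
    · have := abs_le.1 ((norm_le_pi_norm y (e ⟨i, h⟩)).trans hy)
      simp only [φ, dif_pos h, if_pos h]
      constructor <;> linarith [this.1, this.2]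
    · simp only [φ, dif_neg h, if_neg h, add_zero]
      exact ⟨le_rfl, le_rfl⟩
  have hφs : ∀ y ∈ Metric.sphere (0 : Fin J.card → ℝ) 1,
      φ y ∈ gridCell (J, c) ∩ gridSkeleton k J.card := by
    intro y hy
    rw [mem_sphere_zero_iff_norm] at hy
    refine ⟨hφ y hy.le, ?_⟩
    obtain ⟨l, hl⟩ := (norm_eq_one_iff_of_le hy.le).1 hy
    refine Finset.card_lt_card ⟨nonint_subset (hφ y hy.le), fun h => ?_⟩
    have h1 := mem_nonint.1 (h (e.symm l).2)
    have h2 : φ y (e.symm l).1 = c (e.symm l).1 + (y l + 1) / 2 := by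
      simp only [φ, dif_pos (e.symm l).2]
      simp
    rcases eq_or_eq_neg_of_abs_eq hl with h3 | h3
    · refine h1 (c (e.symm l).1 + 1) ?_
      rw [h2, h3]
      push_cast
      ring
    · refine h1 (c (e.symm l).1) ?_
      rw [h2, h3]
      ring
  obtain ⟨G, hG⟩ := exists_extension_ball hT hJ (f ∘ φ) (hf.comp hφc.continuousOn hφs)
  refine ⟨fun a => if h : ‖ψ a‖ ≤ 1 then G ⟨ψ a, mem_closedBall_zero_iff.2 h⟩ else f a, ?_, ?_⟩
  · rw [continuousOn_iff_continuous_domRestrict]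
    have h1 : Continuous fun a : gridCell (J, c) =>
        G ⟨ψ a.1, mem_closedBall_zero_iff.2 (hψ a.1 a.2)⟩ :=
      G.continuous.comp ((hψc.comp continuous_subtype_val).subtype_mk _)
    convert h1 using 1
    funext a
    exact dif_pos (hψ a.1 a.2)
  · rintro a ⟨ha, hs⟩
    have hn : ‖ψ a‖ = 1 := by
      obtain ⟨i, hi, hia⟩ : ∃ i ∈ J, i ∉ nonint a := by
        by_contra! hne
        exact (Finset.card_le_card hne).not_gt hs
      rw [mem_nonint] at hia
      push Not at hia
      obtain ⟨z, hz⟩ := hia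
      refine (norm_eq_one_iff_of_le (hψ a ha)).2 ⟨e ⟨i, hi⟩, ?_⟩
      have h1 := mem_gridCell.1 ha i
      rw [if_pos hi, hz] at h1
      simp only [ψ, Equiv.symm_apply_apply, hz]
      have h2 : c i ≤ z := by exact_mod_cast h1.1
      have h3 : z ≤ c i + 1 := by exact_mod_cast h1.2
      have h4 : z = c i ∨ z = c i + 1 := by omega
      rcases h4 with h4 | h4 <;> rw [h4] <;> norm_num
    exact (dif_pos hn.le).trans ((hG ⟨ψ a, mem_closedBall_zero_iff.2 hn.le⟩ hn).trans
      (congrArg f (hφψ a ha)))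

/-- Induction over skeleta, filling the cells not contained in `L`; local finiteness gives
continuity. Since `gridSkeleton k j` contains cells of dimension below `j`, the bound `j ≤ n + 2`
only involves cells of dimension at most `n + 1`. -/
theorem exists_extension_gridSkeleton (hT : IsNConnected n T) {L : Set (Fin k → ℝ)}
    (hL : IsClosed L) (hcell : ∀ a ∈ L, gridCell (nonint a, fun i => ⌊a i⌋) ⊆ L)
    {h : (Fin k → ℝ) → T} (hh : ContinuousOn h L) (j : ℕ) (hj : j ≤ n + 2) :
    ∃ G : (Fin k → ℝ) → T, ContinuousOn G (L ∪ gridSkeleton k j) ∧ ∀ a ∈ L, G a = h a := by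
  classical
  induction j with
  | zero =>
    refine ⟨h, hh.mono ?_, fun a _ => rfl⟩
    rintro a (ha | ha)
    exacts [ha, absurd ha (Nat.not_lt_zero _)]
  | succ j ih =>
    obtain ⟨G, hG, hGL⟩ := ih (by omega)
    have hext : ∀ p : Finset (Fin k) × (Fin k → ℤ), ∃ g : (Fin k → ℝ) → T, p.1.card = j →
        ContinuousOn g (gridCell p) ∧ ∀ a ∈ gridCell p ∩ gridSkeleton k j, g a = G a := by
      rintro ⟨J, c⟩
      by_cases hJ : J.card = j
      · subst hJ
        obtain ⟨g, hg⟩ := exists_extension_gridCell hT J c (by omega) G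
          (hG.mono fun a ha => Or.inr ha.2)
        exact ⟨g, fun _ => hg⟩
      · exact ⟨G, fun h => absurd h hJ⟩
    choose g hg using hext
    -- A new point is treated by the filling of the one cell which has it in its relative interior.
    let G' : (Fin k → ℝ) → T := fun a =>
      if a ∈ L ∪ gridSkeleton k j then G a else g (nonint a, fun i => ⌊a i⌋) a
    refine ⟨G', ?_, fun a ha => (if_pos (Or.inl ha)).trans (hGL a ha)⟩
    let I := {p : Finset (Fin k) × (Fin k → ℤ) // p.1.card = j ∧ ¬ gridCell p ⊆ L}
    have h1 : L ∪ gridSkeleton k (j + 1) ⊆ (L ∪ gridSkeleton k j) ∪ ⋃ p : I, gridCell p.1 := by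
      intro a ha
      by_cases hA : a ∈ L ∪ gridSkeleton k j
      · exact Or.inl hA
      · refine Or.inr (Set.mem_iUnion.2 ⟨⟨(nonint a, fun i => ⌊a i⌋), ?_, fun hsub => ?_⟩,
          mem_gridCell_nonint a⟩)
        · rcases ha with ha | ha
          · exact absurd (Or.inl ha) hA
          · have h2 : ¬ (nonint a).card < j := fun h => hA (Or.inr h)
            have h3 : (nonint a).card < j + 1 := ha
            exact le_antisymm (Nat.lt_succ_iff.1 h3) (not_lt.1 h2)
        · exact hA (Or.inl (hsub (mem_gridCell_nonint a)))
    refine ContinuousOn.mono ?_ h1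
    have hlf : LocallyFinite fun p : I => gridCell p.1 :=
      locallyFinite_gridCell.comp_injective Subtype.val_injective
    refine ContinuousOn.union_of_isClosed ?_ ?_ (hL.union (isClosed_gridSkeleton j))
      (hlf.isClosed_iUnion fun p => isClosed_gridCell p.1)
    · exact hG.congr fun a ha => if_pos ha
    · refine hlf.continuousOn_iUnion (fun p => isClosed_gridCell p.1) ?_
      rintro ⟨⟨J, c⟩, hJ, hJL⟩
      refine (hg (J, c) hJ).1.congr fun a ha => ?_
      by_cases hA : a ∈ gridSkeleton k j
      · exact (if_pos (Or.inr hA)).trans ((hg (J, c) hJ).2 a ⟨ha, hA⟩).symm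
      · have h2 : nonint a = J := Finset.eq_of_subset_of_card_le (nonint_subset ha)
          (hJ.le.trans (not_lt.1 hA))
        have h3 : (fun i => ⌊a i⌋) = c := funext (floor_eq_of_mem_gridCell ha h2.ge)
        have h4 : a ∉ L := fun h => hJL (by
          have := hcell a h
          rwa [h2, h3] at this)
        have h5 : a ∉ L ∪ gridSkeleton k j := fun h => h.elim h4 hA
        refine (if_neg h5).trans ?_
        rw [h2, h3]

open scoped unitInterval

/-- Maps into an `n`-connected space which are defined near a closed subset of a cube of dimension
at most `n + 1` extend to the cube. -/
theorem exists_extension_cube (hT : IsNConnected n T) (hk : k ≤ n + 1) {F O : Set (Fin k → I)}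
    (hF : IsClosed F) (hO : IsOpen O) (hFO : F ⊆ O) {h : (Fin k → I) → T} (hh : ContinuousOn h O) :
    ∃ G : C(Fin k → I, T), ∀ t ∈ F, G t = h t := by
  obtain ⟨δ, hδ, hδO⟩ := hF.isCompact.exists_thickening_subset_open hO hFO
  -- The mesh `1 / N` is below `δ`, so every cell meeting `F` stays inside `O` after rescaling.
  obtain ⟨N, hN⟩ := exists_nat_gt (1 / δ)
  have hN0 : (0 : ℝ) < N := lt_trans (by positivity) hN
  have hN1 : 1 / (N : ℝ) < δ := by
    rw [div_lt_iff₀ hδ] at hN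
    rw [div_lt_iff₀ hN0, mul_comm]
    exact hN
  -- Rescaling followed by clamping to the cube, so that the grid on the entire space can be used.
  let r : (Fin k → ℝ) → (Fin k → I) := fun a i => Set.projIcc 0 1 zero_le_one (a i / N)
  have hr : Continuous r := continuous_pi fun i =>
    continuous_projIcc.comp ((continuous_apply i).div_const _)
  let J := {c : Fin k → ℤ // (gridCell (Finset.univ, c) ∩ r ⁻¹' F).Nonempty}
  let L : Set (Fin k → ℝ) := ⋃ c : J, gridCell (Finset.univ, c.1)
  have hL : IsClosed L := (locallyFinite_gridCell.comp_injective
    (g := fun c : J => (Finset.univ, c.1)) fun c c' h =>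
      Subtype.ext (congrArg Prod.snd h)).isClosed_iUnion fun c => isClosed_gridCell _
  have hLO : Set.MapsTo r L O := by
    intro a ha
    obtain ⟨⟨c, b, hb, hbF⟩, hac⟩ := Set.mem_iUnion.1 ha
    replace hac : a ∈ gridCell (Finset.univ, c) := hac
    refine hδO (Metric.mem_thickening_iff.2 ⟨r b, hbF, ?_⟩)
    refine (dist_pi_lt_iff hδ).2 fun i => ?_
    refine lt_of_le_of_lt ?_ hN1
    have h1 := mem_gridCell.1 hac i
    have h2 := mem_gridCell.1 hb i
    rw [if_pos (Finset.mem_univ i)] at h1 h2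
    have h3 : abs (a i / N - b i / N) ≤ 1 / N := by
      rw [← sub_div, abs_div, abs_of_pos hN0]
      refine div_le_div_of_nonneg_right ?_ hN0.le
      rw [abs_le]
      constructor <;> linarith [h1.1, h1.2, h2.1, h2.2]
    exact (Set.abs_projIcc_sub_projIcc zero_le_one).trans h3
  have hcell : ∀ a ∈ L, gridCell (nonint a, fun i => ⌊a i⌋) ⊆ L := by
    intro a ha b hb
    obtain ⟨⟨c, hne⟩, hac⟩ := Set.mem_iUnion.1 ha
    replace hac : a ∈ gridCell (Finset.univ, c) := hac
    refine Set.mem_iUnion.2 ⟨⟨c, hne⟩, mem_gridCell.2 fun i => ?_⟩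
    have h1 := mem_gridCell.1 hac i
    have h2 := mem_gridCell.1 hb i
    rw [if_pos (Finset.mem_univ i)] at h1 ⊢
    by_cases hi : i ∈ nonint a
    · rw [if_pos hi] at h2
      have h3 : ⌊a i⌋ = c i := by
        rw [Int.floor_eq_iff]
        refine ⟨h1.1, h1.2.lt_of_ne fun h => mem_nonint.1 hi (c i + 1) ?_⟩
        rw [h]
        push_cast
        rfl
      rwa [h3] at h2
    · have h3 := eq_of_mem_gridCell (mem_gridCell_nonint a) hi
      rw [if_neg hi, add_zero, ← h3] at h2
      exact ⟨h1.1.trans h2.1, h2.2.trans h1.2⟩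
  -- A point has at most `k` non-integral coordinates, so `gridSkeleton k (k + 1)` is everything.
  obtain ⟨G, hG, hGL⟩ := exists_extension_gridSkeleton hT hL hcell (h := h ∘ r)
    (hh.comp hr.continuousOn hLO) (k + 1) (by omega)
  have hG' : Continuous G := by
    rw [← continuousOn_univ]
    refine hG.mono fun a _ => Or.inr ?_
    exact Nat.lt_succ_iff.2 ((Finset.card_le_univ _).trans_eq (Fintype.card_fin k))
  have hrN : ∀ t : Fin k → I, r (fun i => N * t i) = t := by
    intro t
    funext i
    simp only [r, mul_div_cancel_left₀ _ hN0.ne']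
    exact Set.projIcc_val _ _
  refine ⟨⟨fun t => G fun i => N * t i, hG'.comp (by fun_prop)⟩, fun t ht => ?_⟩
  refine (hGL _ ?_).trans (congrArg h (hrN t))
  refine Set.mem_iUnion.2 ⟨⟨fun i => ⌊(N : ℝ) * t i⌋, fun i => N * t i, ?_, ?_⟩, ?_⟩
  · refine mem_gridCell.2 fun i => ⟨Int.floor_le _, ?_⟩
    rw [if_pos (Finset.mem_univ i)]
    exact (Int.lt_floor_add_one _).le
  · rw [Set.mem_preimage, hrN]
    exact ht
  · refine mem_gridCell.2 fun i => ⟨Int.floor_le _, ?_⟩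
    rw [if_pos (Finset.mem_univ i)]
    exact (Int.lt_floor_add_one _).le

end Grid

/-! ### Removing an object with highly connected link -/

section RemoveObject

open scoped unitInterval

variable {C : Type u} [Category.{v} C] {k : ℕ}

/-- A homotopy relative to the boundary of the cube, given by a formula. -/
theorem homotopicRel_of_formula {X : Type*} [TopologicalSpace X] {g g' : C(Fin k → I, X)}
    (H : I × (Fin k → I) → X) (hH : Continuous H) (h0 : ∀ a, H (0, a) = g a)
    (h1 : ∀ a, H (1, a) = g' a) (hb : ∀ s, ∀ a ∈ Cube.boundary (Fin k), H (s, a) = g a) :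
    g.HomotopicRel g' (Cube.boundary (Fin k)) :=
  ⟨{ toFun := H, continuous_toFun := hH, map_zero_left := h0, map_one_left := h1, prop' := hb }⟩

/-- The cut-off function which controls the movement towards an object. -/
noncomputable def cutoff (r : ℝ) : I := Set.projIcc 0 1 zero_le_one (4 * r - 1)

theorem continuous_cutoff : Continuous cutoff := by
  unfold cutoff
  exact continuous_projIcc.comp (by fun_prop)

theorem cutoff_of_le {r : ℝ} (h : r ≤ 1 / 4) : cutoff r = 0 :=
  Set.projIcc_of_le_left _ (by linarith)

theorem cutoff_of_ge {r : ℝ} (h : 1 / 2 ≤ r) : cutoff r = 1 :=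
  Set.projIcc_of_right_le _ (by linarith)

open scoped Classical in
/-- The movement of the points close to an object to this object. -/
noncomputable def gather (x : C) (p : classifyingSpace C) (s : I) : classifyingSpace C :=
  if mass (fun c => c = x) p ≤ 1 / 4 then p
  else push (fun c => c = x) p (s * cutoff (mass (fun c => c = x) p))

theorem gather_zero (x : C) (p : classifyingSpace C) : gather x p 0 = p := by
  unfold gather
  split_ifs with h
  · rfl
  · rw [zero_mul, push_zero _ (by linarith)]

theorem gather_of_le {x : C} {p : classifyingSpace C} (h : mass (fun c => c = x) p ≤ 1 / 4)
    (s : I) : gather x p s = p := if_pos h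

/-- At the end of the movement all points with at least half of their weight at `x` have become the
vertex `x`. Hence changing a cube within this region does not alter its gathered form. -/
theorem gather_one_of_ge {x : C} (hx : ∀ e : x ⟶ x, e = 𝟙 x) {p : classifyingSpace C}
    (h : 1 / 2 ≤ mass (fun c => c = x) p) : gather x p 1 = classifyingVertex x := by
  unfold gather
  rw [if_neg (by linarith), cutoff_of_ge h, one_mul]
  exact eq_classifyingVertex hx (mass_push_one _ (by linarith))

theorem continuous_gather (x : C) (g : C(Fin k → I, classifyingSpace C)) :
    Continuous fun q : I × (Fin k → I) => gather x (g q.2) q.1 := by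
  unfold gather
  have hm : Continuous fun q : I × (Fin k → I) => mass (fun c => c = x) (g q.2) :=
    (continuous_mass _).comp (g.continuous.comp continuous_snd)
  refine continuous_if_le hm continuous_const (g.continuous.comp continuous_snd).continuousOn ?_ ?_
  · refine (continuousOn_push fun c => c = x).comp (f := fun q : I × (Fin k → I) =>
      (g q.2, q.1 * cutoff (mass (fun c => c = x) (g q.2)))) (Continuous.continuousOn ?_) ?_
    · exact (g.continuous.comp continuous_snd).prodMk
        (continuous_fst.mul (continuous_cutoff.comp hm))
    · intro q hq
      have hq : 1 / 4 ≤ mass (fun c => c = x) (g q.2) := hq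
      exact ⟨lt_of_lt_of_le (by norm_num) hq, Set.mem_univ _⟩
  · intro q hq
    rw [cutoff_of_le hq.le, mul_zero, push_zero]
    rw [hq]
    norm_num

theorem homotopicRel_gather (x : C) (g g' : C(Fin k → I, classifyingSpace C))
    (hb : ∀ a ∈ Cube.boundary (Fin k), mass (fun c => c = x) (g a) = 0)
    (hg' : ∀ a, g' a = gather x (g a) 1) : g.HomotopicRel g' (Cube.boundary (Fin k)) :=
  homotopicRel_of_formula (fun q => gather x (g q.2) q.1) (continuous_gather x g)
    (fun a => gather_zero x (g a)) (fun a => (hg' a).symm)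
    fun s a ha => gather_of_le (by rw [hb a ha]; norm_num) s

theorem homotopicRel_push (A : C → Prop) (g g' : C(Fin k → I, classifyingSpace C))
    (hA : ∀ a, 0 < mass A (g a))
    (hb : ∀ a ∈ Cube.boundary (Fin k), mass (fun c => ¬ A c) (g a) = 0)
    (hg' : ∀ a, g' a = push A (g a) 1) : g.HomotopicRel g' (Cube.boundary (Fin k)) :=
  homotopicRel_of_formula (fun q => push A (g q.2) q.1)
    ((continuousOn_push A).comp_continuous (f := fun q : I × (Fin k → I) => (g q.2, q.1))
      (by fun_prop) fun q => ⟨hA q.2, Set.mem_univ _⟩)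
    (fun a => push_zero A (hA a)) (fun a => (hg' a).symm)
    fun s a ha => push_eq_self (hb a ha) s

/-- Points close to `x` are supported on `x` and on objects connected to `x` by an arrow. -/
theorem mass_link_eq_zero {Q : ObjectProperty C} {x : C} {B : C → Prop}
    (hB : ∀ y, B y → y ≠ x → Nonempty (y ⟶ x) ∨ Nonempty (x ⟶ y) → Q y) {p : classifyingSpace C}
    (hp : mass (fun c => ¬ B c) p = 0) (hx : 0 < mass (fun c => c = x) p) :
    mass (fun c => ¬ (c = x ∨ Q c)) p = 0 := by
  obtain ⟨ι, _, _, _, F, t, ht, hpos, rfl⟩ := exists_chainPoint_pos p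
  rw [mass_chainPoint _ F ht] at hx hp ⊢
  rw [chainMass_eq_zero_iff _ _ ht] at hp ⊢
  obtain ⟨l, hl⟩ := exists_of_chainMass_pos hx
  intro k hk
  by_contra hk0
  have hBk : B (F.obj k) := by
    by_contra h
    exact hk0 (hp k h)
  refine hk (Or.inr (hB _ hBk (fun h => hk (Or.inl h)) ?_))
  rcases le_total k l with h | h
  · exact Or.inl ⟨F.map (homOfLE h) ≫ eqToHom hl⟩
  · exact Or.inr ⟨eqToHom hl.symm ≫ F.map (homOfLE h)⟩

/-- If the link of `x` is sufficiently connected, cubes can be moved away from `x`. -/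
theorem exists_homotopicRel_of_link {Q : ObjectProperty C} {x : C}
    (hx : ∀ e : x ⟶ x, e = 𝟙 x) (hQ : ¬ Q x) (hno : ∀ z, Q z → (x ⟶ z) → (z ⟶ x) → False) {n : ℕ}
    (hT : IsNConnected n (classifyingSpace (LinkJoin Q x))) (hk : k ≤ n + 1) {B : C → Prop}
    (hB : ∀ y, B y → y ≠ x → Nonempty (y ⟶ x) ∨ Nonempty (x ⟶ y) → Q y)
    (g : C(Fin k → I, classifyingSpace C)) (hg : ∀ a, mass (fun c => ¬ B c) (g a) = 0)
    (hb : ∀ a ∈ Cube.boundary (Fin k), mass (fun c => c = x) (g a) = 0) :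
    ∃ g' : C(Fin k → I, classifyingSpace C), g.HomotopicRel g' (Cube.boundary (Fin k)) ∧
      ∀ a, mass (fun c => ¬ (c ≠ x ∧ (B c ∨ Q c))) (g' a) = 0 := by
  classical
  obtain ⟨ρ, hρ, hρ'⟩ := exists_linkMap hx hno hT.1.some
  set m : (Fin k → I) → ℝ := fun a => mass (fun c => c = x) (g a) with hm
  have hmc : Continuous m := (continuous_mass _).comp g.continuous
  have hlink : ∀ a, 0 < m a → mass (fun c => ¬ (c = x ∨ Q c)) (g a) = 0 := fun a ha =>
    mass_link_eq_zero hB (hg a) ha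
  -- With positive weight at `x` the support lies in `x` and `Q`; if the weight at `x` is below 1,
  -- some of it must be on `Q`.
  have hO : Set.MapsTo g (m ⁻¹' Set.Ioo 0 1)
      (mass (fun c => c = x) ⁻¹' Set.Ioi 0 ∩ mass Q ⁻¹' Set.Ioi 0) := by
    intro a ha
    refine ⟨ha.1, (mass_nonneg _ _).lt_of_ne fun h => ha.2.ne ?_⟩
    have h1 : mass (fun c => ¬ c = x) (g a) = 0 :=
      mass_eq_zero_mono (fun c hc => by tauto) (mass_or_eq_zero h.symm (hlink a ha.1))
    have h2 := mass_add_mass_not (fun c => c = x) (g a)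
    rw [h1, add_zero] at h2
    exact h2
  -- The projection to the link is defined on a neighbourhood of the level set of weight `1/2`. Its
  -- values on the level set extend over the entire cube; this is where the connectivity of the link
  -- enters.
  obtain ⟨G, hG⟩ := exists_extension_cube hT hk (F := m ⁻¹' {1 / 2}) (O := m ⁻¹' Set.Ioo 0 1)
    (isClosed_singleton.preimage hmc) (isOpen_Ioo.preimage hmc)
    (Set.preimage_mono (by rintro r rfl; norm_num)) (hρ.comp g.continuous.continuousOn hO)
  have hglue : ∀ a, m a = 1 / 2 → g a = linkCone (G a) := by
    intro a ha
    rw [hG a ha]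
    exact (hρ' (g a) ha (hlink a (by rw [ha]; norm_num)) hQ).symm
  -- The part of the cube near `x` is replaced by points at weight exactly `1/2`.
  let g₁ : C(Fin k → I, classifyingSpace C) :=
    ⟨fun a => if m a ≤ 1 / 2 then g a else linkCone (G a),
      Continuous.if_le g.continuous (continuous_linkCone.comp G.continuous) hmc continuous_const
        hglue⟩
  have h₁ : ∀ a, m a ≤ 1 / 2 → g₁ a = g a := fun a ha => if_pos ha
  have h₂ : ∀ a, ¬ m a ≤ 1 / 2 → g₁ a = linkCone (G a) := fun a ha => if_neg ha
  have hm₁ : ∀ a, mass (fun c => c = x) (g₁ a) ≤ 1 / 2 := by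
    intro a
    by_cases ha : m a ≤ 1 / 2
    · rwa [h₁ a ha]
    · rw [h₂ a ha, mass_linkCone hQ]
  have hb₁ : ∀ a ∈ Cube.boundary (Fin k), g₁ a = g a := fun a ha => h₁ a (by
    simp only [hm, hb a ha]; norm_num)
  -- Both cubes gather to the same cube `h`: they agree where the weight at `x` is at most `1/2`,
  -- and elsewhere both become the vertex `x`.
  have hgg₁ : g.HomotopicRel g₁ (Cube.boundary (Fin k)) := by
    let h : C(Fin k → I, classifyingSpace C) := ⟨fun a => gather x (g a) 1,
      (continuous_gather x g).comp (f := fun a => ((1 : I), a)) (by fun_prop)⟩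
    refine (homotopicRel_gather x g h hb fun a => rfl).trans
      (homotopicRel_gather x g₁ h (fun a ha => by rw [hb₁ a ha, hb a ha]) fun a => ?_).symm
    by_cases ha : m a ≤ 1 / 2
    · rw [h₁ a ha]
      rfl
    · refine (gather_one_of_ge hx (not_le.1 ha).le).trans (gather_one_of_ge hx ?_).symm
      rw [h₂ a ha, mass_linkCone hQ]
  have hpos : ∀ a, 0 < mass (fun c => c ≠ x) (g₁ a) := by
    intro a
    have := mass_add_mass_not (fun c => c = x) (g₁ a)
    have := hm₁ a
    change 0 < mass (fun c => ¬ c = x) (g₁ a)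
    linarith
  -- No point of `g₁` has more than half of its weight at `x`, so it can be pushed off `x`
  -- completely.
  let g₂ : C(Fin k → I, classifyingSpace C) := ⟨fun a => push (fun c => c ≠ x) (g₁ a) 1,
    (continuousOn_push fun c => c ≠ x).comp_continuous (f := fun a => (g₁ a, (1 : I)))
      (by fun_prop) fun a => ⟨hpos a, Set.mem_univ _⟩⟩
  refine ⟨g₂, hgg₁.trans (homotopicRel_push _ g₁ g₂ hpos (fun a ha => ?_) fun a => rfl), fun a => ?_⟩
  · rw [hb₁ a ha]
    exact mass_eq_zero_mono (fun c hc => not_not.1 hc) (hb a ha)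
  · have h3 : mass (fun c => ¬ (c = x ∨ B c ∨ Q c)) (g₁ a) = 0 := by
      by_cases ha : m a ≤ 1 / 2
      · rw [h₁ a ha]
        exact mass_eq_zero_mono (fun c hc => by tauto) (hg a)
      · rw [h₂ a ha]
        exact mass_eq_zero_mono (fun c hc => by tauto) (mass_linkCone_eq_zero (G a))
    exact mass_eq_zero_mono (fun c hc => by tauto)
      (mass_or_eq_zero (mass_push_eq_zero (hpos a) h3 1) (mass_push_one _ (hpos a)))

end RemoveObject

/-! ### Constructions that need positive weights -/

section PositiveChains

variable {C : Type u} [Category.{v} C]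

/-- The sub-chain of the objects of positive weight. -/
noncomputable def posChain {ι : Type} [LinearOrder ι] (F : ι ⥤ C) (t : ι → ℝ) :
    {k // 0 < t k} ⥤ C := (Subtype.mono_coe fun k => 0 < t k).functor ⋙ F

/-- Functions on the classifying space are families of functions of positively weighted chains which
are natural for surjections. -/
theorem exists_chainPoint_lift_of_pos {S : Sort*}
    (f : ∀ (ι : Type) [LinearOrder ι] [Fintype ι] [Nonempty ι], (ι ⥤ C) → (ι → ℝ) → S)
    (hf : ∀ (ι κ : Type) [LinearOrder ι] [Fintype ι] [Nonempty ι] [LinearOrder κ] [Fintype κ]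
      [Nonempty κ] (θ : ι → κ) (hθ : Monotone θ) (_ : Function.Surjective θ) (G : κ ⥤ C) (t : ι → ℝ),
      t ∈ stdSimplex ℝ ι → (∀ k, 0 < t k) → f ι (hθ.functor ⋙ G) t = f κ G (pushWeight θ t)) :
    ∃ Φ : classifyingSpace C → S, ∀ (ι : Type) [LinearOrder ι] [Fintype ι] [Nonempty ι]
      (F : ι ⥤ C) (t : ι → ℝ), t ∈ stdSimplex ℝ ι → (∀ k, 0 < t k) →
      Φ (chainPoint F t) = f ι F t := by
  classical
  have h0 : ∀ {ι : Type} {t : ι → ℝ} [Fintype ι], t ∈ stdSimplex ℝ ι → ∀ k, ¬ 0 < t k → t k = 0 :=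
    fun ht k hk => le_antisymm (not_lt.1 hk) (ht.1 k)
  have hne : ∀ {ι : Type} {t : ι → ℝ} [Fintype ι], t ∈ stdSimplex ℝ ι → Nonempty {k // 0 < t k} :=
    fun ht => ⟨⟨_, (exists_pos_of_mem_stdSimplex ht).choose_spec⟩⟩
  obtain ⟨Φ, hΦ⟩ := exists_chainPoint_lift (C := C) (S := S)
    (fun ι _ _ _ F t => if h : Nonempty {k // 0 < t k} then f {k // 0 < t k} (posChain F t)
      (fun k => t k.1) else f ι F t)
    (fun ι κ _ _ _ _ _ _ θ hθ G t ht => by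
      have h1 := hne ht
      have h2 := hne (pushWeight_mem θ ht)
      rw [dif_pos h1, dif_pos h2]
      have hpos : ∀ l, 0 < t l → 0 < pushWeight θ t (θ l) := fun l hl => hl.trans_le
        (Finset.single_le_sum (f := t) (fun i _ => ht.1 i) (by simp))
      -- Every object with positive pushed-forward weight comes from one with positive weight, so
      -- after restriction the order map is surjective.
      let θ' : {l // 0 < t l} → {k // 0 < pushWeight θ t k} := fun l => ⟨θ l.1, hpos l.1 l.2⟩
      have hθ' : Monotone θ' := fun a b h => hθ h
      have hs : Function.Surjective θ' := by
        rintro ⟨k, hk⟩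
        by_contra! hne
        refine hk.ne' (Finset.sum_eq_zero fun l hl => h0 ht l fun hl' => ?_)
        exact hne ⟨l, hl'⟩ (Subtype.ext (by simpa using hl))
      have h3 := hf _ _ θ' hθ' hs (posChain G (pushWeight θ t)) (fun l => t l.1)
        (subtype_weight_mem ht (h0 ht)) fun l => l.2
      refine h3.trans ?_
      congr 1
      funext k
      have h4 := sum_pushWeight (Subtype.val : {l // 0 < t l} → ι) (fun l => t l.1)
        (fun l => θ l = k.1)
      rw [← pushWeight_subtype_val (h0 ht)] at h4
      unfold pushWeight
      rw [h4]
      refine Finset.sum_congr ?_ fun _ _ => rfl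
      ext l
      simp only [Finset.mem_filter, Finset.mem_univ, true_and]
      exact Subtype.ext_iff)
  refine ⟨Φ, ?_⟩
  intro ι _ _ _ F t ht hpos
  have h1 := hne ht
  rw [hΦ ι F t ht, dif_pos h1]
  refine (hf _ _ (Subtype.val : {k // 0 < t k} → ι) (Subtype.mono_coe _)
    (fun k => ⟨⟨k, hpos k⟩, rfl⟩) F (fun k => t k.1) (subtype_weight_mem ht (h0 ht))
    fun k => k.2).trans ?_
  rw [← pushWeight_subtype_val (h0 ht)]

theorem chainPoint_posChain {ι : Type} [LinearOrder ι] [Fintype ι] [Nonempty ι] (F : ι ⥤ C)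
    {t : ι → ℝ} (ht : t ∈ stdSimplex ℝ ι) [Fintype {k // 0 < t k}] [Nonempty {k // 0 < t k}] :
    chainPoint (posChain F t) (fun k => t k.1) = chainPoint F t :=
  chainPoint_subtype (fun k => 0 < t k) F ht fun k hk => le_antisymm (not_lt.1 hk) (ht.1 k)

end PositiveChains

/-! ### Alternations of a chain between `x` and other objects -/

section Blocks

variable {C : Type u} [Category.{v} C] {x : C}
variable {ι κ : Type} [LinearOrder ι] [LinearOrder κ]

/-- The numbering of the blocks of objects equal to `x` and different from `x` in a chain: the
objects of the odd blocks are equal to `x`. -/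
structure IsBlockIndex (x : C) (F : ι ⥤ C) (w : ι → ℕ) : Prop where
  monotone : Monotone w
  odd_iff : ∀ k, F.obj k = x ↔ Odd (w k)
  exists_eq : ∀ k j, 0 < j → j ≤ w k → ∃ l, w l = j

/-- Among monotone functions of the right parity one of least sum is taken. If it skipped a positive
value, all larger values could be lowered by 2. -/
theorem exists_isBlockIndex [Fintype ι] (x : C) (F : ι ⥤ C) : ∃ w, IsBlockIndex x F w := by
  classical
  let V : Set (ι → ℕ) := Set.ofPred fun w => Monotone w ∧ ∀ k, F.obj k = x ↔ Odd (w k)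
  have hV : V.Nonempty := by
    -- Twice the number of predecessors grows by at least 2 at each step, which leaves room for the
    -- parity correction.
    refine ⟨fun k => 2 * (Finset.univ.filter fun l => l < k).card + if F.obj k = x then 1 else 0,
      fun k l hkl => ?_, fun k => ?_⟩
    · rcases hkl.eq_or_lt with rfl | hlt
      · exact le_rfl
      · have h1 : (Finset.univ.filter fun i => i < k).card <
            (Finset.univ.filter fun i => i < l).card := by
          refine Finset.card_lt_card ⟨fun i hi => ?_, fun h => ?_⟩
          · simp only [Finset.mem_filter, Finset.mem_univ, true_and] at hi ⊢
            exact hi.trans hlt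
          · have := @h k (by simpa using hlt)
            simp at this
        dsimp only
        split_ifs <;> omega
    · by_cases h : F.obj k = x <;> simp [h]
  obtain ⟨w, hw, hmin⟩ := WellFounded.has_min (measure fun w : ι → ℕ => ∑ k, w k).wf V hV
  refine ⟨w, hw.1, hw.2, fun k j hj hjk => ?_⟩
  by_contra! hne
  let w' : ι → ℕ := fun l => if w l < j then w l else w l - 2
  refine hmin w' ⟨fun a b hab => ?_, fun a => ?_⟩ ?_
  · have h1 := hw.1 hab
    have h2 := hne a
    have h3 := hne b
    simp only [w']
    split_ifs <;> omega
  · rw [hw.2 a]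
    have h2 := hne a
    simp only [w']
    split_ifs with h
    · rfl
    · rw [Nat.odd_sub (by omega)]
      simp
  · change ∑ l, w' l < ∑ l, w l
    refine Finset.sum_lt_sum (fun l _ => ?_) ⟨k, Finset.mem_univ k, ?_⟩
    · simp only [w']
      split_ifs <;> omega
    · simp only [w']
      rw [if_neg (by omega)]
      omega

/-- Each value above 1 is preceded by an object with the previous value; the change of parity forces
`w'` to increase between them. Applied both ways this gives uniqueness. -/
theorem IsBlockIndex.le {F : ι ⥤ C} {w w' : ι → ℕ} (hw : IsBlockIndex x F w)
    (hw' : IsBlockIndex x F w') (k : ι) : w k ≤ w' k := by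
  have key : ∀ j k, w k = j → j ≤ w' k := by
    intro j
    induction j with
    | zero => exact fun k _ => Nat.zero_le _
    | succ j ih =>
      intro k hk
      rcases Nat.eq_zero_or_pos j with rfl | hj
      · have h1 : Odd (w' k) := by
          rw [← hw'.odd_iff, hw.odd_iff, hk]
          exact odd_one
        exact h1.pos
      · obtain ⟨l, hl⟩ := hw.exists_eq k j hj (by omega)
        have h1 := ih l hl
        have h2 : l ≤ k := by
          by_contra h
          have := hw.monotone (not_le.1 h).le
          omega
        have h3 := hw'.monotone h2
        have h4 : w' l ≠ w' k := by
          intro h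
          have h5 : Odd (w l) ↔ Odd (w k) := by
            rw [← hw.odd_iff, ← hw.odd_iff, hw'.odd_iff, hw'.odd_iff, h]
          rw [hl, hk, Nat.odd_add_one] at h5
          tauto
        omega
  exact key _ k rfl

theorem IsBlockIndex.unique {F : ι ⥤ C} {w w' : ι → ℕ} (hw : IsBlockIndex x F w)
    (hw' : IsBlockIndex x F w') : w = w' :=
  funext fun k => le_antisymm (hw.le hw' k) (hw'.le hw k)

/-- The numbering of the blocks. -/
noncomputable def blockIndex [Fintype ι] (x : C) (F : ι ⥤ C) : ι → ℕ :=
  (exists_isBlockIndex x F).choose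

theorem isBlockIndex_blockIndex [Fintype ι] (x : C) (F : ι ⥤ C) :
    IsBlockIndex x F (blockIndex x F) := (exists_isBlockIndex x F).choose_spec

theorem blockIndex_comp [Fintype ι] [Fintype κ] {θ : ι → κ} (hθ : Monotone θ) (G : κ ⥤ C)
    (h : ∀ l j, 0 < j → j ≤ blockIndex x G (θ l) → ∃ l', blockIndex x G (θ l') = j) :
    blockIndex x (hθ.functor ⋙ G) = fun l => blockIndex x G (θ l) := by
  have hG := isBlockIndex_blockIndex x G
  exact (isBlockIndex_blockIndex x _).unique
    ⟨hG.monotone.comp hθ, fun k => hG.odd_iff (θ k), h⟩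

theorem blockIndex_comp_of_surjective [Fintype ι] [Fintype κ] {θ : ι → κ} (hθ : Monotone θ)
    (hs : Function.Surjective θ) (G : κ ⥤ C) :
    blockIndex x (hθ.functor ⋙ G) = fun l => blockIndex x G (θ l) :=
  blockIndex_comp hθ G fun l j hj hjl => by
    obtain ⟨k, hk⟩ := (isBlockIndex_blockIndex x G).exists_eq _ j hj hjl
    obtain ⟨l', rfl⟩ := hs k
    exact ⟨l', hk⟩

/-- The number of blocks, starting with the first object equal to `x`. -/
noncomputable def blockCount [Fintype ι] (x : C) (F : ι ⥤ C) : ℕ :=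
  Finset.univ.sup (blockIndex x F)

theorem blockIndex_le [Fintype ι] (F : ι ⥤ C) (k : ι) : blockIndex x F k ≤ blockCount x F :=
  Finset.le_sup (f := blockIndex x F) (Finset.mem_univ k)

theorem exists_blockIndex_eq [Fintype ι] (F : ι ⥤ C) {j : ℕ} (hj : 0 < j)
    (hjn : j ≤ blockCount x F) : ∃ k, blockIndex x F k = j := by
  obtain ⟨k, -, hk⟩ := (Finset.le_sup_iff (s := Finset.univ) (f := blockIndex x F) hj).1 hjn
  exact (isBlockIndex_blockIndex x F).exists_eq k j hj hk

theorem blockCount_comp_of_surjective [Fintype ι] [Fintype κ] {θ : ι → κ} (hθ : Monotone θ)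
    (hs : Function.Surjective θ) (G : κ ⥤ C) :
    blockCount x (hθ.functor ⋙ G) = blockCount x G := by
  unfold blockCount
  rw [blockIndex_comp_of_surjective hθ hs]
  refine le_antisymm (Finset.sup_le fun l _ => Finset.le_sup (f := blockIndex x G)
    (Finset.mem_univ _)) (Finset.sup_le fun k _ => ?_)
  obtain ⟨l, rfl⟩ := hs k
  exact Finset.le_sup (f := fun l => blockIndex x G (θ l)) (Finset.mem_univ l)

/-- Sequences of objects of a chain which alternate between `x` and other objects. -/
def IsAlternating (x : C) (F : ι ⥤ C) {N : ℕ} (a : Fin N → ι) : Prop :=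
  Monotone a ∧ ∀ i, F.obj (a i) = x ↔ Even i.1

/-- Along an alternating sequence, monotone functions of the right parity take all values. -/
theorem exists_eq_of_isAlternating {F : ι ⥤ C} {N : ℕ} {a : Fin N → ι} (ha : IsAlternating x F a)
    {w : ι → ℕ} (hw : Monotone w) (hodd : ∀ k, F.obj k = x ↔ Odd (w k)) {n : ℕ}
    (hn : ∀ i, w (a i) ≤ n) : N ≤ n ∧ (N = n → ∀ j, 0 < j → j ≤ n → ∃ i, w (a i) = j) := by
  have hstep : ∀ i (hi : i + 1 < N), w (a ⟨i, by omega⟩) < w (a ⟨i + 1, hi⟩) := by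
    intro i hi
    refine (hw (ha.1 (Nat.le_succ i : (⟨i, by omega⟩ : Fin N) ≤ ⟨i + 1, hi⟩))).lt_of_ne fun h => ?_
    have h1 := (ha.2 ⟨i, by omega⟩).symm.trans (hodd _)
    have h2 := (ha.2 ⟨i + 1, hi⟩).symm.trans (hodd _)
    rw [h] at h1
    have h3 : Even i ↔ Even (i + 1) := h1.trans h2.symm
    rw [Nat.even_add_one] at h3
    tauto
  have hge : ∀ i (hi : i < N), i + 1 ≤ w (a ⟨i, hi⟩) := by
    intro i
    induction i with
    | zero =>
      intro hi
      exact ((hodd _).1 ((ha.2 ⟨0, hi⟩).2 Even.zero)).pos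
    | succ i ih =>
      intro hi
      have := hstep i hi
      have := ih (by omega)
      omega
  have hle : ∀ d i (hi : i < N), i + d + 1 = N → w (a ⟨i, hi⟩) + d ≤ n := by
    intro d
    induction d with
    | zero => exact fun i hi _ => hn _
    | succ d ih =>
      intro i hi h
      have := ih (i + 1) (by omega) (by omega)
      have := hstep i (by omega)
      omega
  constructor
  · rcases Nat.eq_zero_or_pos N with h | h
    · omega
    · exact le_trans (by omega) ((hge (N - 1) (by omega)).trans (hn _))
  · rintro rfl j hj hjn
    refine ⟨⟨j - 1, by omega⟩, ?_⟩
    have h1 := hge (j - 1) (by omega)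
    have h2 := hle (N - j) (j - 1) (by omega) (by omega)
    omega

theorem le_blockCount [Fintype ι] {F : ι ⥤ C} {N : ℕ} {a : Fin N → ι} (ha : IsAlternating x F a) :
    N ≤ blockCount x F :=
  (exists_eq_of_isAlternating ha (isBlockIndex_blockIndex x F).monotone
    (isBlockIndex_blockIndex x F).odd_iff fun _ => blockIndex_le F _).1

theorem exists_isAlternating [Fintype ι] (F : ι ⥤ C) {N : ℕ} (hN : N ≤ blockCount x F) :
    ∃ a : Fin N → ι, IsAlternating x F a := by
  have hw := isBlockIndex_blockIndex x F
  choose a ha using fun i : Fin N => exists_blockIndex_eq (x := x) F (Nat.succ_pos i.1)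
    (i.2.trans_le hN)
  refine ⟨a, fun i j hij => ?_, fun i => ?_⟩
  · rcases hij.eq_or_lt with rfl | hlt
    · exact le_rfl
    · by_contra h
      have h1 := hw.monotone (not_le.1 h).le
      rw [ha, ha] at h1
      have h2 : i.1 < j.1 := hlt
      omega
  · rw [hw.odd_iff, ha, Nat.odd_add_one, Nat.not_odd_iff_even]

open scoped Classical in
/-- The polynomial which is nonzero if and only if there is an alternating sequence of objects of
positive weight. -/
noncomputable def chainAlternation [Fintype ι] (x : C) (N : ℕ) (F : ι ⥤ C) (t : ι → ℝ) : ℝ :=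
  ∑ a : Fin N → ι with IsAlternating x F a, ∏ i, t (a i)

/-- Consecutive members of an alternating sequence differ in being equal to `x`, so `θ` cannot merge
them and their order can be read off after `θ`. -/
theorem isAlternating_comp {θ : ι → κ} (hθ : Monotone θ) (G : κ ⥤ C) {N : ℕ} (a : Fin N → ι) :
    IsAlternating x (hθ.functor ⋙ G) a ↔ IsAlternating x G (θ ∘ a) := by
  refine ⟨fun h => ⟨hθ.comp h.1, h.2⟩, fun h => ⟨?_, h.2⟩⟩
  match N with
  | 0 => exact fun i => i.elim0
  | N + 1 =>
    refine Fin.monotone_iff_le_succ.2 fun i => ?_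
    by_contra hlt
    have h1 : θ (a i.castSucc) = θ (a i.succ) :=
      le_antisymm (h.1 i.castSucc_lt_succ.le) (hθ (not_le.1 hlt).le)
    have h2 := h.2 i.castSucc
    have h3 := h.2 i.succ
    rw [Function.comp_apply] at h2 h3
    rw [h1] at h2
    have h4 : Even i.1 ↔ Even (i.1 + 1) := h2.symm.trans h3
    rw [Nat.even_add_one] at h4
    tauto

-- Expanding the products of pushed-forward weights gives a sum over lifts of alternating sequences,
-- which are exactly the alternating sequences upstairs. Thus the polynomial is natural, unlike the
-- number of blocks itself.
variable (C) in
theorem exists_alternation (x : C) (N : ℕ) : ∃ Φ : classifyingSpace C → ℝ, ∀ (ι : Type)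
    [LinearOrder ι] [Fintype ι] [Nonempty ι] (F : ι ⥤ C) (t : ι → ℝ), t ∈ stdSimplex ℝ ι →
    Φ (chainPoint F t) = chainAlternation x N F t :=
  exists_chainPoint_lift (fun ι _ _ _ F t => chainAlternation x N F t)
    fun ι κ _ _ _ _ _ _ θ hθ G t _ => by
      classical
      unfold chainAlternation pushWeight
      simp only [Finset.prod_univ_sum]
      rw [Finset.sum_comm' (t' := Finset.univ.filter fun a => IsAlternating x (hθ.functor ⋙ G) a)
        (s' := fun a => {θ ∘ a})]
      · simp
      · intro b a
        simp only [Finset.mem_filter, Finset.mem_univ, true_and, Finset.mem_singleton,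
          Fintype.mem_piFinset, isAlternating_comp]
        constructor
        · rintro ⟨h1, h2⟩
          obtain rfl : θ ∘ a = b := funext h2
          exact ⟨rfl, h1⟩
        · rintro ⟨rfl, h1⟩
          exact ⟨h1, fun _ => rfl⟩

/-- The sum over all alternating sequences in a chain of the products of their weights. -/
noncomputable def alternation (x : C) (N : ℕ) (p : classifyingSpace C) : ℝ :=
  Classical.choose (exists_alternation C x N) p

variable [Fintype ι] [Nonempty ι]

theorem alternation_chainPoint (x : C) (N : ℕ) (F : ι ⥤ C) {t : ι → ℝ} (ht : t ∈ stdSimplex ℝ ι) :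
    alternation x N (chainPoint F t) = chainAlternation x N F t :=
  Classical.choose_spec (exists_alternation C x N) ι F t ht

theorem continuous_alternation (x : C) (N : ℕ) : Continuous (alternation x N) :=
  continuous_of_chainPoint fun _ F => by
    have h : Continuous (chainAlternation x N F) := by
      unfold chainAlternation
      fun_prop
    exact h.continuousOn.congr fun _ ht => alternation_chainPoint x N F ht

theorem chainAlternation_eq_zero_iff (F : ι ⥤ C) {t : ι → ℝ} (ht : t ∈ stdSimplex ℝ ι) (N : ℕ) :
    chainAlternation x N F t = 0 ↔ ∀ a : Fin N → ι, IsAlternating x F a → ∃ i, t (a i) = 0 := by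
  classical
  unfold chainAlternation
  rw [Finset.sum_eq_zero_iff_of_nonneg fun a _ => Finset.prod_nonneg fun i _ => ht.1 _]
  simp [Finset.prod_eq_zero_iff]

theorem alternation_nonneg (x : C) (N : ℕ) (p : classifyingSpace C) : 0 ≤ alternation x N p := by
  obtain ⟨m, F, t, ht, rfl⟩ := exists_chainPoint p
  rw [alternation_chainPoint x N F ht]
  exact Finset.sum_nonneg fun a _ => Finset.prod_nonneg fun i _ => ht.1 _

/-- The zero sets of `alternation x N` therefore form a closed filtration of the classifying space
by the number of blocks. -/
theorem alternation_eq_zero_iff_of_pos (F : ι ⥤ C) {t : ι → ℝ} (ht : t ∈ stdSimplex ℝ ι)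
    (hpos : ∀ k, 0 < t k) (N : ℕ) : alternation x N (chainPoint F t) = 0 ↔ blockCount x F < N := by
  rw [alternation_chainPoint x N F ht, chainAlternation_eq_zero_iff F ht]
  constructor
  · intro h
    by_contra hN
    obtain ⟨a, ha⟩ := exists_isAlternating (x := x) F (not_lt.1 hN)
    obtain ⟨i, hi⟩ := h a ha
    exact (hpos _).ne' hi
  · intro h a ha
    exact absurd (le_blockCount ha) (not_le.2 h)

theorem alternation_eq_zero_of_le (F : ι ⥤ C) {t : ι → ℝ} (ht : t ∈ stdSimplex ℝ ι) {N : ℕ}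
    (hN : blockCount x F < N) : alternation x N (chainPoint F t) = 0 := by
  rw [alternation_chainPoint x N F ht, chainAlternation_eq_zero_iff F ht]
  exact fun a ha => absurd (le_blockCount ha) (not_le.2 hN)

theorem isAlternating_injective {F : ι ⥤ C} {N : ℕ} {a : Fin N → ι} (ha : IsAlternating x F a) :
    Function.Injective a := by
  have key : ∀ i j : Fin N, i < j → a i ≠ a j := by
    intro i j hij h
    have h1 : i.1 + 1 ≤ j.1 := hij
    have h2 : a ⟨i.1 + 1, by omega⟩ = a i := le_antisymm
      ((ha.1 (show (⟨i.1 + 1, by omega⟩ : Fin N) ≤ j from h1)).trans h.ge)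
      (ha.1 (show i ≤ ⟨i.1 + 1, by omega⟩ from Nat.le_succ _))
    have h3 := ha.2 i
    have h4 := ha.2 ⟨i.1 + 1, by omega⟩
    rw [h2, h3, Nat.even_add_one] at h4
    tauto
  intro i j h
  rcases lt_trichotomy i j with h1 | h1 | h1
  exacts [absurd h (key _ _ h1), h1, absurd h.symm (key _ _ h1)]

theorem alternation_eq_zero_of_card_lt (F : ι ⥤ C) {t : ι → ℝ} (ht : t ∈ stdSimplex ℝ ι) {N : ℕ}
    (hN : Fintype.card ι < N) : alternation x N (chainPoint F t) = 0 := by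
  rw [alternation_chainPoint x N F ht, chainAlternation_eq_zero_iff F ht]
  intro a ha
  have := Fintype.card_le_of_injective a (isAlternating_injective ha)
  rw [Fintype.card_fin] at this
  exact absurd this (not_le.2 hN)

/-- A compact set contains only chains with boundedly many blocks. -/
theorem exists_alternation_eq_zero_of_isCompact (x : C) {K : Set (classifyingSpace C)}
    (hK : IsCompact K) : ∃ n, ∀ p ∈ K, alternation x (n + 1) p = 0 := by
  have h := finite_nonzero_of_isCompact (φ := fun n => alternation x (n + 1))
    (fun n => continuous_alternation x (n + 1)) (fun n => alternation_nonneg x (n + 1))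
    (fun m F => (Set.finite_Iio (m + 1)).subset fun j hj => by
      obtain ⟨t, ht, hne⟩ := hj
      by_contra h
      refine hne (alternation_eq_zero_of_card_lt F ht ?_)
      rw [Fintype.card_fin]
      have : ¬ j < m + 1 := h
      omega) hK
  obtain ⟨n, hn⟩ := h.exists_notMem
  refine ⟨n, fun p hp => ?_⟩
  by_contra hne
  exact hn ⟨p, hp, hne⟩

theorem mass_eq_zero_of_alternation {p : classifyingSpace C} (h : alternation x 1 p = 0) :
    mass (fun c => c = x) p = 0 := by
  obtain ⟨m, F, t, ht, rfl⟩ := exists_chainPoint p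
  rw [alternation_chainPoint x 1 F ht, chainAlternation_eq_zero_iff F ht] at h
  rw [mass_chainPoint _ F ht, chainMass_eq_zero_iff _ F ht]
  intro k hk
  obtain ⟨i, hi⟩ := h (fun _ => k) ⟨monotone_const, fun i => by simp [hk]⟩
  exact hi

end Blocks

/-! ### Removing equal weight from all blocks -/

section BlockWeights

variable {ι κ : Type} [Fintype ι] [Fintype κ]

open scoped Classical in
/-- The total weight of a block. -/
noncomputable def blockMass (w : ι → ℕ) (t : ι → ℝ) (j : ℕ) : ℝ := ∑ k with w k = j, t k

/-- The smallest weight of the blocks `1, …, n + 1`. -/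
noncomputable def minBlockMass (n : ℕ) (w : ι → ℕ) (t : ι → ℝ) : ℝ :=
  Finset.univ.inf' Finset.univ_nonempty fun j : Fin (n + 1) => blockMass w t (j.1 + 1)

/-- The share of an object which is removed. -/
noncomputable def shareFactor (n : ℕ) (w : ι → ℕ) (t : ι → ℝ) (k : ι) : ℝ :=
  if w k = 0 then 0 else minBlockMass n w t / blockMass w t (w k)

theorem blockMass_comp (θ : ι → κ) (w : κ → ℕ) (t : ι → ℝ) (j : ℕ) :
    blockMass (fun l => w (θ l)) t j = blockMass w (pushWeight θ t) j := by
  unfold blockMass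
  convert (sum_pushWeight θ t fun k => w k = j).symm

theorem minBlockMass_comp (n : ℕ) (θ : ι → κ) (w : κ → ℕ) (t : ι → ℝ) :
    minBlockMass n (fun l => w (θ l)) t = minBlockMass n w (pushWeight θ t) := by
  unfold minBlockMass
  simp only [blockMass_comp]

theorem shareFactor_comp (n : ℕ) (θ : ι → κ) (w : κ → ℕ) (t : ι → ℝ) (l : ι) :
    shareFactor n (fun l => w (θ l)) t l = shareFactor n w (pushWeight θ t) (θ l) := by
  unfold shareFactor
  rw [blockMass_comp, minBlockMass_comp]

variable {n : ℕ} {w : ι → ℕ} {t : ι → ℝ}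

theorem blockMass_nonneg (ht : ∀ k, 0 ≤ t k) (j : ℕ) : 0 ≤ blockMass w t j :=
  Finset.sum_nonneg fun k _ => ht k

theorem le_blockMass (ht : ∀ k, 0 ≤ t k) (k : ι) : t k ≤ blockMass w t (w k) := by
  classical
  exact Finset.single_le_sum (f := t) (fun l _ => ht l) (by simp)

theorem exists_pos_of_blockMass_ne_zero (ht : ∀ k, 0 ≤ t k) {j : ℕ} (h : blockMass w t j ≠ 0) :
    ∃ k, w k = j ∧ 0 < t k := by
  classical
  by_contra! hne
  refine h (Finset.sum_eq_zero fun k hk => le_antisymm (hne k ?_) (ht k))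
  simpa using hk

theorem minBlockMass_le {j : ℕ} (h0 : j ≠ 0) (hj : j ≤ n + 1) :
    minBlockMass n w t ≤ blockMass w t j := by
  have h := Finset.inf'_le (s := Finset.univ)
    (fun j : Fin (n + 1) => blockMass w t (j.1 + 1)) (Finset.mem_univ ⟨j - 1, by omega⟩)
  have h1 : j - 1 + 1 = j := by omega
  simp only [h1] at h
  exact h

theorem minBlockMass_nonneg (ht : ∀ k, 0 ≤ t k) : 0 ≤ minBlockMass n w t :=
  Finset.le_inf' _ _ fun _ _ => blockMass_nonneg ht _

theorem exists_minBlockMass_eq (n : ℕ) (w : ι → ℕ) (t : ι → ℝ) :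
    ∃ j, 0 < j ∧ j ≤ n + 1 ∧ minBlockMass n w t = blockMass w t j := by
  obtain ⟨j, -, hj⟩ := Finset.exists_mem_eq_inf' Finset.univ_nonempty
    (fun j : Fin (n + 1) => blockMass w t (j.1 + 1))
  exact ⟨j.1 + 1, Nat.succ_pos _, j.2, hj⟩

theorem shareFactor_nonneg (ht : ∀ k, 0 ≤ t k) (k : ι) : 0 ≤ shareFactor n w t k := by
  unfold shareFactor
  split_ifs
  · exact le_rfl
  · exact div_nonneg (minBlockMass_nonneg ht) (blockMass_nonneg ht _)

theorem shareFactor_le_one (ht : ∀ k, 0 ≤ t k) (hw : ∀ k, w k ≤ n + 1) (k : ι) :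
    shareFactor n w t k ≤ 1 := by
  unfold shareFactor
  split_ifs with h
  · exact zero_le_one
  · exact div_le_one_of_le₀ (minBlockMass_le h (hw k)) (blockMass_nonneg ht _)

theorem shareFactor_eq_zero (h : minBlockMass n w t = 0) (k : ι) : shareFactor n w t k = 0 := by
  unfold shareFactor
  rw [h, zero_div, ite_self]

/-- A block of least mass is emptied completely; this is what makes a block disappear. -/
theorem shareFactor_mul_eq {k : ι} (ht : ∀ k, 0 ≤ t k) (h0 : w k ≠ 0)
    (h : minBlockMass n w t = blockMass w t (w k)) : shareFactor n w t k * t k = t k := by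
  unfold shareFactor
  rw [if_neg h0, h]
  by_cases hb : blockMass w t (w k) = 0
  · have : t k = 0 := le_antisymm (hb ▸ le_blockMass ht k) (ht k)
    rw [this, mul_zero]
  · rw [div_self hb, one_mul]

/-- Each of the `n + 1` blocks numbered from 1 loses exactly the least block mass, and block 0 loses
nothing. -/
theorem sum_shareFactor_mul (ht : ∀ k, 0 ≤ t k) (hw : ∀ k, w k ≤ n + 1) :
    ∑ k, shareFactor n w t k * t k = (n + 1) * minBlockMass n w t := by
  classical
  rcases (minBlockMass_nonneg (n := n) (w := w) ht).eq_or_lt with h0 | h0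
  · rw [← h0, mul_zero]
    exact Finset.sum_eq_zero fun k _ => by rw [shareFactor_eq_zero h0.symm, zero_mul]
  · have h1 : ∀ j : Fin (n + 1), ∑ k with w k = j.1 + 1, shareFactor n w t k * t k =
        minBlockMass n w t := by
      intro j
      have h2 : blockMass w t (j.1 + 1) ≠ 0 :=
        (h0.trans_le (minBlockMass_le (Nat.succ_ne_zero _) j.2)).ne'
      have h3 : ∀ k ∈ Finset.univ.filter (fun k => w k = j.1 + 1), shareFactor n w t k * t k =
          minBlockMass n w t / blockMass w t (j.1 + 1) * t k := by
        intro k hk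
        simp only [Finset.mem_filter, Finset.mem_univ, true_and] at hk
        unfold shareFactor
        rw [if_neg (by omega), hk]
      rw [Finset.sum_congr rfl h3, ← Finset.mul_sum]
      have h4 : ∑ k with w k = j.1 + 1, t k = blockMass w t (j.1 + 1) := by
        unfold blockMass
        congr!
      rw [h4, div_mul_cancel₀ _ h2]
    have h5 : ∑ k, shareFactor n w t k * t k =
        ∑ j : Fin (n + 1), ∑ k with w k = j.1 + 1, shareFactor n w t k * t k := by
      rw [Finset.sum_comm' (t' := Finset.univ)
        (s' := fun k => Finset.univ.filter fun j : Fin (n + 1) => w k = j.1 + 1) (by simp)]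
      refine Finset.sum_congr rfl fun k _ => ?_
      by_cases hk : w k = 0
      · rw [shareFactor, if_pos hk]
        simp
      · rw [Finset.sum_eq_single (⟨w k - 1, by have := hw k; omega⟩ : Fin (n + 1))]
        · intro j hj hne
          simp only [Finset.mem_filter, Finset.mem_univ, true_and] at hj
          exact absurd (Fin.ext (by simp only; omega)) hne
        · intro h
          refine absurd (Finset.mem_filter.2 ⟨Finset.mem_univ _, ?_⟩) h
          simp only
          omega
    rw [h5, Finset.sum_congr rfl fun j _ => h1 j]
    simp

theorem continuous_blockMass (w : ι → ℕ) (j : ℕ) : Continuous fun t : ι → ℝ => blockMass w t j := by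
  unfold blockMass
  fun_prop

theorem continuous_minBlockMass (n : ℕ) (w : ι → ℕ) :
    Continuous fun t : ι → ℝ => minBlockMass n w t :=
  Continuous.finset_inf'_apply _ fun _ _ => continuous_blockMass w _

/-- Where the mass of the block vanishes the quotient is singular, but the product lies between 0
and `t k` and is squeezed to 0. -/
theorem continuousOn_shareFactor_mul (hw : ∀ k, w k ≤ n + 1) (k : ι) :
    ContinuousOn (fun t : ι → ℝ => shareFactor n w t k * t k) (stdSimplex ℝ ι) := by
  unfold shareFactor
  by_cases h0 : w k = 0
  · simp only [if_pos h0, zero_mul]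
    exact continuousOn_const
  simp only [if_neg h0]
  intro t₀ ht₀
  by_cases hb : blockMass w t₀ (w k) = 0
  · have h1 : t₀ k = 0 := le_antisymm (hb ▸ le_blockMass ht₀.1 k) (ht₀.1 k)
    rw [ContinuousWithinAt, h1, mul_zero]
    have h2 : Filter.Tendsto (fun t : ι → ℝ => t k) (𝓝[stdSimplex ℝ ι] t₀) (𝓝 0) := by
      have := (continuous_apply (A := fun _ : ι => ℝ) k).continuousWithinAt (s := stdSimplex ℝ ι)
        (x := t₀)
      rw [ContinuousWithinAt, h1] at this
      exact this
    refine tendsto_of_tendsto_of_tendsto_of_le_of_le' tendsto_const_nhds h2 ?_ ?_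
    · filter_upwards [self_mem_nhdsWithin] with t ht
      exact mul_nonneg (div_nonneg (minBlockMass_nonneg ht.1) (blockMass_nonneg ht.1 _)) (ht.1 k)
    · filter_upwards [self_mem_nhdsWithin] with t ht
      refine mul_le_of_le_one_left (ht.1 k) ?_
      exact div_le_one_of_le₀ (minBlockMass_le h0 (hw k)) (blockMass_nonneg ht.1 _)
  · exact (((continuous_minBlockMass n w).continuousAt.div (continuous_blockMass w _).continuousAt
      hb).mul (continuous_apply k).continuousAt).continuousWithinAt

end BlockWeights

/-! ### Inserting an object of which `x` is a retract -/

section FirstInsertion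

variable {C : Type u} [Category.{v} C] {x z : C}
variable {ι κ : Type} [LinearOrder ι] [LinearOrder κ] [Fintype ι] [Fintype κ]

theorem le_of_blockIndex_eq_zero {F : ι ⥤ C} {k l : ι} (hk : blockIndex x F k = 0)
    (hl : F.obj l = x) : k ≤ l := by
  by_contra h
  have hw := isBlockIndex_blockIndex x F
  have h1 := hw.monotone (not_le.1 h).le
  have h2 := ((hw.odd_iff l).1 hl).pos
  omega

theorem exists_le_of_blockIndex_ne_zero {F : ι ⥤ C} {k : ι} (hk : blockIndex x F k ≠ 0) :
    ∃ l, l ≤ k ∧ F.obj l = x := by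
  have hw := isBlockIndex_blockIndex x F
  obtain ⟨l, hl⟩ := hw.exists_eq k 1 one_pos (Nat.one_le_iff_ne_zero.2 hk)
  rcases le_total l k with h | h
  · exact ⟨l, h, (hw.odd_iff l).2 (hl ▸ odd_one)⟩
  · have h1 := hw.monotone h
    have h2 : blockIndex x F k = 1 := by omega
    exact ⟨k, le_rfl, (hw.odd_iff k).2 (h2 ▸ odd_one)⟩

variable (hx : ∀ e : x ⟶ x, e = 𝟙 x) (i : x ⟶ z) (r : z ⟶ x)

/-- The insertion of an object of which `x` is a retract before the first `x`. -/
noncomputable def firstInsertion (F : ι ⥤ C) (hex : ∃ k, F.obj k = x) : Insertion F z where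
  L k := blockIndex x F k = 0
  lower k l h hl := Nat.le_zero.1 (hl ▸ (isBlockIndex_blockIndex x F).monotone h)
  α k hk := F.map (homOfLE (le_of_blockIndex_eq_zero hk hex.choose_spec)) ≫
    eqToHom hex.choose_spec ≫ i
  β k hk := r ≫ eqToHom (exists_le_of_blockIndex_ne_zero hk).choose_spec.2.symm ≫
    F.map (homOfLE (exists_le_of_blockIndex_ne_zero hk).choose_spec.1)
  map_α k l h hl := by
    rw [← Category.assoc, ← F.map_comp]
    rfl
  β_map k l h hk := by
    have h1 := exists_le_of_blockIndex_ne_zero hk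
    have h2 := exists_le_of_blockIndex_ne_zero (F := F) (x := x) (k := l)
      fun hl => hk (Nat.le_zero.1 (hl ▸ (isBlockIndex_blockIndex x F).monotone h))
    simp only [Category.assoc]
    rw [← F.map_comp]
    congr 1
    exact eqToHom_map_unique hx F (h1.choose_spec.1.trans h) h2.choose_spec.1 h1.choose_spec.2
      h2.choose_spec.2
  α_β k l h hk hl := by
    -- The composite is an endomorphism of `x`, hence trivial. So passing through `z` does not
    -- change the arrows of the chain across the insertion.
    have hir : i ≫ r = 𝟙 x := hx _
    have hl' := exists_le_of_blockIndex_ne_zero hl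
    rw [← Category.assoc (F.map _), map_eqToHom_unique hx F _
      (le_of_blockIndex_eq_zero hk hl'.choose_spec.2) _ hl'.choose_spec.2]
    simp only [Category.assoc]
    rw [← Category.assoc i r, hir, Category.id_comp, eqToHom_trans_assoc, eqToHom_refl,
      Category.id_comp, ← F.map_comp]
    rfl

theorem firstInsertion_comp {θ : ι → κ} (hθ : Monotone θ) (G : κ ⥤ C)
    (hex : ∃ k, (hθ.functor ⋙ G).obj k = x) (hex' : ∃ k, G.obj k = x)
    (hL : ∀ k, (firstInsertion hx i r (hθ.functor ⋙ G) hex).L k ↔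
      (firstInsertion hx i r G hex').L (θ k)) :
    (firstInsertion hx i r (hθ.functor ⋙ G) hex).functor =
      (Insertion.monotone_map hθ (firstInsertion hx i r (hθ.functor ⋙ G) hex).lower hL).functor ⋙
      (firstInsertion hx i r G hex').functor := by
  refine Insertion.functor_comp hθ _ _ hL (fun k h h' => ?_) fun k h h' => ?_
  · change _ ≫ _ ≫ _ = _ ≫ _ ≫ _
    exact (Category.assoc _ _ _).symm.trans ((congrArg (fun f => f ≫ i)
      (map_eqToHom_unique hx G (hθ (le_of_blockIndex_eq_zero h hex.choose_spec))
      (le_of_blockIndex_eq_zero h' hex'.choose_spec) hex.choose_spec hex'.choose_spec)).trans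
      (Category.assoc _ _ _))
  · have h1 := exists_le_of_blockIndex_ne_zero h
    have h2 := exists_le_of_blockIndex_ne_zero h'
    change _ ≫ _ ≫ _ = _ ≫ _ ≫ _
    congr 1
    exact eqToHom_map_unique hx G (hθ h1.choose_spec.1) h2.choose_spec.1 h1.choose_spec.2
      h2.choose_spec.2

variable [Nonempty ι] [Nonempty κ]

theorem chainPoint_insertWeight_zero {F : ι ⥤ C} (D : Insertion F z) {t : ι → ℝ}
    (ht : t ∈ stdSimplex ℝ ι) : chainPoint D.functor (insertWeight 0 t) = chainPoint F t := by
  classical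
  have hm : Monotone (Inserted.old (L := D.L)) := fun k l h => Inserted.old_le_old h (D.lower k l h)
  refine (chainPoint_eq_of_map hm ht rfl ?_).symm
  funext a
  unfold pushWeight
  match a with
  | ⟨none⟩ => exact (Finset.sum_eq_zero fun k hk => by simp at hk).symm
  | ⟨some k⟩ =>
    refine (Finset.sum_eq_single k (fun l hl hne => ?_) (by simp)).symm
    simp only [Finset.mem_filter, Finset.mem_univ, true_and, Inserted.mk.injEq,
      Option.some.injEq] at hl
    exact absurd hl hne

end FirstInsertion

open unitInterval

/-! ### Weights along the deformation -/

section RetractWeight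

variable {ι κ : Type} [LinearOrder ι] [LinearOrder κ] [Fintype ι] [Fintype κ]
variable {n : ℕ} {w : ι → ℕ} {t : ι → ℝ} {L : ι → Prop}

/-- The weights of a chain with an object inserted after the same amount of weight has been moved
from each of the blocks `1, …, n + 1` to this object. -/
noncomputable def retractWeight (n : ℕ) (w : ι → ℕ) (t : ι → ℝ) (s : I) : Inserted L → ℝ :=
  insertWeight ((n + 1) * s * minBlockMass n w t) fun k => (1 - s * shareFactor n w t k) * t k

theorem retractWeight_mem (ht : t ∈ stdSimplex ℝ ι) (hw : ∀ k, w k ≤ n + 1) (s : I) :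
    retractWeight (L := L) n w t s ∈ stdSimplex ℝ (Inserted L) := by
  refine insertWeight_mem ?_ (fun k => ?_) ?_
  · exact mul_nonneg (mul_nonneg (by positivity) s.2.1) (minBlockMass_nonneg ht.1)
  · exact mul_nonneg (sub_nonneg.2 (mul_le_one₀ s.2.2 (shareFactor_nonneg ht.1 k)
      (shareFactor_le_one ht.1 hw k))) (ht.1 k)
  · have h1 : ∑ k, (1 - s * shareFactor n w t k) * t k =
        ∑ k, t k - s * ∑ k, shareFactor n w t k * t k := by
      rw [Finset.mul_sum, ← Finset.sum_sub_distrib]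
      exact Finset.sum_congr rfl fun k _ => by ring
    rw [h1, sum_shareFactor_mul ht.1 hw, ht.2]
    ring

/-- An empty block stops all movement. This makes the formula agree, on faces where a block is lost,
with the constant deformation used there. -/
theorem retractWeight_of_eq_zero (h : minBlockMass n w t = 0) (s : I) :
    retractWeight (L := L) n w t s = insertWeight 0 t := by
  unfold retractWeight
  simp only [shareFactor_eq_zero h, h, mul_zero, sub_zero, one_mul]

theorem retractWeight_zero : retractWeight (L := L) n w t 0 = insertWeight 0 t := by
  unfold retractWeight
  simp

theorem pushWeight_retractWeight {L' : κ → Prop} (θ : ι → κ) (w : κ → ℕ) (s : I) :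
    pushWeight (Insertion.map (L' := L') θ) (retractWeight (L := L) n (fun l => w (θ l)) t s) =
      retractWeight n w (pushWeight θ t) s := by
  unfold retractWeight
  rw [pushWeight_insertWeight, minBlockMass_comp]
  simp only [shareFactor_comp]
  rw [pushWeight_mul θ t fun k => 1 - s * shareFactor n w (pushWeight θ t) k]

theorem continuousOn_retractWeight (hw : ∀ k, w k ≤ n + 1) :
    ContinuousOn (fun q : (ι → ℝ) × I => retractWeight (L := L) n w q.1 q.2)
      (stdSimplex ℝ ι ×ˢ Set.univ) := by
  rw [continuousOn_pi]
  intro a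
  have hm := continuous_minBlockMass n w
  match a with
  | ⟨none⟩ =>
    refine Continuous.continuousOn (?_ : Continuous fun q : (ι → ℝ) × I =>
      (n + 1) * (q.2 : ℝ) * minBlockMass n w q.1)
    fun_prop
  | ⟨some k⟩ =>
    have h : ContinuousOn (fun q : (ι → ℝ) × I => q.1 k - q.2 * (shareFactor n w q.1 k * q.1 k))
        (stdSimplex ℝ ι ×ˢ Set.univ) := by
      refine ContinuousOn.sub (by fun_prop) (ContinuousOn.mul (by fun_prop) ?_)
      exact (continuousOn_shareFactor_mul hw k).comp continuousOn_fst fun q hq => hq.1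
    refine h.congr fun q _ => ?_
    change (1 - q.2 * shareFactor n w q.1 k) * q.1 k = _
    ring

end RetractWeight

/-! ### The deformation lowering the number of blocks -/

section Retract

variable {C : Type u} [Category.{v} C] {x z : C}
variable {ι κ : Type} [LinearOrder ι] [LinearOrder κ] [Fintype ι] [Fintype κ]
  [Nonempty ι] [Nonempty κ]

theorem exists_obj_eq {F : ι ⥤ C} {n : ℕ} (h : blockCount x F = n + 1) : ∃ k, F.obj k = x := by
  obtain ⟨k, hk⟩ := exists_blockIndex_eq (x := x) F one_pos (by omega)
  exact ⟨k, ((isBlockIndex_blockIndex x F).odd_iff k).2 (hk ▸ odd_one)⟩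

variable (hx : ∀ e : x ⟶ x, e = 𝟙 x) (i : x ⟶ z) (r : z ⟶ x)

theorem chainPoint_firstInsertion_comp {n : ℕ} {θ : ι → κ} (hθ : Monotone θ) (G : κ ⥤ C)
    (hF : blockCount x (hθ.functor ⋙ G) = n + 1) (hG : blockCount x G = n + 1)
    (hw : blockIndex x (hθ.functor ⋙ G) = fun l => blockIndex x G (θ l)) {t : ι → ℝ}
    (ht : t ∈ stdSimplex ℝ ι) (s : I) :
    chainPoint (firstInsertion hx i r (hθ.functor ⋙ G) (exists_obj_eq hF)).functor
      (retractWeight n (blockIndex x (hθ.functor ⋙ G)) t s) =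
    chainPoint (firstInsertion hx i r G (exists_obj_eq hG)).functor
      (retractWeight n (blockIndex x G) (pushWeight θ t) s) := by
  have hL : ∀ k, (firstInsertion hx i r (hθ.functor ⋙ G) (exists_obj_eq hF)).L k ↔
      (firstInsertion hx i r G (exists_obj_eq hG)).L (θ k) := fun k => by
    change blockIndex x _ k = 0 ↔ blockIndex x G (θ k) = 0
    rw [hw]
  refine chainPoint_eq_of_map (Insertion.monotone_map hθ (firstInsertion hx i r _ _).lower hL)
    (retractWeight_mem ht (fun k => hF ▸ blockIndex_le _ k) s)
    (firstInsertion_comp hx i r hθ G _ _ hL) ?_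
  rw [hw]
  exact (pushWeight_retractWeight θ _ s).symm

/-- The deformation of chains with `n + 1` blocks into chains with fewer blocks. -/
noncomputable def retractPoint (n : ℕ) (F : ι ⥤ C) (t : ι → ℝ) (s : I) : classifyingSpace C :=
  open scoped Classical in
  if h : blockCount x F = n + 1 then
    chainPoint (firstInsertion hx i r F (exists_obj_eq h)).functor
      (retractWeight n (blockIndex x F) t s)
  else chainPoint F t

theorem retractPoint_of_eq {n : ℕ} {F : ι ⥤ C} (h : blockCount x F = n + 1) (t : ι → ℝ) (s : I) :
    retractPoint hx i r n F t s = chainPoint (firstInsertion hx i r F (exists_obj_eq h)).functor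
      (retractWeight n (blockIndex x F) t s) := dif_pos h

theorem retractPoint_of_ne {n : ℕ} {F : ι ⥤ C} (h : blockCount x F ≠ n + 1) (t : ι → ℝ) (s : I) :
    retractPoint hx i r n F t s = chainPoint F t := dif_neg h

theorem retractPoint_comp (n : ℕ) {θ : ι → κ} (hθ : Monotone θ) (G : κ ⥤ C)
    (hc : blockCount x (hθ.functor ⋙ G) = blockCount x G)
    (hw : blockIndex x (hθ.functor ⋙ G) = fun l => blockIndex x G (θ l)) {t : ι → ℝ}
    (ht : t ∈ stdSimplex ℝ ι) (s : I) :
    retractPoint hx i r n (hθ.functor ⋙ G) t s = retractPoint hx i r n G (pushWeight θ t) s := by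
  by_cases hG : blockCount x G = n + 1
  · have hF := hc.trans hG
    rw [retractPoint_of_eq hx i r hF, retractPoint_of_eq hx i r hG]
    exact chainPoint_firstInsertion_comp hx i r hθ G hF hG hw ht s
  · have hF : blockCount x (hθ.functor ⋙ G) ≠ n + 1 := fun h => hG (hc.symm.trans h)
    rw [retractPoint_of_ne hx i r hF, retractPoint_of_ne hx i r hG]
    exact chainPoint_comp hθ G ht

theorem posChain_isAlternating {F : ι ⥤ C} {t : ι → ℝ} {N : ℕ} {a : Fin N → {k // 0 < t k}}
    (ha : IsAlternating x (posChain F t) a) : IsAlternating x F fun j => (a j).1 :=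
  ⟨fun _ _ h => ha.1 h, ha.2⟩

/-- If all `n + 1` blocks survive the removal of zero weights, the numbering is inherited. If one of
them is lost, the least block mass is zero and nothing moves on either side. -/
theorem retractPoint_posChain (n : ℕ) {F : ι ⥤ C} (hF : blockCount x F ≤ n + 1) {t : ι → ℝ}
    (ht : t ∈ stdSimplex ℝ ι) [Fintype {k // 0 < t k}] [Nonempty {k // 0 < t k}] (s : I) :
    retractPoint hx i r n (posChain F t) (fun k => t k.1) s = retractPoint hx i r n F t s := by
  have h0 : ∀ k, ¬ 0 < t k → t k = 0 := fun k hk => le_antisymm (not_lt.1 hk) (ht.1 k)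
  have hw := isBlockIndex_blockIndex x F
  have hle : blockCount x (posChain F t) ≤ blockCount x F := by
    obtain ⟨a, ha⟩ := exists_isAlternating (x := x) (posChain F t) le_rfl
    exact le_blockCount (posChain_isAlternating ha)
  by_cases hn : blockCount x (posChain F t) = n + 1
  · have hn' : blockCount x F = n + 1 := by omega
    obtain ⟨a, ha⟩ := exists_isAlternating (x := x) (posChain F t) hn.ge
    have hall := (exists_eq_of_isAlternating (posChain_isAlternating ha) hw.monotone hw.odd_iff
      (n := n + 1) fun k => hn' ▸ blockIndex_le F _).2 rfl
    have hidx : blockIndex x (posChain F t) = fun l => blockIndex x F l.1 :=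
      blockIndex_comp (Subtype.mono_coe fun k => 0 < t k) F fun l j hj hjl => by
        obtain ⟨k, hk⟩ := hall j hj (hjl.trans (hn' ▸ blockIndex_le F _))
        exact ⟨a k, hk⟩
    have h1 := retractPoint_comp hx i r n (Subtype.mono_coe fun k => 0 < t k) F
      (hn.trans hn'.symm) hidx (subtype_weight_mem ht h0) s
    rw [← pushWeight_subtype_val h0] at h1
    exact h1
  · rw [retractPoint_of_ne hx i r hn, chainPoint_posChain F ht]
    by_cases hn' : blockCount x F = n + 1
    · rw [retractPoint_of_eq hx i r hn', retractWeight_of_eq_zero, chainPoint_insertWeight_zero _ ht]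
      by_contra hne
      have hpos : ∀ j, 0 < j → j ≤ n + 1 → ∃ k, blockIndex x F k = j ∧ 0 < t k := fun j hj hjn =>
        exists_pos_of_blockMass_ne_zero ht.1 (((minBlockMass_nonneg ht.1).lt_of_ne' hne).trans_le
          (minBlockMass_le hj.ne' hjn)).ne'
      -- If all blocks had positive mass, one object of positive weight from each would form an
      -- alternating sequence of length `n + 1`.
      choose b hb using fun j : Fin (n + 1) => hpos (j.1 + 1) (Nat.succ_pos _) j.2
      refine hn (le_antisymm (hn' ▸ hle) (le_blockCount (a := fun j => ⟨b j, (hb j).2⟩) ⟨?_, ?_⟩))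
      · intro j j' hj
        rcases hj.eq_or_lt with rfl | hlt
        · exact le_rfl
        · by_contra hlt'
          have h1 := hw.monotone (not_le.1 hlt').le
          change blockIndex x F (b j') ≤ blockIndex x F (b j) at h1
          rw [(hb j).1, (hb j').1] at h1
          have h2 : j.1 < j'.1 := hlt
          omega
      · intro j
        change F.obj (b j) = x ↔ _
        rw [hw.odd_iff, (hb j).1, Nat.odd_add_one, Nat.not_odd_iff_even]
    · rw [retractPoint_of_ne hx i r hn']

theorem exists_retract (n : ℕ) : ∃ Φ : classifyingSpace C → I → classifyingSpace C, ∀ (ι : Type)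
    [LinearOrder ι] [Fintype ι] [Nonempty ι] (F : ι ⥤ C) (t : ι → ℝ), t ∈ stdSimplex ℝ ι →
    blockCount x F ≤ n + 1 → Φ (chainPoint F t) = retractPoint hx i r n F t := by
  obtain ⟨Φ, hΦ⟩ := exists_chainPoint_lift_of_pos (C := C)
    (fun ι _ _ _ F t => retractPoint hx i r n F t)
    fun ι κ _ _ _ _ _ _ θ hθ hs G t ht hpos => funext fun s =>
      retractPoint_comp hx i r n hθ G (blockCount_comp_of_surjective hθ hs G)
        (blockIndex_comp_of_surjective hθ hs G) ht s
  refine ⟨Φ, ?_⟩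
  intro ι _ _ _ F t ht hF
  classical
  have h0 : ∀ k, ¬ 0 < t k → t k = 0 := fun k hk => le_antisymm (not_lt.1 hk) (ht.1 k)
  have hne : Nonempty {k // 0 < t k} := ⟨⟨_, (exists_pos_of_mem_stdSimplex ht).choose_spec⟩⟩
  rw [← chainPoint_posChain F ht, hΦ _ _ _ (subtype_weight_mem ht h0) fun k => k.2]
  exact funext fun s => retractPoint_posChain hx i r n hF ht s

theorem continuousOn_retractPoint (n : ℕ) (F : ι ⥤ C) :
    ContinuousOn (fun q : (ι → ℝ) × I => retractPoint hx i r n F q.1 q.2)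
      (stdSimplex ℝ ι ×ˢ Set.univ) := by
  by_cases h : blockCount x F = n + 1
  · simp only [retractPoint_of_eq hx i r h]
    have hw : ∀ k, blockIndex x F k ≤ n + 1 := fun k => h ▸ blockIndex_le F k
    exact (continuousOn_chainPoint _).comp (continuousOn_retractWeight hw)
      fun q hq => retractWeight_mem hq.1 hw q.2
  · simp only [retractPoint_of_ne hx i r h]
    exact (continuousOn_chainPoint F).comp continuousOn_fst fun q hq => hq.1

end Retract

open unitInterval

/-! ### Continuity on closed subspaces -/

section ClosedSubspace

variable {C : Type u} [Category.{v} C]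

/-- The deformation is controlled only on a closed stage of the filtration by blocks, so the
criterion for open sets does not apply. -/
theorem continuousOn_prod_of_isClosed_of_chainPoint {Y S : Type*} [TopologicalSpace Y]
    [LocallyCompactSpace Y] [TopologicalSpace S] {Φ : classifyingSpace C → Y → S}
    {D : Set (classifyingSpace C)} (hD : IsClosed D)
    (h : ∀ (m : ℕ) (F : Fin (m + 1) ⥤ C),
      ContinuousOn (fun q : (Fin (m + 1) → ℝ) × Y => Φ (chainPoint F q.1) q.2)
      ((stdSimplex ℝ (Fin (m + 1)) ∩ chainPoint F ⁻¹' D) ×ˢ Set.univ)) :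
    ContinuousOn (fun q : classifyingSpace C × Y => Φ q.1 q.2) (D ×ˢ Set.univ) := by
  rw [continuousOn_iff_isClosed]
  intro A hA
  refine ⟨_, ?_, (Set.inter_eq_left.2 Set.inter_subset_right).symm⟩
  rw [← isOpen_compl_iff]
  refine isOpen_prod_of_chainPoint fun m F => ?_
  have hc : Continuous fun q : stdSimplex ℝ (Fin (m + 1)) × Y => chainPoint F q.1.1 := by
    simp only [chainPoint_fin]
    fun_prop
  have hD' : IsClosed ((fun q : stdSimplex ℝ (Fin (m + 1)) × Y => chainPoint F q.1.1) ⁻¹' D) :=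
    hD.preimage hc
  have h1 := (h m F).comp (f := fun q : stdSimplex ℝ (Fin (m + 1)) × Y => (q.1.1, q.2))
    (s := (fun q : stdSimplex ℝ (Fin (m + 1)) × Y => chainPoint F q.1.1) ⁻¹' D)
    (by fun_prop) (fun q hq => ⟨⟨q.1.2, hq⟩, Set.mem_univ _⟩)
  have h2 := h1.preimage_isClosed_of_isClosed hD' hA
  rw [← isOpen_compl_iff] at h2
  convert! h2 using 1
  ext q
  simp only [Set.mem_preimage, Set.mem_compl_iff, Set.mem_inter_iff, Set.mem_prod, Set.mem_univ,
    and_true, Function.comp_apply]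
  tauto

end ClosedSubspace

/-! ### Pushing cubes off a retract -/

section Retract

variable {C : Type u} [Category.{v} C] {x z : C}

/-- The face of the chains supported in a set of objects. -/
def stdFace {ι : Type} [Fintype ι] (T : Finset ι) : Set (ι → ℝ) :=
  stdSimplex ℝ ι ∩ ⋂ k ∈ (T : Set ι)ᶜ, (fun t : ι → ℝ => t k) ⁻¹' {0}

theorem isClosed_stdFace {ι : Type} [Fintype ι] (T : Finset ι) : IsClosed (stdFace T) :=
  (isClosed_stdSimplex ℝ ι).inter
    (isClosed_biInter fun k _ => isClosed_singleton.preimage (continuous_apply k))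

theorem eq_zero_of_mem_stdFace {ι : Type} [Fintype ι] {T : Finset ι} {t : ι → ℝ}
    (ht : t ∈ stdFace T) (k : ι) (hk : k ∉ T) : t k = 0 := Set.mem_iInter₂.1 ht.2 k hk

/-- The sub-chain of the objects in a finite set. -/
abbrev subChain {ι : Type} [LinearOrder ι] (F : ι ⥤ C) (T : Finset ι) : {k // k ∈ T} ⥤ C :=
  (Subtype.mono_coe fun k => k ∈ T).functor ⋙ F

/-- Within a simplex, a stage of the filtration is covered by those faces whose chains have fewer
than `N` blocks. These are finitely many closed sets, on each of which the formula applies. -/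
theorem continuousOn_of_subchains {Y S : Type*} [TopologicalSpace Y] [TopologicalSpace S]
    {Φ : classifyingSpace C → Y → S} {N : ℕ} {ι : Type} [LinearOrder ι] [Fintype ι] [Nonempty ι]
    (F : ι ⥤ C)
    (h : ∀ (T : Finset ι) [Nonempty {k // k ∈ T}], blockCount x (subChain F T) < N →
      ContinuousOn (fun q : ({k // k ∈ T} → ℝ) × Y => Φ (chainPoint (subChain F T) q.1) q.2)
        (stdSimplex ℝ {k // k ∈ T} ×ˢ Set.univ)) :
    ContinuousOn (fun q : (ι → ℝ) × Y => Φ (chainPoint F q.1) q.2)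
      ((stdSimplex ℝ ι ∩ chainPoint F ⁻¹' (alternation x N ⁻¹' {0})) ×ˢ Set.univ) := by
  classical
  have hface : ∀ T : {T : Finset ι // Nonempty {k // k ∈ T} ∧ blockCount x (subChain F T) < N},
      ContinuousOn (fun q : (ι → ℝ) × Y => Φ (chainPoint F q.1) q.2)
        (stdFace T.1 ×ˢ (Set.univ : Set Y)) := by
    rintro ⟨T, hne, hT⟩
    have h1 := (h T hT).comp
      (f := fun q : (ι → ℝ) × Y => ((fun k => q.1 k.1 : {k // k ∈ T} → ℝ), q.2))
      (s := stdFace T ×ˢ (Set.univ : Set Y)) (by fun_prop)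
      fun q hq => ⟨subtype_weight_mem hq.1.1 (eq_zero_of_mem_stdFace hq.1), Set.mem_univ _⟩
    refine h1.congr fun q hq => ?_
    have h2 := chainPoint_subtype (fun k => k ∈ T) F hq.1.1 (eq_zero_of_mem_stdFace hq.1)
    exact congrArg (fun p => Φ p q.2) h2.symm
  have hcov : (stdSimplex ℝ ι ∩ chainPoint F ⁻¹' (alternation x N ⁻¹' {0})) ×ˢ
      (Set.univ : Set Y) ⊆ ⋃ T : {T : Finset ι // Nonempty {k // k ∈ T} ∧
        blockCount x (subChain F T) < N}, stdFace T.1 ×ˢ (Set.univ : Set Y) := by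
    rintro ⟨t, s⟩ ⟨⟨ht, hp⟩, -⟩
    let T : Finset ι := Finset.univ.filter fun k => 0 < t k
    have hT : ∀ k, k ∈ T ↔ 0 < t k := fun k => by simp [T]
    obtain ⟨k, hk⟩ := exists_pos_of_mem_stdSimplex ht
    have hne : Nonempty {k // k ∈ T} := ⟨⟨k, (hT k).2 hk⟩⟩
    have hT0 : ∀ k, k ∉ T → t k = 0 := fun k hk =>
      le_antisymm (not_lt.1 fun h => hk ((hT k).2 h)) (ht.1 k)
    have hp' : alternation x N (chainPoint F t) = 0 := hp
    rw [← chainPoint_subtype (fun k => k ∈ T) F ht hT0, alternation_eq_zero_iff_of_pos _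
      (subtype_weight_mem ht hT0) fun k => (hT k.1).1 k.2] at hp'
    refine Set.mem_iUnion.2 ⟨⟨T, hne, hp'⟩, ⟨ht, ?_⟩, Set.mem_univ _⟩
    exact Set.mem_iInter₂.2 fun k hk => hT0 k hk
  have hfin : LocallyFinite fun T : {T : Finset ι // Nonempty {k // k ∈ T} ∧
      blockCount x (subChain F T) < N} => stdFace T.1 ×ˢ (Set.univ : Set Y) :=
    locallyFinite_of_finite _
  have hclosed : ∀ T : {T : Finset ι // Nonempty {k // k ∈ T} ∧
      blockCount x (subChain F T) < N}, IsClosed (stdFace T.1 ×ˢ (Set.univ : Set Y)) :=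
    fun T => (isClosed_stdFace T.1).prod isClosed_univ
  exact (hfin.continuousOn_iUnion hclosed hface).mono hcov

theorem alternation_eq_zero_of_mass {p : classifyingSpace C} (N : ℕ)
    (h : mass (fun c => c = x) p = 0) : alternation x (N + 1) p = 0 := by
  obtain ⟨m, F, t, ht, rfl⟩ := exists_chainPoint p
  rw [mass_chainPoint _ F ht, chainMass_eq_zero_iff _ F ht] at h
  rw [alternation_chainPoint x _ F ht, chainAlternation_eq_zero_iff F ht]
  exact fun a ha => ⟨0, h _ ((ha.2 0).2 Even.zero)⟩

/-- Vanishing of `alternation x (n + 2)` means at most `n + 1` blocks. The least of them is emptied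
in favour of the inserted `z`, which joins the uncounted block 0 because `z ≠ x`; one block fewer
remains. -/
theorem exists_retract_deformation (hx : ∀ e : x ⟶ x, e = 𝟙 x) (i : x ⟶ z) (r : z ⟶ x)
    (hzx : z ≠ x) (n : ℕ) :
    ∃ Φ : classifyingSpace C → I → classifyingSpace C,
      ContinuousOn (fun q : classifyingSpace C × I => Φ q.1 q.2)
        ((alternation x (n + 2) ⁻¹' {0}) ×ˢ Set.univ) ∧
      (∀ p, alternation x (n + 2) p = 0 → Φ p 0 = p ∧ alternation x (n + 1) (Φ p 1) = 0) ∧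
      (∀ p s, mass (fun c => c = x) p = 0 → Φ p s = p) ∧
      ∀ p s, alternation x (n + 2) p = 0 → ∀ B : C → Prop, mass B p = 0 → ¬ B z →
        mass B (Φ p s) = 0 := by
  classical
  obtain ⟨Φ, hΦ⟩ := exists_retract hx i r n
  refine ⟨Φ, ?_, ?_, ?_, ?_⟩
  · refine continuousOn_prod_of_isClosed_of_chainPoint
      (isClosed_singleton.preimage (continuous_alternation x _)) fun m F => ?_
    refine continuousOn_of_subchains F fun T _ hT => ?_
    refine (continuousOn_retractPoint hx i r n (subChain F T)).congr fun q hq => ?_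
    exact congrFun (hΦ _ _ _ hq.1 (Nat.lt_succ_iff.1 hT)) q.2
  · intro p hp
    obtain ⟨ι, _, _, _, F, t, ht, hpos, rfl⟩ := exists_chainPoint_pos p
    rw [alternation_eq_zero_iff_of_pos F ht hpos] at hp
    rw [hΦ ι F t ht (Nat.lt_succ_iff.1 hp)]
    by_cases h : blockCount x F = n + 1
    · have hw := isBlockIndex_blockIndex x F
      have hle : ∀ k, blockIndex x F k ≤ n + 1 := fun k => h ▸ blockIndex_le F k
      rw [retractPoint_of_eq hx i r h, retractPoint_of_eq hx i r h, retractWeight_zero]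
      refine ⟨chainPoint_insertWeight_zero _ ht, ?_⟩
      rw [alternation_chainPoint x _ _ (retractWeight_mem ht hle 1),
        chainAlternation_eq_zero_iff _ (retractWeight_mem ht hle 1)]
      intro a ha
      -- The old block numbers with `z` added to block 0, again monotone and of the right parity.
      let v : Inserted (firstInsertion hx i r F (exists_obj_eq h)).L → ℕ := fun b =>
        match b with
        | ⟨none⟩ => 0
        | ⟨some k⟩ => blockIndex x F k
      have hv : Monotone v := by
        intro b b' hb
        match b, b' with
        | ⟨none⟩, _ => exact Nat.zero_le _
        | ⟨some k⟩, ⟨none⟩ => exact (Inserted.old_le_new.1 hb).le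
        | ⟨some k⟩, ⟨some l⟩ => exact hw.monotone (Insertion.le _ hb)
      obtain ⟨j, hj, hjn, hmin⟩ := exists_minBlockMass_eq n (blockIndex x F) t
      -- An alternating sequence of length `n + 1` has to visit every block, in particular the
      -- emptied block `j`.
      obtain ⟨l, hl⟩ := (exists_eq_of_isAlternating ha hv (fun b => by
        match b with
        | ⟨none⟩ => exact ⟨fun h => absurd h hzx, fun h => absurd h (by simp [v])⟩
        | ⟨some k⟩ => exact hw.odd_iff k) (n := n + 1) fun l => by
          match a l with
          | ⟨none⟩ => exact Nat.zero_le _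
          | ⟨some k⟩ => exact hle k).2 rfl j hj hjn
      refine ⟨l, ?_⟩
      match a l, hl with
      | ⟨none⟩, hl => exact absurd hl hj.ne
      | ⟨some k⟩, hl =>
        have hl' : blockIndex x F k = j := hl
        have h1 := shareFactor_mul_eq (n := n) ht.1 (hl' ▸ hj.ne') (hl' ▸ hmin)
        change (1 - (1 : ℝ) * shareFactor n _ t k) * t k = 0
        rw [one_mul, sub_mul, h1, one_mul, sub_self]
    · rw [retractPoint_of_ne hx i r h, retractPoint_of_ne hx i r h]
      exact ⟨rfl, alternation_eq_zero_of_le F ht (by omega)⟩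
  · intro p s hp
    obtain ⟨ι, _, _, _, F, t, ht, hpos, rfl⟩ := exists_chainPoint_pos p
    have h := alternation_eq_zero_of_mass 0 hp
    rw [alternation_eq_zero_iff_of_pos F ht hpos] at h
    rw [hΦ ι F t ht (by omega), retractPoint_of_ne hx i r (by omega)]
  · intro p s hp B hB hz
    obtain ⟨ι, _, _, _, F, t, ht, hpos, rfl⟩ := exists_chainPoint_pos p
    rw [alternation_eq_zero_iff_of_pos F ht hpos] at hp
    rw [hΦ ι F t ht (Nat.lt_succ_iff.1 hp)]
    by_cases h : blockCount x F = n + 1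
    · have hle : ∀ k, blockIndex x F k ≤ n + 1 := fun k => h ▸ blockIndex_le F k
      rw [mass_chainPoint _ F ht, chainMass_eq_zero_iff _ F ht] at hB
      rw [retractPoint_of_eq hx i r h, mass_chainPoint _ _ (retractWeight_mem ht hle s),
        chainMass_eq_zero_iff _ _ (retractWeight_mem ht hle s)]
      intro b hb
      match b, hb with
      | ⟨none⟩, hb => exact absurd hb hz
      | ⟨some k⟩, hb => exact absurd (hB k hb) (hpos k).ne'
    · rw [retractPoint_of_ne hx i r h]
      exact hB

/-- A cube can be pushed off an object which is a retract of another object. -/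
theorem exists_homotopicRel_of_retract {k : ℕ} (hx : ∀ e : x ⟶ x, e = 𝟙 x) (i : x ⟶ z) (r : z ⟶ x)
    (hzx : z ≠ x) {B : C → Prop} (g : C(Fin k → I, classifyingSpace C))
    (hg : ∀ a, mass (fun c => ¬ B c) (g a) = 0)
    (hb : ∀ a ∈ Cube.boundary (Fin k), mass (fun c => c = x) (g a) = 0) :
    ∃ g' : C(Fin k → I, classifyingSpace C), g.HomotopicRel g' (Cube.boundary (Fin k)) ∧
      ∀ a, mass (fun c => ¬ (c ≠ x ∧ (B c ∨ c = z))) (g' a) = 0 := by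
  have key : ∀ n (g : C(Fin k → I, classifyingSpace C)),
      (∀ a, mass (fun c => ¬ (B c ∨ c = z)) (g a) = 0) →
      (∀ a ∈ Cube.boundary (Fin k), mass (fun c => c = x) (g a) = 0) →
      (∀ a, alternation x (n + 1) (g a) = 0) →
      ∃ g' : C(Fin k → I, classifyingSpace C), g.HomotopicRel g' (Cube.boundary (Fin k)) ∧
        ∀ a, mass (fun c => ¬ (c ≠ x ∧ (B c ∨ c = z))) (g' a) = 0 := by
    intro n
    induction n with
    | zero =>
      intro g hg hb h
      refine ⟨g, ContinuousMap.HomotopicRel.refl g, fun a => ?_⟩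
      exact mass_eq_zero_mono (fun c hc => by tauto)
        (mass_or_eq_zero (mass_eq_zero_of_alternation (h a)) (hg a))
    | succ n ih =>
      intro g hg hb h
      obtain ⟨Φ, hc, h1, h2, h3⟩ := exists_retract_deformation hx i r hzx n
      have hH : Continuous fun q : I × (Fin k → I) => Φ (g q.2) q.1 :=
        hc.comp_continuous (f := fun q : I × (Fin k → I) => (g q.2, q.1)) (by fun_prop)
          fun q => ⟨h q.2, Set.mem_univ _⟩
      let g₁ : C(Fin k → I, classifyingSpace C) :=
        ⟨fun a => Φ (g a) 1, hH.comp (f := fun a => ((1 : I), a)) (by fun_prop)⟩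
      have hr : g.HomotopicRel g₁ (Cube.boundary (Fin k)) :=
        homotopicRel_of_formula (fun q => Φ (g q.2) q.1) hH (fun a => (h1 _ (h a)).1)
          (fun _ => rfl) fun s a ha => h2 _ _ (hb a ha)
      obtain ⟨g', hg', hm⟩ := ih g₁ (fun a => h3 _ _ (h a) _ (hg a) (by simp))
        (fun a ha => by
          change mass _ (Φ (g a) 1) = 0
          rw [h2 _ _ (hb a ha)]
          exact hb a ha) fun a => (h1 _ (h a)).2
      exact ⟨g', hr.trans hg', hm⟩
  -- Compactness bounds the number of blocks in the cube and so starts the induction.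
  obtain ⟨n, hn⟩ := exists_alternation_eq_zero_of_isCompact x (isCompact_range g.continuous)
  exact key n g (fun a => mass_eq_zero_mono (fun c hc => fun h => hc (Or.inl h)) (hg a)) hb
    fun a => hn _ (Set.mem_range_self a)

end Retract

open unitInterval

/-! ### Compressing cubes into the full subcategory -/

section Compression

variable {C : Type u} [Category.{v} C]

theorem mass_eq_zero_of_forall {B : C → Prop} {p : classifyingSpace C}
    (h : ∀ c, B c → mass (fun d => d = c) p = 0) : mass B p = 0 := by
  obtain ⟨m, F, t, ht, rfl⟩ := exists_chainPoint p
  rw [mass_chainPoint _ F ht, chainMass_eq_zero_iff _ F ht]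
  intro k hk
  have h1 := h _ hk
  rw [mass_chainPoint _ F ht, chainMass_eq_zero_iff _ F ht] at h1
  exact h1 k rfl

theorem finite_support (P : ObjectProperty C) {k : ℕ} (g : C(Fin k → I, classifyingSpace C)) :
    (Set.ofPred fun c : {c // ¬ P c} => ∃ a, mass (fun d => d = c.1) (g a) ≠ 0).Finite := by
  refine (finite_nonzero_of_isCompact (φ := fun c : {c // ¬ P c} => mass fun d => d = c.1)
    (fun c => continuous_mass _) (fun c p => mass_nonneg _ p) (fun m F => ?_)
    (isCompact_range g.continuous)).subset fun c hc => ?_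
  · refine ((Set.finite_range F.obj).preimage Subtype.val_injective.injOn).subset ?_
    rintro c ⟨t, ht, h⟩
    by_contra hne
    refine h ?_
    rw [mass_chainPoint _ F ht, chainMass_eq_zero_iff _ F ht]
    exact fun k hk => absurd ⟨k, hk⟩ hne
  · obtain ⟨a, ha⟩ := hc
    exact ⟨g a, Set.mem_range_self a, ha⟩

variable {W : Type w} [LinearOrder W] {P : ObjectProperty C} {f : {x : C // ¬ P x} → W}

/-- The set `T` holds further objects of the same value. They are independent of `x`, so they cannot
lie in a common chain with it, and every other neighbour of `x` in the support was added before. The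
two ways of removing `x` depend on whether an earlier object has arrows from and to it. -/
theorem exists_homotopicRel_remove (hEnd : ∀ x : C, ¬ P x → ∀ e : x ⟶ x, e = 𝟙 x)
    (hf : IsMorseFunction P f) {n k : ℕ} (hk : k ≤ n + 1) (x : {x : C // ¬ P x})
    (hlk : IsNConnected n (classifyingSpace (descendingLink P f x))) {T : Finset {x : C // ¬ P x}}
    (hT : ∀ c ∈ T, f c = f x) (g : C(Fin k → I, classifyingSpace C))
    (hb : ∀ a ∈ Cube.boundary (Fin k), mass (fun c => ¬ P c) (g a) = 0)
    (hg : ∀ a, mass (fun c => ¬ (addedBefore P f x c ∨ c = x ∨ ∃ h, ⟨c, h⟩ ∈ T)) (g a) = 0) :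
    ∃ g' : C(Fin k → I, classifyingSpace C), g.HomotopicRel g' (Cube.boundary (Fin k)) ∧
      ∀ a, mass (fun c => ¬ (addedBefore P f x c ∨ ∃ h, ⟨c, h⟩ ∈ T)) (g' a) = 0 := by
  have hx := hEnd x.1 x.2
  have hQ : ¬ addedBefore P f x x.1 := by
    rintro (h | ⟨h, hlt⟩)
    exacts [x.2 h, lt_irrefl _ hlt]
  have hb' : ∀ a ∈ Cube.boundary (Fin k), mass (fun c => c = x.1) (g a) = 0 := fun a ha =>
    mass_eq_zero_mono (fun c hc => hc ▸ x.2) (hb a ha)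
  by_cases hno : ∃ z, addedBefore P f x z ∧ Nonempty (x.1 ⟶ z) ∧ Nonempty (z ⟶ x.1)
  · obtain ⟨z, hz, ⟨i⟩, ⟨r⟩⟩ := hno
    obtain ⟨g', h1, h2⟩ := exists_homotopicRel_of_retract hx i r (fun h => hQ (h ▸ hz)) g hg hb'
    refine ⟨g', h1, fun a => mass_eq_zero_mono (fun c hc hc' => hc ?_) (h2 a)⟩
    obtain ⟨h3, (h4 | h4 | h4) | rfl⟩ := hc'
    exacts [Or.inl h4, absurd h4 h3, Or.inr h4, Or.inl hz]
  · obtain ⟨g', h1, h2⟩ := exists_homotopicRel_of_link hx hQ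
      (fun z hz i r => hno ⟨z, hz, ⟨i⟩, ⟨r⟩⟩) hlk hk (fun y hy hne harr => by
        rcases hy with hy | hy | ⟨h, hy⟩
        · exact hy
        · exact absurd hy hne
        · have hne' : (⟨y, h⟩ : {x : C // ¬ P x}) ≠ x := fun h' => hne (congrArg Subtype.val h')
          rcases harr with ⟨⟨b⟩⟩ | ⟨⟨b⟩⟩
          · exact ((hf _ _ hne' (hT _ hy)).false b).elim
          · exact ((hf _ _ hne'.symm (hT _ hy).symm).false b).elim) g hg hb'
    refine ⟨g', h1, fun a => mass_eq_zero_mono (fun c hc hc' => hc ?_) (h2 a)⟩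
    obtain ⟨h3, (h4 | h4 | h4) | h4⟩ := hc'
    exacts [Or.inl h4, absurd h4 h3, Or.inr h4, Or.inl h4]

/-- Cubes with boundary in the full subcategory can be compressed into this subcategory. -/
theorem exists_homotopicRel_compress [WellFoundedLT W]
    (hEnd : ∀ x : C, ¬ P x → ∀ e : x ⟶ x, e = 𝟙 x) (hf : IsMorseFunction P f) {n k : ℕ}
    (hlk : ∀ x : {x : C // ¬ P x}, IsNConnected n (classifyingSpace (descendingLink P f x)))
    (hk : k ≤ n + 1) (g : C(Fin k → I, classifyingSpace C))
    (hb : ∀ a ∈ Cube.boundary (Fin k), mass (fun c => ¬ P c) (g a) = 0) :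
    ∃ g' : C(Fin k → I, classifyingSpace C), g.HomotopicRel g' (Cube.boundary (Fin k)) ∧
      ∀ a, mass (fun c => ¬ P c) (g' a) = 0 := by
  classical
  -- Either the support is already in `P`, or the finite support outside `P` has an object `y` of
  -- greatest value, and `T` collects the support objects of that value.
  have reduce : ∀ g : C(Fin k → I, classifyingSpace C),
      (∀ a ∈ Cube.boundary (Fin k), mass (fun c => ¬ P c) (g a) = 0) →
      (∀ y : {x : C // ¬ P x}, (∃ a, mass (fun d => d = y.1) (g a) ≠ 0) →
        ∀ T : Finset {x : C // ¬ P x}, (∀ c ∈ T, f c = f y) →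
        (∀ a, mass (fun c => ¬ (addedBefore P f y c ∨ ∃ h, ⟨c, h⟩ ∈ T)) (g a) = 0) →
        ∃ g' : C(Fin k → I, classifyingSpace C), g.HomotopicRel g' (Cube.boundary (Fin k)) ∧
          ∀ a, mass (fun c => ¬ P c) (g' a) = 0) →
      ∃ g' : C(Fin k → I, classifyingSpace C), g.HomotopicRel g' (Cube.boundary (Fin k)) ∧
        ∀ a, mass (fun c => ¬ P c) (g' a) = 0 := by
    intro g hb ih
    let S := (finite_support P g).toFinset
    have hS : ∀ c, c ∈ S ↔ ∃ a, mass (fun d => d = c.1) (g a) ≠ 0 :=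
      fun c => Set.Finite.mem_toFinset _
    rcases S.eq_empty_or_nonempty with h | h
    · refine ⟨g, ContinuousMap.HomotopicRel.refl g, fun a => mass_eq_zero_of_forall fun c hc => ?_⟩
      by_contra hne
      have : (⟨c, hc⟩ : {c // ¬ P c}) ∈ S := (hS _).2 ⟨a, hne⟩
      rw [h] at this
      simp at this
    · obtain ⟨y, hy, hmax⟩ := S.exists_max_image f h
      refine ih y ((hS y).1 hy) (S.filter fun c => f c = f y)
        (fun c hc => (Finset.mem_filter.1 hc).2) fun a => mass_eq_zero_of_forall fun c hc => ?_
      by_contra hne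
      refine hc ?_
      by_cases hP : P c
      · exact Or.inl (Or.inl hP)
      have h1 : (⟨c, hP⟩ : {c // ¬ P c}) ∈ S := (hS _).2 ⟨a, hne⟩
      rcases (hmax _ h1).lt_or_eq with h2 | h2
      · exact Or.inl (Or.inr ⟨hP, h2⟩)
      · exact Or.inr ⟨hP, Finset.mem_filter.2 ⟨h1, h2⟩⟩
  -- Well-founded induction on the greatest value, and within it induction on the finite set of
  -- objects of that value.
  have main : ∀ (w : W) (y : {x : C // ¬ P x}), f y = w → ∀ T : Finset {x : C // ¬ P x},
      (∀ c ∈ T, f c = f y) → ∀ g : C(Fin k → I, classifyingSpace C),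
      (∀ a ∈ Cube.boundary (Fin k), mass (fun c => ¬ P c) (g a) = 0) →
      (∀ a, mass (fun c => ¬ (addedBefore P f y c ∨ ∃ h, ⟨c, h⟩ ∈ T)) (g a) = 0) →
      ∃ g' : C(Fin k → I, classifyingSpace C), g.HomotopicRel g' (Cube.boundary (Fin k)) ∧
        ∀ a, mass (fun c => ¬ P c) (g' a) = 0 := by
    intro w
    induction w using WellFoundedLT.induction with
    | _ w ihw =>
    intro y hy T
    induction T using Finset.induction_on with
    | empty =>
      intro _ g hb hg
      -- With no object of value `w` left, the new greatest value is strictly smaller.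
      refine reduce g hb fun y' ⟨a, ha⟩ T' hT' hg' => ?_
      refine ihw (f y') ?_ y' rfl T' hT' g hb hg'
      by_contra hlt
      refine ha (mass_eq_zero_mono ?_ (hg a))
      rintro c rfl (h | ⟨h, h'⟩)
      · rcases h with h | ⟨h, h'⟩
        exacts [y'.2 h, hlt (hy ▸ h')]
      · simp at h'
    | insert x T hx ihT =>
      intro hT g hb hg
      have hxy := hT x (Finset.mem_insert_self x T)
      have hT' : ∀ c ∈ T, f c = f y := fun c hc => hT c (Finset.mem_insert_of_mem hc)
      have hQ : addedBefore P f x = addedBefore P f y := by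
        unfold addedBefore
        rw [hxy]
      obtain ⟨g₁, h1, h2⟩ := exists_homotopicRel_remove hEnd hf hk x (hlk x)
        (fun c hc => (hT' c hc).trans hxy.symm) g hb fun a => by
          refine mass_eq_zero_mono (fun c hc hc' => hc ?_) (hg a)
          rw [hQ]
          rcases hc' with h | ⟨h, h'⟩
          · exact Or.inl h
          · rcases Finset.mem_insert.1 h' with h' | h'
            · exact Or.inr (Or.inl (congrArg Subtype.val h'))
            · exact Or.inr (Or.inr ⟨h, h'⟩)
      rw [hQ] at h2
      obtain ⟨g₂, h3, h4⟩ := ihT hT' g₁ (fun a ha => h1.fst_eq_snd ha ▸ hb a ha) h2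
      exact ⟨g₂, h1.trans h3, h4⟩
  exact reduce g hb fun y _ T hT hg => main _ y rfl T hT g hb hg

end Compression

open unitInterval

/-! ### Induced maps are homomorphisms -/

section HomotopyGroupMap

variable {X Y : Type*} [TopologicalSpace X] [TopologicalSpace Y]

theorem homotopyGroupMap_mul (k : ℕ) (g : C(X, Y)) {x : X} {y : Y} (h : g x = y)
    (a b : HomotopyGroup.Pi (k + 1) X x) :
    homotopyGroupMap (k + 1) g h (a * b) =
      homotopyGroupMap (k + 1) g h a * homotopyGroupMap (k + 1) g h b := by
  induction a, b using Quotient.inductionOn₂ with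
  | _ p q =>
    -- Both products are represented by concatenation along coordinate 0, which is a case
    -- distinction and hence commutes with postcomposition.
    have h1 := HomotopyGroup.mul_spec (i := (0 : Fin (k + 1))) (p := p) (q := q)
    have h2 := HomotopyGroup.mul_spec (i := (0 : Fin (k + 1))) (p := genLoopMap (k + 1) g h p)
      (q := genLoopMap (k + 1) g h q)
    refine (congrArg (homotopyGroupMap (k + 1) g h) h1).trans (Eq.trans ?_ h2.symm)
    refine congrArg (fun r : GenLoop (Fin (k + 1)) Y y => (⟦r⟧ : HomotopyGroup.Pi (k + 1) Y y)) ?_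
    ext t
    exact apply_ite g _ _ _

end HomotopyGroupMap

/-! ### From compression to homotopy groups -/

section Restriction

variable {C : Type u} [Category.{v} C] (P : ObjectProperty C)

/-- The sub-chain of the objects in a full subcategory. -/
noncomputable def restrictChain {ι : Type} [LinearOrder ι] (F : ι ⥤ C) :
    {k // P (F.obj k)} ⥤ P.FullSubcategory :=
  P.lift ((Subtype.mono_coe fun k => P (F.obj k)).functor ⋙ F) fun k => k.2

theorem mass_classifyingMap (q : classifyingSpace P.FullSubcategory) :
    mass (fun c => ¬ P c) (classifyingMap P.ι q) = 0 := by
  obtain ⟨m, F, t, ht, rfl⟩ := exists_chainPoint q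
  rw [classifyingMap_chainPoint P.ι F ht, mass_chainPoint _ _ ht, chainMass_eq_zero_iff _ _ ht]
  exact fun k hk => absurd (F.obj k).2 hk

/-- Dropping the objects outside `P` and renormalizing inverts the inclusion on the points supported
on `P`. Thus compressed cubes lift continuously to the classifying space of the subcategory; `x₀` is
only a default value. -/
theorem exists_restriction (x₀ : P.FullSubcategory) :
    ∃ ρ : classifyingSpace C → classifyingSpace P.FullSubcategory,
      ContinuousOn ρ (mass P ⁻¹' Set.Ioi 0) ∧ (∀ q, ρ (classifyingMap P.ι q) = q) ∧
      ∀ p, mass (fun c => ¬ P c) p = 0 → classifyingMap P.ι (ρ p) = p := by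
  classical
  have hne : ∀ {ι : Type} [LinearOrder ι] [Fintype ι] [Nonempty ι] {F : ι ⥤ C} {t : ι → ℝ},
      0 < chainMass P F t → Nonempty {k // P (F.obj k)} := fun h =>
    ⟨⟨_, (exists_of_chainMass_pos h).choose_spec⟩⟩
  obtain ⟨ρ, hρ⟩ := exists_chainPoint_lift (C := C) (S := classifyingSpace P.FullSubcategory)
    (fun ι _ _ _ F t => if h : 0 < chainMass P F t then
      haveI := hne h
      chainPoint (restrictChain P F) (fun k => (chainMass P F t)⁻¹ * t k.1)
      else classifyingVertex x₀)
    (fun ι κ _ _ _ _ _ _ θ hθ G t ht => by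
      by_cases h : 0 < chainMass P G (pushWeight θ t)
      · have h' := h
        rw [← chainMass_comp _ hθ] at h'
        rw [dif_pos h, dif_pos h']
        have := hne h
        have : Nonempty {k // P (G.obj (θ k))} := hne h'
        exact chainPoint_eq_of_map (monotone_subtypeMap hθ fun k => P (G.obj k))
          (normalized_mem P (hθ.functor ⋙ G) ht h') rfl (pushWeight_normalized P hθ G t)
      · have h' := h
        rw [← chainMass_comp _ hθ] at h'
        rw [dif_neg h, dif_neg h'])
  have hρ' : ∀ (ι : Type) [LinearOrder ι] [Fintype ι] [Nonempty ι] (F : ι ⥤ C)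
      [Nonempty {k // P (F.obj k)}] (t : ι → ℝ), t ∈ stdSimplex ℝ ι → 0 < chainMass P F t →
      ρ (chainPoint F t) = chainPoint (restrictChain P F) fun k => (chainMass P F t)⁻¹ * t k.1 := by
    intro ι _ _ _ F _ t ht h
    rw [hρ ι F t ht, dif_pos h]
  have hρ₁ : ∀ (ι : Type) [LinearOrder ι] [Fintype ι] [Nonempty ι] (F : ι ⥤ C) (t : ι → ℝ),
      t ∈ stdSimplex ℝ ι → (∀ k, ¬ P (F.obj k) → t k = 0) → ∃ _ : Nonempty {k // P (F.obj k)},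
      ρ (chainPoint F t) = chainPoint (restrictChain P F) fun k => t k.1 := by
    intro ι _ _ _ F t ht h
    have h1 : mass P (chainPoint F t) = 1 := by
      have h2 := mass_add_mass_not P (chainPoint F t)
      have h3 : mass (fun c => ¬ P c) (chainPoint F t) = 0 := by
        rw [mass_chainPoint _ F ht, chainMass_eq_zero_iff _ F ht]
        exact h
      linarith
    rw [mass_chainPoint _ F ht] at h1
    have := hne (F := F) (t := t) (by rw [h1]; exact one_pos)
    refine ⟨this, ?_⟩
    rw [hρ' ι F t ht (by rw [h1]; exact one_pos), h1]
    simp only [inv_one, one_mul]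
  refine ⟨ρ, ?_, fun q => ?_, fun p hp => ?_⟩
  · refine continuousOn_of_chainPoint (isOpen_Ioi.preimage (continuous_mass _)) fun m F => ?_
    have hpos : ∀ t ∈ stdSimplex ℝ (Fin (m + 1)) ∩ chainPoint F ⁻¹' (mass P ⁻¹' Set.Ioi 0),
        0 < chainMass P F t := by
      rintro t ⟨h3, h4⟩
      rwa [Set.mem_preimage, Set.mem_preimage, mass_chainPoint _ F h3] at h4
    rcases Set.eq_empty_or_nonempty (stdSimplex ℝ (Fin (m + 1)) ∩ chainPoint F ⁻¹'
      (mass P ⁻¹' Set.Ioi 0)) with he | ⟨t₀, h₀⟩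
    · rw [he]
      exact continuousOn_empty _
    · have := hne (hpos t₀ h₀)
      refine ContinuousOn.congr ?_ fun t ht => hρ' _ F t ht.1 (hpos t ht)
      exact (continuousOn_chainPoint (restrictChain P F)).comp
        ((continuousOn_normalized P F).mono fun t ht => hpos t ht)
        fun t ht => normalized_mem P F ht.1 (hpos t ht)
  · obtain ⟨m, F, t, ht, rfl⟩ := exists_chainPoint q
    rw [classifyingMap_chainPoint P.ι F ht]
    have h0 : ∀ k, ¬ P ((F ⋙ P.ι).obj k) → t k = 0 := fun k hk => absurd (F.obj k).2 hk
    obtain ⟨_, h1⟩ := hρ₁ _ (F ⋙ P.ι) t ht h0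
    rw [h1]
    exact chainPoint_subtype (fun k => P ((F ⋙ P.ι).obj k)) F ht h0
  · obtain ⟨m, F, t, ht, rfl⟩ := exists_chainPoint p
    rw [mass_chainPoint _ F ht, chainMass_eq_zero_iff _ F ht] at hp
    obtain ⟨_, h1⟩ := hρ₁ _ F t ht hp
    rw [h1, classifyingMap_chainPoint P.ι _ (subtype_weight_mem ht hp)]
    exact chainPoint_subtype (fun k => P (F.obj k)) F ht hp

variable {P} {W : Type w} [LinearOrder W] [WellFoundedLT W] {f : {x : C // ¬ P x} → W}

/-- Surjectivity compresses a loop of dimension `k`; injectivity compresses a homotopy, of dimension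
`k + 1 ≤ n + 1`, which accounts for the bound on `k`. -/
theorem homotopyGroupMap_bijective (hEnd : ∀ x : C, ¬ P x → ∀ e : x ⟶ x, e = 𝟙 x)
    (hf : IsMorseFunction P f) {n k : ℕ}
    (hlk : ∀ x : {x : C // ¬ P x}, IsNConnected n (classifyingSpace (descendingLink P f x)))
    (hk : k ≤ n) (x₀ : P.FullSubcategory) : Function.Bijective
      (homotopyGroupMap k (classifyingMap P.ι) (classifyingMap_vertex P.ι x₀)) := by
  obtain ⟨ρ, hρ, h1, h2⟩ := exists_restriction P x₀
  have hpos : ∀ p, mass (fun c => ¬ P c) p = 0 → 0 < mass P p := fun p hp => by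
    have := mass_add_mass_not P p
    linarith
  have hvertex := classifyingMap_vertex P.ι x₀
  constructor
  · intro a b
    induction a, b using Quotient.inductionOn₂ with
    | _ p q =>
      intro h
      obtain ⟨H⟩ : (genLoopMap k (classifyingMap P.ι) hvertex p).1.HomotopicRel
        (genLoopMap k (classifyingMap P.ι) hvertex q).1 (Cube.boundary (Fin k)) := Quotient.exact h
      have h00 : ∀ a, H (0, a) = classifyingMap P.ι (p a) := H.apply_zero
      have h01 : ∀ a, H (1, a) = classifyingMap P.ι (q a) := H.apply_one
      have hbd : ∀ s, ∀ a ∈ Cube.boundary (Fin k), H (s, a) = classifyingMap P.ι (p a) :=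
        fun s a ha => H.eq_fst s ha
      -- The homotopy as a cube with time as coordinate 0. Its two end faces and its sides all come
      -- from the subcategory.
      let G : C(Fin (k + 1) → I, classifyingSpace C) :=
        ⟨fun a => H (a 0, Fin.tail a), by unfold Fin.tail; fun_prop⟩
      obtain ⟨G', hG, hG'⟩ := exists_homotopicRel_compress hEnd hf hlk
        (Nat.succ_le_succ hk) G (by
          rintro a ⟨j, hj⟩
          change mass _ (H (a 0, Fin.tail a)) = 0
          revert hj
          refine Fin.cases (fun hj => ?_) (fun j hj => ?_) j
          · rcases hj with hj | hj
            · rw [hj, h00]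
              exact mass_classifyingMap P _
            · rw [hj, h01]
              exact mass_classifyingMap P _
          · rw [hbd _ _ ⟨j, hj⟩]
            exact mass_classifyingMap P _)
      have heq : ∀ a ∈ Cube.boundary (Fin (k + 1)), G' a = H (a 0, Fin.tail a) :=
        fun a ha => (hG.fst_eq_snd ha).symm
      -- The compressed cube, pulled back along `ρ`, is the required homotopy; on the boundary it is
      -- unchanged, so its ends are still `p` and `q`.
      have hc : Continuous fun r : I × (Fin k → I) =>
          ρ (G' (Fin.cons r.1 r.2 : Fin (k + 1) → I)) :=
        hρ.comp_continuous (by fun_prop) fun r => hpos _ (hG' _)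
      refine Quotient.sound (homotopicRel_of_formula _ hc (fun a => ?_) (fun a => ?_)
        fun s a ha => ?_)
      · rw [heq _ ⟨0, Or.inl rfl⟩]
        exact (congrArg ρ (h00 a)).trans (h1 _)
      · rw [heq _ ⟨0, Or.inr rfl⟩]
        exact (congrArg ρ (h01 a)).trans (h1 _)
      · obtain ⟨j, hj⟩ := ha
        rw [heq _ ⟨j.succ, hj⟩]
        exact (congrArg ρ (hbd s a ⟨j, hj⟩)).trans (h1 _)
  · intro b
    induction b using Quotient.inductionOn with
    | _ p =>
      obtain ⟨g, hg, hg'⟩ := exists_homotopicRel_compress hEnd hf hlk (hk.trans (Nat.le_succ n)) p.1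
        fun a ha => by
          rw [p.2 a ha, ← hvertex]
          exact mass_classifyingMap P _
      have hc : Continuous fun a => ρ (g a) :=
        hρ.comp_continuous g.continuous fun a => hpos _ (hg' a)
      let q : GenLoop (Fin k) (classifyingSpace P.FullSubcategory) (classifyingVertex x₀) :=
        ⟨⟨_, hc⟩, fun a ha => by
          change ρ (g a) = _
          rw [← hg.fst_eq_snd ha, p.2 a ha, ← hvertex, h1]⟩
      have hq : (genLoopMap k (classifyingMap P.ι) hvertex q).1 = g :=
        ContinuousMap.ext fun a => h2 _ (hg' a)
      refine ⟨⟦q⟧, Quotient.sound ?_⟩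
      change (genLoopMap k (classifyingMap P.ι) hvertex q).1.HomotopicRel p.1 _
      rw [hq]
      exact hg.symm

end Restriction

theorem theorem34332 {C : Type u} [Category.{v} C] (P : ObjectProperty C)
    (hEnd : ∀ x : C, ¬ P x → ∀ e : x ⟶ x, e = 𝟙 x)
    {W : Type w} [LinearOrder W] [WellFoundedLT W]
    (f : {x : C // ¬ P x} → W) (hf : IsMorseFunction P f)
    (n : ℕ)
    (hlk : ∀ x : {x : C // ¬ P x}, IsNConnected n (classifyingSpace (descendingLink P f x)))
    (x₀ : P.FullSubcategory) :
    Function.Bijective (homotopyGroupMap 0 (classifyingMap P.ι) (classifyingMap_vertex P.ι x₀)) ∧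
    ∀ k : ℕ, k + 1 ≤ n →
      ∃ e : HomotopyGroup.Pi (k + 1) (classifyingSpace P.FullSubcategory) (classifyingVertex x₀) ≃*
          HomotopyGroup.Pi (k + 1) (classifyingSpace C) (classifyingVertex (P.ι.obj x₀)),
        ∀ a, e a = homotopyGroupMap (k + 1) (classifyingMap P.ι) (classifyingMap_vertex P.ι x₀) a :=
  ⟨homotopyGroupMap_bijective hEnd hf hlk (Nat.zero_le n) x₀, fun k hk =>
    ⟨MulEquiv.ofBijective (MulHom.mk _ (homotopyGroupMap_mul k (classifyingMap P.ι)
      (classifyingMap_vertex P.ι x₀))) (homotopyGroupMap_bijective hEnd hf hlk hk x₀),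
      fun _ => rfl⟩⟩
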